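/- Let $(M,g)$ be a closed (compact, without boundary, nonempty) smooth Riemannian manifold of dimension $n\ge 2$, let $L^2(M)$ be the space of complex-valued functions that are square integrable for the Riemannian volume, with $\langle\cdot,\cdot\rangle$ its inner product (linear in the first variable), and let $-\Delta_g$ be the nonnegative self-adjoint Laplace–Beltrami operator on $L^2(M)$. Let $\alpha,\beta\in(0,1)$. There are eigenvalues $0=\lambda_0\le\lambda_1\le\lambda_2\le\cdots\to+\infty$ of $-\Delta_g$ and an orthonormal basis $(\varphi_k)_{k\ge 0}$ of $L^2(M)$ with $-\Delta_g\varphi_k=\lambda_k\varphi_k$. For any such basis and $r>0$ put $$H^r(M)=\Big\{u\in L^2(M):\sum_k\lambda_k^r|\langle u,\varphi_k\rangle|^2<\infty\Big\},\quad \|u\|_{H^r}^2=\sum_k(1+\lambda_k^r)|\langle u,\varphi_k\rangle|^2,\quad (-\Delta_g)^{r}u=\sum_k\lambda_k^{r}\langle u,\varphi_k\rangle\varphi_k\ \ (u\in H^{2r}(M)).$$ Let $$\partial_t^\alpha u(t)=\frac1{\Gamma(1-\alpha)}\int_0^t\frac{u'(\tau)}{(t-\tau)^\alpha}\,d\tau,\qquad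 E_{a,b}(z)=\sum_{k=0}^\infty\frac{z^k}{\Gamma(ka+b)}$$ be the Caputo derivative and the Mittag–Leffler function. Then for every $f\in C^2_c((0,\infty);L^2(M))$ there is exactly one $u$ with $$u\in C^1([0,\infty);H^{2\beta}(M))\cap L^\infty(0,\infty;H^{2\beta}(M)),\qquad \partial_tu\in L^\infty(0,\infty;H^{2\beta}(M)),$$ such that $$i\,\partial_t^\alpha u(t)+(-\Delta_g)^\beta u(t)=f(t)\ \text{ in } L^2(M)\text{ for all } t>0,\qquad u(0)=0.$$ Moreover, for every $t\ge0$, $$u(t)=\sum_{k=0}^\infty\Big(\int_0^tK_k(t-\tau)\,\langle f(\tau),\varphi_k\rangle\,d\tau\Big)\varphi_k\ \text{ in }H^{2\beta}(M),\qquad K_k(t)=-i\,t^{\alpha-1}E_{\alpha,\alpha}\big(i\lambda_k^\beta t^\alpha\big).$$ -/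

import Mathlib

open Set Filter Topology MeasureTheory
open scoped Manifold ContDiff ENNReal InnerProductSpace

namespace FracSchrodinger

noncomputable section

/-! ### Closed Riemannian manifolds: volume, Dirichlet form, Laplace-Beltrami operator -/

/-- Smooth Riemannian metrics on an `n`-dimensional smooth manifold `M` without boundary. -/
abbrev Metric (n : ℕ) (M : Type*) [TopologicalSpace M]
    [ChartedSpace (EuclideanSpace ℝ (Fin n)) M] [IsManifold (𝓡 n) ∞ M] :=
  Bundle.ContMDiffRiemannianMetric (𝓡 n) ∞ (EuclideanSpace ℝ (Fin n))
    (fun x : M => TangentSpace (𝓡 n) x)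

variable {n : ℕ} {M : Type*} [TopologicalSpace M]
  [ChartedSpace (EuclideanSpace ℝ (Fin n)) M] [IsManifold (𝓡 n) ∞ M]

/-- The `i`-th vector of the standard basis of the tangent space at `x` (which Mathlib identifies
with the model space through the preferred chart at `x`). -/
def stdTangent (x : M) (i : Fin n) : TangentSpace (𝓡 n) x :=
  (EuclideanSpace.single i (1 : ℝ) : EuclideanSpace ℝ (Fin n))

/-- The coordinate vector field `∂/∂yᵢ` of the preferred chart at `x₀`, taken at the point with
coordinates `y`. -/
def coordVector (x₀ : M) (y : EuclideanSpace ℝ (Fin n)) (i : Fin n) :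
    TangentSpace (𝓡 n) ((chartAt (EuclideanSpace ℝ (Fin n)) x₀).symm y) :=
  mfderiv (𝓡 n) (𝓡 n) (chartAt (EuclideanSpace ℝ (Fin n)) x₀).symm y
    (EuclideanSpace.single i (1 : ℝ) : EuclideanSpace ℝ (Fin n))

/-- The matrix `(g_{ij}(y))` of the metric in the preferred chart at `x₀`. -/
def chartGram (g : Metric n M) (x₀ : M) (y : EuclideanSpace ℝ (Fin n)) :
    Matrix (Fin n) (Fin n) ℝ :=
  Matrix.of fun i j => g.inner ((chartAt (EuclideanSpace ℝ (Fin n)) x₀).symm y)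
    (coordVector x₀ y i) (coordVector x₀ y j)

variable [MeasurableSpace M]

/-- The Riemannian volume of the part of `M` covered by the chart at `x₀`: the measure
`√(det g_{ij}(y)) dy` on the image of the chart, carried over to `M`. -/
def chartVolume (g : Metric n M) (x₀ : M) : Measure M :=
  Measure.map (chartAt (EuclideanSpace ℝ (Fin n)) x₀).symm
    ((volume.restrict (chartAt (EuclideanSpace ℝ (Fin n)) x₀).target).withDensity
      fun y => ENNReal.ofReal (Real.sqrt (chartGram g x₀ y).det))

/-- The Riemannian volume measure of `(M, g)`: the least measure that dominates the volume measures
of the charts. As these agree where two charts overlap, this is the measure that is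
`√(det g_{ij}) dy` in each chart. -/
def riemVolume (g : Metric n M) : Measure M := ⨆ x₀ : M, chartVolume g x₀

/-- `L²(M)`: complex-valued, with respect to the Riemannian volume. -/
abbrev L2 (g : Metric n M) := Lp ℂ 2 (riemVolume g)

/-- Complex-valued smooth functions on `M`. -/
abbrev SmoothFn (n : ℕ) (M : Type*) [TopologicalSpace M]
    [ChartedSpace (EuclideanSpace ℝ (Fin n)) M] :=
  ContMDiffMap (𝓡 n) 𝓘(ℝ, ℂ) M ℂ ∞

/-- The partial derivative of `φ` at `x` along `stdTangent x i`. -/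
def partialDeriv (φ : SmoothFn n M) (x : M) (i : Fin n) : ℂ :=
  (mfderiv (𝓡 n) 𝓘(ℝ, ℂ) φ x (stdTangent x i) : ℂ)

/-- The sesquilinear product `⟨dφ, dψ⟩_g = ∑ g^{ij} ∂ᵢφ conj(∂ⱼψ)` at the point `x`, where `(g^{ij})`
is the inverse of the matrix of `g`. -/
def gradInner (g : Metric n M) (φ ψ : SmoothFn n M) (x : M) : ℂ :=
  ∑ i, ∑ j,
    (((Matrix.of fun k l => g.inner x (stdTangent x k) (stdTangent x l) :
        Matrix (Fin n) (Fin n) ℝ)⁻¹ i j : ℝ) : ℂ) *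
      partialDeriv φ x i * (starRingEnd ℂ) (partialDeriv ψ x j)

/-- The Dirichlet form `∫_M ⟨dφ, dψ⟩_g dV_g`, which by Green's formula is `⟨-Δ_g φ, ψ⟩`. -/
def dirichlet (g : Metric n M) (φ ψ : SmoothFn n M) : ℂ :=
  ∫ x, gradInner g φ ψ x ∂(riemVolume g)

/-- `IsNegLaplacian g u w` says that `u` lies in the domain of the self-adjoint operator `-Δ_g` on
`L²(M)` and that `-Δ_g u = w`: `u` is in `H¹(M)`, the closure of the smooth functions (there are
smooth `φₖ → u` in `L²(M)` that are Cauchy for the Dirichlet form), and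
`∫ ⟨du, dψ⟩_g = ∫ w conj ψ` for all smooth `ψ`, the left side being `lim ∫ ⟨dφₖ, dψ⟩_g`. -/
def IsNegLaplacian (g : Metric n M) (u w : L2 g) : Prop :=
  ∃ φ : ℕ → SmoothFn n M,
    Tendsto (fun k => eLpNorm (fun x => φ k x - u x) 2 (riemVolume g)) atTop (𝓝 0) ∧
    (∀ ε > 0, ∃ N, ∀ k ≥ N, ∀ l ≥ N, (dirichlet g (φ k - φ l) (φ k - φ l)).re < ε) ∧
    ∀ ψ : SmoothFn n M, Tendsto (fun k => dirichlet g (φ k) ψ) atTop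
      (𝓝 (∫ x, w x * (starRingEnd ℂ) (ψ x) ∂(riemVolume g)))

/-- The eigenvalues `0 = λ₀ ≤ λ₁ ≤ λ₂ ≤ ⋯ → ∞` of `-Δ_g` together with an orthonormal basis
`φ₀, φ₁, …` of `L²(M)` consisting of corresponding eigenfunctions. -/
structure EigenBasis (g : Metric n M) where
  /-- the eigenfunctions -/
  φ : HilbertBasis ℕ ℂ (L2 g)
  /-- the eigenvalues -/
  lam : ℕ → ℝ
  eigen : ∀ k, IsNegLaplacian g (φ k) ((lam k : ℂ) • φ k)
  lam_zero : lam 0 = 0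
  lam_mono : Monotone lam
  lam_tendsto : Tendsto lam atTop atTop

variable {g : Metric n M}

/-! ### Sobolev spaces and fractional powers -/

theorem EigenBasis.lam_nonneg (e : EigenBasis g) (k : ℕ) : 0 ≤ e.lam k :=
  e.lam_zero ▸ e.lam_mono (Nat.zero_le k)

/-- The Fourier coefficient `⟨u, φₖ⟩` (the `L²`-product being linear in `u`). -/
def EigenBasis.coeff (e : EigenBasis g) (k : ℕ) (u : L2 g) : ℂ := ⟪e.φ k, u⟫_ℂ

theorem EigenBasis.coeff_summable (e : EigenBasis g) (u : L2 g) :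
    Summable fun k => ‖e.coeff k u‖ ^ 2 := by
  have h := (lp.memℓp (e.φ.repr u)).summable (by norm_num)
  simpa [EigenBasis.coeff, HilbertBasis.repr_apply_apply] using h

/-- The set `{u ∈ L²(M) : ∑ λₖ^r |⟨u, φₖ⟩|² < ∞}`, as a subspace. -/
def EigenBasis.sobolevSubmodule (e : EigenBasis g) (r : ℝ) : Submodule ℂ (L2 g) where
  carrier := {u | Summable fun k => e.lam k ^ r * ‖e.coeff k u‖ ^ 2}
  zero_mem' := by simp [EigenBasis.coeff]
  add_mem' := by
    intro u v hu hv
    refine Summable.of_nonneg_of_le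
      (fun k => mul_nonneg (Real.rpow_nonneg (e.lam_nonneg k) r) (sq_nonneg _))
      (fun k => ?_) ((hu.add hv).mul_left 2)
    have h0 := Real.rpow_nonneg (e.lam_nonneg k) r
    have h1 : ‖e.coeff k (u + v)‖ ^ 2 ≤ 2 * (‖e.coeff k u‖ ^ 2 + ‖e.coeff k v‖ ^ 2) := by
      have h2 : ‖e.coeff k (u + v)‖ ≤ ‖e.coeff k u‖ + ‖e.coeff k v‖ := by
        simp only [EigenBasis.coeff, inner_add_right]
        exact norm_add_le _ _
      nlinarith [norm_nonneg (e.coeff k (u + v)), sq_nonneg (‖e.coeff k u‖ - ‖e.coeff k v‖),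
        norm_nonneg (e.coeff k u), norm_nonneg (e.coeff k v)]
    calc _ ≤ e.lam k ^ r * (2 * (‖e.coeff k u‖ ^ 2 + ‖e.coeff k v‖ ^ 2)) :=
          mul_le_mul_of_nonneg_left h1 h0
      _ = _ := by ring
  smul_mem' := by
    intro c u hu
    have h := hu.mul_left (‖c‖ ^ 2)
    refine h.congr fun k => ?_
    simp only [EigenBasis.coeff, inner_smul_right, norm_mul]
    ring

/-- The Sobolev space `H^r(M) = {u ∈ L²(M) : ∑ λₖ^r |⟨u, φₖ⟩|² < ∞}`. -/
def EigenBasis.H (e : EigenBasis g) (r : ℝ) := ↥(e.sobolevSubmodule r)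

namespace EigenBasis

variable (e : EigenBasis g) (r : ℝ)

instance : AddCommGroup (e.H r) := inferInstanceAs (AddCommGroup ↥(e.sobolevSubmodule r))
instance : Module ℂ (e.H r) := inferInstanceAs (Module ℂ ↥(e.sobolevSubmodule r))

variable {e r}

/-- The inclusion of `H^r(M)` in `L²(M)`. -/
def H.toL2 : e.H r →ₗ[ℂ] L2 g := (e.sobolevSubmodule r).subtype

theorem H.summable (u : e.H r) : Summable fun k => e.lam k ^ r * ‖e.coeff k u.toL2‖ ^ 2 := u.2

variable (e r)

theorem weight_sq (k : ℕ) : Real.sqrt (1 + e.lam k ^ r) ^ 2 = 1 + e.lam k ^ r :=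
  Real.sq_sqrt (add_nonneg zero_le_one (Real.rpow_nonneg (e.lam_nonneg k) r))

/-- The weighted coefficient sequence `(1 + λₖ^r)^{1/2} ⟨u, φₖ⟩`, an element of `ℓ²`. -/
def weighted : e.H r →ₗ[ℂ] lp (fun _ : ℕ => ℂ) 2 where
  toFun u := ⟨fun k => ((Real.sqrt (1 + e.lam k ^ r) : ℝ) : ℂ) * e.coeff k u.toL2, by
    refine memℓp_gen ?_
    refine ((e.coeff_summable u.toL2).add u.summable).congr fun k => ?_
    have h := weight_sq e r k
    simp only [ENNReal.toReal_ofNat, Real.rpow_ofNat, norm_mul, mul_pow, Complex.norm_real,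
      Real.norm_eq_abs, sq_abs, h]
    ring⟩
  map_add' u v := by
    ext k
    rw [lp.coeFn_add, Pi.add_apply]
    simp [coeff, inner_add_right, mul_add]
  map_smul' c u := by
    ext k
    simp [coeff, inner_smul_right]
    ring

theorem weighted_injective : Function.Injective (weighted e r) := by
  intro u v huv
  apply Subtype.ext
  apply e.φ.repr.injective
  ext k
  have h := congrArg (fun s : lp (fun _ : ℕ => ℂ) 2 => s k) huv
  have hw : ((Real.sqrt (1 + e.lam k ^ r) : ℝ) : ℂ) ≠ 0 := by
    have h0 := Real.rpow_nonneg (e.lam_nonneg k) r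
    exact_mod_cast (Real.sqrt_pos.2 (by linarith)).ne'
  have h' := mul_left_cancel₀ hw h
  rw [HilbertBasis.repr_apply_apply, HilbertBasis.repr_apply_apply]
  exact h'

/-- The norm of `H^r(M)`: `‖u‖² = ∑ (1 + λₖ^r) |⟨u, φₖ⟩|²`. -/
instance : NormedAddCommGroup (e.H r) :=
  NormedAddCommGroup.induced (e.H r) (lp (fun _ : ℕ => ℂ) 2) (weighted e r)
    (weighted_injective e r)

instance : NormedSpace ℂ (e.H r) where
  norm_smul_le c u := by
    change ‖weighted e r (c • u)‖ ≤ ‖c‖ * ‖weighted e r u‖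
    rw [map_smul]
    exact norm_smul_le c _

/-- The eigenfunction `φₖ` as an element of `H^r(M)`. -/
def φH (k : ℕ) : e.H r := ⟨e.φ k, by
  refine summable_of_ne_finset_zero (s := {k}) fun j hj => ?_
  have hjk : j ≠ k := by simpa using hj
  simp [coeff, e.φ.orthonormal.inner_eq_zero hjk]⟩

variable {r}

/-- The fractional power `(-Δ_g)^r u = ∑ λₖ^r ⟨u, φₖ⟩ φₖ`, for `u ∈ H^{2r}(M)`; the series
converges in `L²(M)`. -/
def fracLaplacian (u : e.H (2 * r)) : L2 g :=
  ∑' k, (((e.lam k ^ r : ℝ) : ℂ) * e.coeff k u.toL2) • e.φ k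

end EigenBasis

/-! ### Caputo derivatives, Mittag-Leffler functions, solutions -/

/-- The time derivative of a curve defined on `[0, ∞)` (one-sided at `0`). -/
def timeDeriv {E : Type*} [NormedAddCommGroup E] [NormedSpace ℝ E] (u : ℝ → E) (t : ℝ) : E :=
  derivWithin u (Ici 0) t

/-- The Caputo derivative `∂_t^α u(t) = Γ(1-α)⁻¹ ∫₀ᵗ (t-τ)^{-α} u'(τ) dτ`. -/
def caputo {E : Type*} [NormedAddCommGroup E] [NormedSpace ℝ E] (α : ℝ) (u : ℝ → E) (t : ℝ) : E :=
  (Real.Gamma (1 - α))⁻¹ • ∫ τ in (0 : ℝ)..t, (t - τ) ^ (-α) • timeDeriv u τ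

/-- The two-parameter Mittag-Leffler function `E_{a,b}(z) = ∑ zᵏ / Γ(ka+b)`. -/
def mittagLeffler (a b : ℝ) (z : ℂ) : ℂ := ∑' k : ℕ, z ^ k / (Real.Gamma (k * a + b) : ℂ)

/-- The kernel `K_{lam}(t) = -i t^{α-1} E_{α,α}(i lam^β t^α)`, for `t > 0`. -/
def kernel (α β lam t : ℝ) : ℂ :=
  -Complex.I * ((t ^ (α - 1) : ℝ) : ℂ) *
    mittagLeffler α α (Complex.I * ((lam ^ β : ℝ) : ℂ) * ((t ^ α : ℝ) : ℂ))

/-- `f ∈ C²_c((0, ∞); E)`, `f` being extended by zero to the real line. -/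
structure IsSource {E : Type*} [NormedAddCommGroup E] [NormedSpace ℝ E] (f : ℝ → E) : Prop where
  contDiff : ContDiff ℝ 2 f
  hasCompactSupport : HasCompactSupport f
  tsupport_subset : tsupport f ⊆ Ioi 0

/-- `u` (considered on `[0, ∞)`) solves `i ∂_t^α u + (-Δ_g)^β u = f` for `t > 0`, `u(0) = 0`, with
`u ∈ C¹([0, ∞); H^{2β}) ∩ L^∞(0, ∞; H^{2β})` and `∂_t u ∈ L^∞(0, ∞; H^{2β})`. -/
structure IsSolution (e : EigenBasis g) (α β : ℝ) (f : ℝ → L2 g) (u : ℝ → e.H (2 * β)) :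
    Prop where
  contDiffOn : ContDiffOn ℝ 1 u (Ici 0)
  memLp_top : MemLp u ⊤ (volume.restrict (Ioi 0))
  deriv_memLp_top : MemLp (timeDeriv u) ⊤ (volume.restrict (Ioi 0))
  equation : ∀ t > 0,
    Complex.I • caputo α (fun s => (u s).toL2) t + e.fracLaplacian (u t) = f t
  initial : u 0 = 0

end

end FracSchrodinger

namespace FracSchrodinger

noncomputable section

/-! ### Convolution on the half-line -/

/-! In an eigenbasis the equation decouples into scalar equations `i ∂_t^α v + μ v = h` with `μ =
λₖ^β ≥ 0`. Write `k_p(t) = t^{p-1}/Γ(p)`. The Beta integral is the semigroup law `k_p * k_q =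
k_{p+q}`, and both `E(t) = E_{α,1}(iμt^α)` and `t^{α-1} E_{α,α}(iμt^α)` are series of such kernels.
Termwise convolution gives `E' = iμ t^{α-1} E_{α,α}(iμt^α)`, `∂_t^α E = iμE` and `E(0) = 1`. For `v
= K * h` it gives `μ v = h - E * h'` and `i ∂_t^α v = E * h'` (`mul_lconv_solKernel`,
`lconv_solKernel_eq`).

What makes the series over all modes converge is `|E| ≤ 1`, uniformly in `μ` and `t`. It follows
from the energy inequality `∂_t^α |y|² ≤ 2 Re (conj y ∂_t^α y)` (`re_lconv_sub_nonpos`): the right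
side vanishes when `∂_t^α y = iμy` with `μ` real, so `|y|` never exceeds its initial value
(`norm_le_of_caputo_eq`). Hence `μ |v| ≤ 2 ∫ |h'|`, and the `H^{2β}` norm of `u` is controlled by
`f'`. As `v' = K * h'`, that of `∂_t u` is controlled by `f''`; this is where two derivatives of `f`
enter. The modes with `μ = 0` are handled separately, using the compact support of `f`
(`norm_lconv_zero_le`). The same energy inequality, applied to each coefficient of the difference of
two solutions, gives uniqueness.

The eigenbasis comes from the Dirichlet form on smooth functions. Adding the `L²` product to it and
completing gives `H¹(M)`, with a map `J` to `L²(M)`. Compactness of `J` is a Rellich inequality: in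
a chart, small convex cells satisfy the Poincaré inequality, so up to finitely many cell integrals
the `L²` norm is a small multiple of the Dirichlet norm (`IsGoodBall.rellichOn`); compactness of `M`
globalizes this. Then `J J*` is compact, positive and injective, and its eigenvalues `1/ν` give the
spectrum `λ = ν - 1`. The constant function forces `λ₀ = 0` (`exists_hilbertBasis_of_form`). -/

theorem integral_sub_rpow_mul_rpow {p q t : ℝ} (hp : 0 < p) (hq : 0 < q) (ht : 0 < t) :
    ∫ s in (0 : ℝ)..t, (t - s) ^ (p - 1) * s ^ (q - 1) =
      t ^ (p + q - 1) * (Real.Gamma p * Real.Gamma q / Real.Gamma (p + q)) := by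
  have h := Complex.betaIntegral_scaled q p ht
  rw [Complex.betaIntegral_eq_Gamma_mul_div _ _ (by simpa) (by simpa)] at h
  have h1 : ∫ x in (0 : ℝ)..t, (x : ℂ) ^ ((q : ℂ) - 1) * ((t : ℂ) - x) ^ ((p : ℂ) - 1) =
      ∫ s in (0 : ℝ)..t, (((t - s) ^ (p - 1) * s ^ (q - 1) : ℝ) : ℂ) := by
    refine intervalIntegral.integral_congr fun s hs => ?_
    rw [uIcc_of_le ht.le] at hs
    have e1 := Complex.ofReal_cpow hs.1 (q - 1)
    have e2 := Complex.ofReal_cpow (sub_nonneg.2 hs.2) (p - 1)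
    push_cast at e1 e2 ⊢
    rw [e1, e2, mul_comm]
  rw [h1, intervalIntegral.integral_ofReal] at h
  have e3 := Complex.ofReal_cpow ht.le (q + p - 1)
  push_cast at e3
  rw [← e3, ← Complex.ofReal_add, Complex.Gamma_ofReal, Complex.Gamma_ofReal,
    Complex.Gamma_ofReal] at h
  norm_cast at h
  rw [h, add_comm q p, mul_comm (Real.Gamma q)]

theorem intervalIntegrable_sub_rpow_mul_rpow {p q t : ℝ} (hp : 0 < p) (hq : 0 < q) (ht : 0 < t) :
    IntervalIntegrable (fun s => (t - s) ^ (p - 1) * s ^ (q - 1)) volume 0 t := by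
  -- A non-integrable function has integral 0 by convention, whereas the Beta value is positive.
  by_contra h
  have h0 := intervalIntegral.integral_undef h
  rw [integral_sub_rpow_mul_rpow hp hq ht] at h0
  have h1 := Real.Gamma_pos_of_pos hp
  have h2 := Real.Gamma_pos_of_pos hq
  have h3 := Real.Gamma_pos_of_pos (add_pos hp hq)
  have : 0 < t ^ (p + q - 1) * (Real.Gamma p * Real.Gamma q / Real.Gamma (p + q)) := by positivity
  exact this.ne' h0

/-- The convolution `∫₀ᵗ a(t-s) b(s) ds`. -/
def lconv (a b : ℝ → ℂ) (t : ℝ) : ℂ := ∫ s in (0 : ℝ)..t, a (t - s) * b s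

/-- Continuous functions on `(0, ∞)` that are `O(t^{p-1})` on bounded sets. -/
structure PowBdd (p : ℝ) (a : ℝ → ℂ) : Prop where
  cont : ContinuousOn a (Ioi 0)
  bdd : ∀ T, 0 < T → ∃ C, 0 ≤ C ∧ ∀ t ∈ Ioc 0 T, ‖a t‖ ≤ C * t ^ (p - 1)

theorem PowBdd.of_continuous {a : ℝ → ℂ} (ha : ContinuousOn a (Ici 0)) : PowBdd 1 a where
  cont := ha.mono Ioi_subset_Ici_self
  bdd T _ := by
    obtain ⟨C, hC⟩ := isCompact_Icc.exists_bound_of_continuousOn (ha.mono (Icc_subset_Ici_self (b := 0) (a := T)))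
    refine ⟨max C 0, le_max_right _ _, fun t ht => ?_⟩
    simpa using Or.inl (hC t ⟨ht.1.le, ht.2⟩)

theorem PowBdd.const_mul {p : ℝ} {a : ℝ → ℂ} (ha : PowBdd p a) (c : ℂ) :
    PowBdd p (fun t => c * a t) where
  cont := continuousOn_const.mul ha.cont
  bdd T hT := by
    obtain ⟨C, hC, h⟩ := ha.bdd T hT
    refine ⟨‖c‖ * C, by positivity, fun t ht => ?_⟩
    rw [norm_mul, mul_assoc]
    exact mul_le_mul_of_nonneg_left (h t ht) (norm_nonneg _)

theorem PowBdd.mul_continuous {p : ℝ} {a b : ℝ → ℂ} (ha : PowBdd p a)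
    (hb : ContinuousOn b (Ici 0)) : PowBdd p (fun t => b t * a t) where
  cont := (hb.mono Ioi_subset_Ici_self).mul ha.cont
  bdd T hT := by
    obtain ⟨C, hC, h⟩ := ha.bdd T hT
    obtain ⟨D, hD⟩ := isCompact_Icc.exists_bound_of_continuousOn (hb.mono (Icc_subset_Ici_self (b := 0) (a := T)))
    have hD0 : 0 ≤ D := (norm_nonneg _).trans (hD 0 ⟨le_rfl, hT.le⟩)
    refine ⟨D * C, by positivity, fun t ht => ?_⟩
    rw [norm_mul, mul_assoc]
    exact mul_le_mul (hD t ⟨ht.1.le, ht.2⟩) (h t ht) (norm_nonneg _) hD0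

variable {p q r t : ℝ} {a b c : ℝ → ℂ}

theorem PowBdd.intervalIntegrable_mul (ha : PowBdd p a) (hb : PowBdd q b)
    (hp : 0 < p) (hq : 0 < q) (ht : 0 < t) :
    IntervalIntegrable (fun s => a (t - s) * b s) volume 0 t := by
  obtain ⟨C, hC, h⟩ := ha.bdd t ht
  obtain ⟨D, hD, h'⟩ := hb.bdd t ht
  have hi := ((intervalIntegrable_sub_rpow_mul_rpow hp hq ht).const_mul (C * D))
  rw [intervalIntegrable_iff_integrableOn_Ioo_of_le ht.le] at hi ⊢
  refine hi.mono' ?_ ?_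
  · refine ContinuousOn.aestronglyMeasurable ?_ measurableSet_Ioo
    refine (ha.cont.comp (by fun_prop) fun s hs => ?_).mul (hb.cont.mono fun s hs => hs.1)
    exact sub_pos.2 hs.2
  · filter_upwards [ae_restrict_mem measurableSet_Ioo] with s hs
    rw [norm_mul]
    calc _ ≤ (C * (t - s) ^ (p - 1)) * (D * s ^ (q - 1)) := by
          refine mul_le_mul (h _ ⟨sub_pos.2 hs.2, by linarith [hs.1]⟩) (h' _ ⟨hs.1, hs.2.le⟩)
            (norm_nonneg _) (mul_nonneg hC (Real.rpow_nonneg (sub_pos.2 hs.2).le _))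
      _ = _ := by ring

theorem PowBdd.intervalIntegrable (hb : PowBdd q b) (hq : 0 < q) (ht : 0 < t) :
    IntervalIntegrable b volume 0 t := by
  simpa using (PowBdd.of_continuous (a := fun _ => 1) continuousOn_const).intervalIntegrable_mul hb
    one_pos hq ht

/-- The triangle `0 < r < s < t`, as a set of pairs `(s, r)`. -/
def triangle (t : ℝ) : Set (ℝ × ℝ) := {x | 0 < x.2 ∧ x.2 < x.1 ∧ x.1 < t}

theorem isOpen_triangle (t : ℝ) : IsOpen (triangle t) :=
  (isOpen_lt continuous_const continuous_snd).inter
    ((isOpen_lt continuous_snd continuous_fst).inter (isOpen_lt continuous_fst continuous_const))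

/-- Tonelli: integrating out the second variable is a Beta integral and leaves a multiple of
`s^{q+r-1}`; what remains is a Beta integrand again. This is the dominating function for
associativity of the convolution. -/
theorem integrable_triangle_rpow (hp : 0 < p) (hq : 0 < q) (hr : 0 < r) (ht : 0 < t) :
    Integrable ((triangle t).indicator
      fun x : ℝ × ℝ => (t - x.1) ^ (p - 1) * ((x.1 - x.2) ^ (q - 1) * x.2 ^ (r - 1)))
      (volume.prod volume) := by
  have hmeas : AEStronglyMeasurable ((triangle t).indicator
      fun x : ℝ × ℝ => (t - x.1) ^ (p - 1) * ((x.1 - x.2) ^ (q - 1) * x.2 ^ (r - 1)))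
      (volume.prod volume) := by
    refine AEStronglyMeasurable.indicator ?_ (isOpen_triangle t).measurableSet
    have : Measurable fun x : ℝ × ℝ =>
        (t - x.1) ^ (p - 1) * ((x.1 - x.2) ^ (q - 1) * x.2 ^ (r - 1)) := by fun_prop
    exact this.aestronglyMeasurable
  have hsec : ∀ s, (fun u => (triangle t).indicator
      (fun x : ℝ × ℝ => (t - x.1) ^ (p - 1) * ((x.1 - x.2) ^ (q - 1) * x.2 ^ (r - 1))) (s, u)) =
      if s ∈ Ioo 0 t then (Ioo 0 s).indicator
        (fun u => (t - s) ^ (p - 1) * ((s - u) ^ (q - 1) * u ^ (r - 1))) else fun _ => 0 := by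
    intro s
    ext u
    by_cases hs : s ∈ Ioo 0 t
    · rw [if_pos hs]
      by_cases hu : u ∈ Ioo 0 s
      · rw [indicator_of_mem hu, indicator_of_mem (show (s, u) ∈ triangle t from ⟨hu.1, hu.2, hs.2⟩)]
      · rw [indicator_of_notMem hu, indicator_of_notMem]
        exact fun h => hu ⟨h.1, h.2.1⟩
    · rw [if_neg hs, indicator_of_notMem]
      exact fun h => hs ⟨h.1.trans h.2.1, h.2.2⟩
  rw [integrable_prod_iff hmeas]
  constructor
  · refine Eventually.of_forall fun s => ?_
    rw [hsec s]
    split_ifs with hs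
    · rw [integrable_indicator_iff measurableSet_Ioo,
        ← intervalIntegrable_iff_integrableOn_Ioo_of_le hs.1.le]
      exact (intervalIntegrable_sub_rpow_mul_rpow hq hr hs.1).const_mul _
    · exact integrable_zero _ _ _
  · have key : (fun s => ∫ u, ‖(triangle t).indicator
        (fun x : ℝ × ℝ => (t - x.1) ^ (p - 1) * ((x.1 - x.2) ^ (q - 1) * x.2 ^ (r - 1))) (s, u)‖) =
        (Ioo 0 t).indicator fun s => (t - s) ^ (p - 1) * s ^ (q + r - 1) *
          (Real.Gamma q * Real.Gamma r / Real.Gamma (q + r)) := by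
      ext s
      have h1 := hsec s
      by_cases hs : s ∈ Ioo 0 t
      · rw [if_pos hs] at h1
        rw [indicator_of_mem hs, mul_assoc, ← integral_sub_rpow_mul_rpow hq hr hs.1,
          intervalIntegral.integral_of_le hs.1.le, integral_Ioc_eq_integral_Ioo,
          ← integral_const_mul, ← integral_indicator measurableSet_Ioo]
        refine integral_congr_ae (Eventually.of_forall fun u => ?_)
        have h2 := congrFun h1 u
        dsimp only at h2 ⊢
        rw [h2, Real.norm_of_nonneg]
        refine indicator_nonneg (fun u hu => ?_) u
        have := sub_pos.2 hs.2
        have := sub_pos.2 hu.2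
        have := hu.1
        positivity
      · rw [if_neg hs] at h1
        rw [indicator_of_notMem hs]
        simp only [fun u => congrFun h1 u, norm_zero, integral_zero]
    rw [key, integrable_indicator_iff measurableSet_Ioo,
      ← intervalIntegrable_iff_integrableOn_Ioo_of_le ht.le]
    exact (intervalIntegrable_sub_rpow_mul_rpow hp (add_pos hq hr) ht).mul_const _

/-- Fubini on the triangle `0 < u < s < t`. The power bounds make the triple product integrable
although each factor may be singular at 0. -/
theorem lconv_assoc (ha : PowBdd p a) (hb : PowBdd q b) (hc : PowBdd r c)
    (hp : 0 < p) (hq : 0 < q) (hr : 0 < r) (ht : 0 < t) :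
    lconv (lconv a b) c t = lconv a (lconv b c) t := by
  set Φ : ℝ × ℝ → ℂ := (triangle t).indicator fun x => a (t - x.1) * (b (x.1 - x.2) * c x.2) with hΦ
  have hint : Integrable Φ (volume.prod volume) := by
    obtain ⟨A, hA, h1⟩ := ha.bdd t ht
    obtain ⟨B, hB, h2⟩ := hb.bdd t ht
    obtain ⟨C, hC, h3⟩ := hc.bdd t ht
    refine ((integrable_triangle_rpow hp hq hr ht).const_mul (A * (B * C))).mono' ?_ ?_
    · rw [hΦ, aestronglyMeasurable_indicator_iff (isOpen_triangle t).measurableSet]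
      refine ContinuousOn.aestronglyMeasurable ?_ (isOpen_triangle t).measurableSet
      refine (ha.cont.comp (by fun_prop) fun x hx => sub_pos.2 hx.2.2).mul
        ((hb.cont.comp (by fun_prop) fun x hx => sub_pos.2 hx.2.1).mul
          (hc.cont.comp (by fun_prop) fun x hx => hx.1))
    · refine Eventually.of_forall fun x => ?_
      by_cases hx : x ∈ triangle t
      · have e1 := hx.1
        have e2 := hx.2.1
        have e3 := hx.2.2
        rw [hΦ, indicator_of_mem hx, indicator_of_mem hx, norm_mul, norm_mul]
        have f1 := h1 (t - x.1) ⟨by linarith, by linarith⟩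
        have f2 := h2 (x.1 - x.2) ⟨by linarith, by linarith⟩
        have f3 := h3 x.2 ⟨by linarith, by linarith⟩
        calc _ ≤ (A * (t - x.1) ^ (p - 1)) * ((B * (x.1 - x.2) ^ (q - 1)) * (C * x.2 ^ (r - 1))) := by
              gcongr
          _ = _ := by ring
      · rw [hΦ, indicator_of_notMem hx, indicator_of_notMem hx]
        simp
  have hswap := integral_integral_swap (f := fun s u => Φ (s, u)) hint
  have hL : ∀ s, ∫ u, Φ (s, u) = (Ioo 0 t).indicator (fun s => a (t - s) * lconv b c s) s := by
    intro s
    by_cases hs : s ∈ Ioo 0 t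
    · rw [indicator_of_mem hs, lconv, ← intervalIntegral.integral_const_mul,
        intervalIntegral.integral_of_le hs.1.le, integral_Ioc_eq_integral_Ioo,
        ← integral_indicator measurableSet_Ioo]
      congr 1
      ext u
      by_cases hu : u ∈ Ioo 0 s
      · rw [indicator_of_mem hu, hΦ, indicator_of_mem (show (s, u) ∈ triangle t from ⟨hu.1, hu.2, hs.2⟩)]
      · rw [indicator_of_notMem hu, hΦ, indicator_of_notMem]
        exact fun h => hu ⟨h.1, h.2.1⟩
    · rw [indicator_of_notMem hs]
      have : ∀ u, Φ (s, u) = 0 := fun u => indicator_of_notMem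
        (fun h => hs ⟨h.1.trans h.2.1, h.2.2⟩) _
      simp [this]
  have hR : ∀ u, ∫ s, Φ (s, u) = (Ioo 0 t).indicator (fun u => lconv a b (t - u) * c u) u := by
    intro u
    by_cases hu : u ∈ Ioo 0 t
    · rw [indicator_of_mem hu, lconv, ← intervalIntegral.integral_mul_const]
      -- Shifting by `u` turns the inner convolution over `(0, t - u)` into an integral over the
      -- slice `(u, t)` of the triangle.
      have := intervalIntegral.integral_comp_sub_right
        (a := u) (b := t) (fun s => a (t - u - s) * b s * c u) u
      rw [sub_self] at this
      rw [← this, intervalIntegral.integral_of_le hu.2.le, integral_Ioc_eq_integral_Ioo,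
        ← integral_indicator measurableSet_Ioo]
      congr 1
      ext s
      by_cases hs : s ∈ Ioo u t
      · rw [indicator_of_mem hs, hΦ, indicator_of_mem (show (s, u) ∈ triangle t from ⟨hu.1, hs.1, hs.2⟩)]
        rw [mul_assoc]
        congr 2
        ring
      · rw [indicator_of_notMem hs, hΦ, indicator_of_notMem]
        exact fun h => hs ⟨h.2.1, h.2.2⟩
    · rw [indicator_of_notMem hu]
      have : ∀ s, Φ (s, u) = 0 := fun s => indicator_of_notMem
        (fun h => hu ⟨h.1, h.2.1.trans h.2.2⟩) _
      simp [this]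
  simp only [hL, hR] at hswap
  rw [integral_indicator measurableSet_Ioo, integral_indicator measurableSet_Ioo] at hswap
  rw [lconv, lconv, intervalIntegral.integral_of_le ht.le, integral_Ioc_eq_integral_Ioo,
    intervalIntegral.integral_of_le ht.le, integral_Ioc_eq_integral_Ioo]
  exact hswap.symm

/-! ### Mittag-Leffler functions -/

/-- Keep only the part of Euler's integral over `(p, 2p]` and bound the integrand below there. Since
`p` is free, `Γ` outgrows every exponential, which is all that convergence of Mittag-Leffler series
needs. -/
theorem rpow_mul_exp_le_Gamma {p x : ℝ} (hp : 0 < p) (hx : 0 < x) :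
    p ^ x * (Real.exp (-(2 * p)) / 2) ≤ Real.Gamma x := by
  have hi := Real.GammaIntegral_convergent hx
  rw [Real.Gamma_eq_integral hx]
  have h1 : ∫ _ in Ioc p (2 * p), Real.exp (-(2 * p)) * (p ^ x / (2 * p)) ≤
      ∫ s in Ioc p (2 * p), Real.exp (-s) * s ^ (x - 1) := by
    refine setIntegral_mono_on ?_ (hi.mono_set fun s hs => hp.trans hs.1) measurableSet_Ioc ?_
    · exact integrableOn_const (by simp)
    · intro s hs
      have hs0 : 0 < s := hp.trans hs.1
      rw [Real.rpow_sub_one hs0.ne']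
      have e1 : p ^ x ≤ s ^ x := Real.rpow_le_rpow hp.le hs.1.le hx.le
      have e2 : Real.exp (-(2 * p)) ≤ Real.exp (-s) := Real.exp_le_exp.2 (by linarith [hs.2])
      have := hs.2
      gcongr
  have h2 : ∫ s in Ioc p (2 * p), Real.exp (-s) * s ^ (x - 1) ≤
      ∫ s in Ioi 0, Real.exp (-s) * s ^ (x - 1) := by
    refine setIntegral_mono_set hi ?_ (Eventually.of_forall fun s hs => hp.trans hs.1)
    filter_upwards [ae_restrict_mem measurableSet_Ioi] with s hs
    have : 0 < s := hs
    positivity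
  refine le_trans (le_of_eq ?_) (h1.trans h2)
  rw [setIntegral_const, Real.volume_real_Ioc_of_le (by linarith), smul_eq_mul]
  field_simp
  ring

theorem summable_pow_div_Gamma {a b : ℝ} (ha : 0 < a) (hb : 0 < b) (R : ℝ) :
    Summable fun k : ℕ => |R| ^ k / Real.Gamma (k * a + b) := by
  obtain ⟨p, hp, hR⟩ : ∃ p : ℝ, 0 < p ∧ |R| / p ^ a < 1 := by
    -- With this `p`, `p^a = |R| + 1`, so the comparison series is geometric with ratio `|R| / (|R|
    -- + 1)`.
    refine ⟨(|R| + 1) ^ (a⁻¹), by positivity, ?_⟩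
    rw [Real.rpow_inv_rpow (by positivity) ha.ne', div_lt_one (by positivity)]
    linarith
  have hg := (summable_geometric_of_lt_one (by positivity) hR).mul_left
    (2 / (p ^ b * Real.exp (-(2 * p))))
  refine Summable.of_nonneg_of_le (fun k => ?_) (fun k => ?_) hg
  · have := Real.Gamma_pos_of_pos (show 0 < k * a + b by positivity)
    positivity
  · have h1 := rpow_mul_exp_le_Gamma hp (show 0 < k * a + b by positivity)
    calc |R| ^ k / Real.Gamma (k * a + b)
        ≤ |R| ^ k / (p ^ (k * a + b) * (Real.exp (-(2 * p)) / 2)) := by gcongr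
      _ = _ := by
        rw [Real.rpow_add hp, mul_comm (k : ℝ) a, Real.rpow_mul hp.le, Real.rpow_natCast, div_pow]
        field_simp

theorem Gamma_ofReal_ne_zero {x : ℝ} (hx : 0 < x) : (Real.Gamma x : ℂ) ≠ 0 :=
  Complex.ofReal_ne_zero.2 (Real.Gamma_pos_of_pos hx).ne'

theorem norm_pow_div_Gamma {a b : ℝ} (ha : 0 < a) (hb : 0 < b) (z : ℂ) (k : ℕ) :
    ‖z ^ k / (Real.Gamma (k * a + b) : ℂ)‖ = |‖z‖| ^ k / Real.Gamma (k * a + b) := by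
  rw [norm_div, norm_pow, Complex.norm_real, abs_norm, Real.norm_of_nonneg
    (Real.Gamma_pos_of_pos (by positivity)).le]

theorem continuous_mittagLeffler {a b : ℝ} (ha : 0 < a) (hb : 0 < b) :
    Continuous (mittagLeffler a b) := by
  refine continuous_iff_continuousAt.2 fun z => ?_
  have h : ContinuousOn (mittagLeffler a b) (Metric.ball 0 (‖z‖ + 1)) := by
    refine continuousOn_tsum (fun k => by fun_prop)
      (summable_pow_div_Gamma ha hb (‖z‖ + 1)) fun k w hw => ?_
    rw [norm_pow_div_Gamma ha hb]
    have := Real.Gamma_pos_of_pos (show 0 < k * a + b by positivity)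
    rw [abs_norm, abs_of_nonneg (by positivity : 0 ≤ ‖z‖ + 1)]
    have : ‖w‖ ≤ ‖z‖ + 1 := (mem_ball_zero_iff.1 hw).le
    gcongr
  exact h.continuousAt (Metric.isOpen_ball.mem_nhds (by simp))

/-- The Riemann-Liouville kernel `t^{p-1} / Γ(p)`. -/
def rlKernel (p t : ℝ) : ℂ := ((t ^ (p - 1) / Real.Gamma p : ℝ) : ℂ)

theorem rlKernel_one (t : ℝ) : rlKernel 1 t = 1 := by simp [rlKernel]

theorem powBdd_rlKernel {p : ℝ} (hp : 0 < p) : PowBdd p (rlKernel p) where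
  cont := by
    refine Complex.continuous_ofReal.comp_continuousOn (ContinuousOn.div_const ?_ _)
    exact fun t ht => (Real.continuousAt_rpow_const _ _ (Or.inl (ne_of_gt ht))).continuousWithinAt
  bdd T _ := by
    have h := Real.Gamma_pos_of_pos hp
    refine ⟨(Real.Gamma p)⁻¹, by positivity, fun t ht => ?_⟩
    rw [rlKernel, Complex.norm_real, Real.norm_of_nonneg, div_eq_inv_mul]
    have := ht.1
    positivity

theorem lconv_rlKernel {p q t : ℝ} (hp : 0 < p) (hq : 0 < q) (ht : 0 < t) :
    lconv (rlKernel p) (rlKernel q) t = rlKernel (p + q) t := by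
  have h1 := Real.Gamma_pos_of_pos hp
  have h2 := Real.Gamma_pos_of_pos hq
  have h := integral_sub_rpow_mul_rpow hp hq ht
  have e : lconv (rlKernel p) (rlKernel q) t =
      ((∫ s in (0 : ℝ)..t, (t - s) ^ (p - 1) * s ^ (q - 1) * (Real.Gamma p * Real.Gamma q)⁻¹ : ℝ) : ℂ) := by
    rw [lconv, ← intervalIntegral.integral_ofReal]
    refine intervalIntegral.integral_congr fun s _ => ?_
    simp only [rlKernel]
    norm_cast
    field_simp
  rw [e, intervalIntegral.integral_mul_const, h, rlKernel]
  congr 1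
  field_simp

/-- `t^{q-1} E_{α,q}(iμt^α)`, as a series of Riemann-Liouville kernels. -/
def mlKernel (α μ q t : ℝ) : ℂ := ∑' k : ℕ, (Complex.I * μ) ^ k * rlKernel (k * α + q) t

variable {α μ q t : ℝ}

theorem mlKernel_term (ht : 0 < t) (k : ℕ) :
    (Complex.I * μ) ^ k * rlKernel (k * α + q) t =
      ((t ^ (q - 1) : ℝ) : ℂ) * ((Complex.I * μ * ((t ^ α : ℝ) : ℂ)) ^ k /
        (Real.Gamma (k * α + q) : ℂ)) := by
  have : t ^ (k * α + q - 1) = t ^ (q - 1) * (t ^ α) ^ k := by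
    rw [← Real.rpow_natCast, ← Real.rpow_mul ht.le, ← Real.rpow_add ht]
    congr 1
    ring
  rw [rlKernel, this]
  push_cast
  ring

theorem mlKernel_eq (ht : 0 < t) :
    mlKernel α μ q t = ((t ^ (q - 1) : ℝ) : ℂ) *
      mittagLeffler α q (Complex.I * μ * ((t ^ α : ℝ) : ℂ)) := by
  rw [mlKernel, mittagLeffler, ← tsum_mul_left]
  exact tsum_congr fun k => mlKernel_term ht k

theorem norm_mlKernel_term (hα : 0 < α) (hq : 0 < q) (ht : 0 < t) (k : ℕ) :
    ‖(Complex.I * μ) ^ k * rlKernel (k * α + q) t‖ =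
      t ^ (q - 1) * (|μ * t ^ α| ^ k / Real.Gamma (k * α + q)) := by
  rw [mlKernel_term ht, norm_mul, norm_pow_div_Gamma hα hq, Complex.norm_real,
    Real.norm_of_nonneg (by positivity)]
  simp [abs_mul]

theorem summable_norm_mlKernel (hα : 0 < α) (hq : 0 < q) (ht : 0 < t) :
    Summable fun k : ℕ => ‖(Complex.I * μ) ^ k * rlKernel (k * α + q) t‖ := by
  simp only [norm_mlKernel_term hα hq ht]
  exact (summable_pow_div_Gamma hα hq _).mul_left _

theorem powBdd_mlKernel (hα : 0 < α) (hq : 0 < q) : PowBdd q (mlKernel α μ q) := by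
  have hE : Continuous fun t : ℝ => mittagLeffler α q (Complex.I * μ * ((t ^ α : ℝ) : ℂ)) := by
    refine (continuous_mittagLeffler hα hq).comp (continuous_const.mul ?_)
    exact Complex.continuous_ofReal.comp (Real.continuous_rpow_const hα.le)
  have h := ((powBdd_rlKernel hq).const_mul (Real.Gamma q : ℂ)).mul_continuous hE.continuousOn
  have he : EqOn (mlKernel α μ q) (fun t => mittagLeffler α q (Complex.I * μ * ((t ^ α : ℝ) : ℂ)) *
      ((Real.Gamma q : ℂ) * rlKernel q t)) (Ioi 0) := by
    intro t ht
    have := Gamma_ofReal_ne_zero hq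
    dsimp only
    rw [mlKernel_eq ht, rlKernel]
    push_cast
    field_simp
  refine ⟨h.cont.congr he, fun T hT => ?_⟩
  obtain ⟨C, hC, hb⟩ := h.bdd T hT
  exact ⟨C, hC, fun t ht => by rw [he ht.1]; exact hb t ht⟩

/-- Termwise this is the semigroup law of the Riemann-Liouville kernels: convolution with `k_p`
raises the second Mittag-Leffler parameter by `p`. -/
theorem lconv_mlKernel {p : ℝ} (hα : 0 < α) (hp : 0 < p) (hq : 0 < q) (ht : 0 < t) :
    lconv (rlKernel p) (mlKernel α μ q) t = mlKernel α μ (p + q) t := by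
  have hpos : ∀ k : ℕ, 0 < k * α + q := fun k => by positivity
  set F : ℕ → ℝ → ℂ := fun k s => rlKernel p (t - s) * ((Complex.I * μ) ^ k * rlKernel (k * α + q) s)
  have hF : ∀ k, IntervalIntegrable (F k) volume 0 t := fun k =>
    (powBdd_rlKernel hp).intervalIntegrable_mul ((powBdd_rlKernel (hpos k)).const_mul _) hp (hpos k) ht
  have hval : ∀ k, ∫ s in (0 : ℝ)..t, F k s = (Complex.I * μ) ^ k * rlKernel (k * α + (p + q)) t := by
    intro k
    have := lconv_rlKernel hp (hpos k) ht
    rw [show k * α + (p + q) = p + (k * α + q) by ring, ← this, lconv,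
      ← intervalIntegral.integral_const_mul]
    refine intervalIntegral.integral_congr fun s _ => ?_
    simp only [F]
    ring
  -- The kernels are nonnegative, so the integral of the norm is again given by the semigroup law,
  -- with `|μ|` in place of `iμ`; these values are summable, which justifies exchanging sum and
  -- integral.
  have hnorm : ∀ k, ∫ s in (0 : ℝ)..t, ‖F k s‖ = ‖(Complex.I * μ) ^ k * rlKernel (k * α + (p + q)) t‖ := by
    intro k
    have h1 := lconv_rlKernel hp (hpos k) ht
    have h2 : ∀ s ∈ Icc 0 t, ‖F k s‖ = |μ| ^ k * ((rlKernel p (t - s) * rlKernel (k * α + q) s).re) := by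
      intro s hs
      have g1 := Real.Gamma_pos_of_pos hp
      have g2 := Real.Gamma_pos_of_pos (hpos k)
      have := hs.1
      have := sub_nonneg.2 hs.2
      simp only [F, rlKernel, norm_mul, norm_pow, Complex.norm_I, one_mul, Complex.norm_real]
      have hn1 : 0 ≤ (t - s) ^ (p - 1) / Real.Gamma p := by positivity
      have hn2 : 0 ≤ s ^ (k * α + q - 1) / Real.Gamma (k * α + q) := by positivity
      rw [← Complex.ofReal_mul, Complex.ofReal_re, Real.norm_of_nonneg hn1,
        Real.norm_of_nonneg hn2, Real.norm_eq_abs]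
      ring
    rw [intervalIntegral.integral_congr (g := fun s => |μ| ^ k *
      ((rlKernel p (t - s) * rlKernel (k * α + q) s).re)) (fun s hs => h2 s (by rwa [uIcc_of_le ht.le] at hs)),
      intervalIntegral.integral_const_mul]
    have h3 := (Complex.reCLM.intervalIntegral_comp_comm
      ((powBdd_rlKernel hp).intervalIntegrable_mul (powBdd_rlKernel (hpos k)) hp (hpos k) ht))
    simp only [Complex.reCLM_apply] at h3
    rw [h3]
    rw [lconv] at h1
    rw [h1, show p + (k * α + q) = k * α + (p + q) by ring, norm_mul, norm_pow, norm_mul,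
      Complex.norm_I, one_mul, Complex.norm_real, rlKernel, Complex.ofReal_re, Complex.norm_real,
      Real.norm_eq_abs μ, Real.norm_of_nonneg]
    have := Real.Gamma_pos_of_pos (show 0 < k * α + (p + q) by positivity)
    positivity
  have hsum : Summable fun k => ∫ s, ‖F k s‖ ∂(volume.restrict (Ioc 0 t)) := by
    have := summable_norm_mlKernel (μ := μ) hα (add_pos hp hq) ht
    refine this.congr fun k => ?_
    rw [← hnorm, intervalIntegral.integral_of_le ht.le]
  have h := hasSum_integral_of_summable_integral_norm (fun k => (intervalIntegrable_iff_integrableOn_Ioc_of_le ht.le).1 (hF k)) hsum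
  have h1 : lconv (rlKernel p) (mlKernel α μ q) t = ∫ s in Ioc 0 t, ∑' k, F k s := by
    rw [lconv, intervalIntegral.integral_of_le ht.le]
    refine setIntegral_congr_fun measurableSet_Ioc fun s _ => ?_
    simp only [F, mlKernel]
    rw [tsum_mul_left]
  rw [h1, ← h.tsum_eq, mlKernel]
  exact tsum_congr fun k => by rw [← hval, intervalIntegral.integral_of_le ht.le]

theorem mlKernel_eq_add (hα : 0 < α) (hq : 0 < q) (ht : 0 < t) :
    mlKernel α μ q t = rlKernel q t + Complex.I * μ * mlKernel α μ (q + α) t := by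
  have h := (summable_norm_mlKernel (μ := μ) hα hq ht).of_norm
  rw [mlKernel, h.tsum_eq_zero_add, mlKernel, ← tsum_mul_left]
  congr 1
  · simp
  · refine tsum_congr fun k => ?_
    rw [show ((k + 1 : ℕ) : ℝ) * α + q = k * α + (q + α) by push_cast; ring]
    ring

/-! ### The energy inequality for Caputo derivatives -/

theorem lconv_congr {a a' b b' : ℝ → ℂ} {t : ℝ} (ht : 0 ≤ t) (ha : EqOn a a' (Ioo 0 t))
    (hb : EqOn b b' (Ioo 0 t)) : lconv a b t = lconv a' b' t := by
  rw [lconv, lconv, intervalIntegral.integral_of_le ht, intervalIntegral.integral_of_le ht,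
    integral_Ioc_eq_integral_Ioo, integral_Ioc_eq_integral_Ioo]
  refine setIntegral_congr_fun measurableSet_Ioo fun s hs => ?_
  rw [ha ⟨sub_pos.2 hs.2, by linarith [hs.1]⟩, hb hs]

theorem lconv_comm (a b : ℝ → ℂ) (t : ℝ) : lconv a b t = lconv b a t := by
  have := intervalIntegral.integral_comp_sub_left (a := 0) (b := t) (fun s => a (t - s) * b s) t
  simp only [sub_self, sub_zero, sub_sub_cancel] at this
  rw [lconv, ← this, lconv]
  simp only [mul_comm]

theorem lconv_const_mul_left (z : ℂ) (a b : ℝ → ℂ) (t : ℝ) :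
    lconv (fun s => z * a s) b t = z * lconv a b t := by
  simp only [lconv, mul_assoc, intervalIntegral.integral_const_mul]

theorem lconv_const_mul_right (z : ℂ) (a b : ℝ → ℂ) (t : ℝ) :
    lconv a (fun s => z * b s) t = z * lconv a b t := by
  rw [lconv_comm, lconv_const_mul_left, lconv_comm]

theorem lconv_one_left (b : ℝ → ℂ) (t : ℝ) :
    lconv (fun _ => 1) b t = ∫ s in (0 : ℝ)..t, b s := by simp [lconv]

theorem re_lconv_rlKernel_nonpos {p t : ℝ} {b : ℝ → ℂ} (hp : 0 < p) (ht : 0 ≤ t)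
    (hb : ∀ s, 0 < s → (b s).re ≤ 0) : (lconv (rlKernel p) b t).re ≤ 0 := by
  rw [lconv]
  by_cases hi : IntervalIntegrable (fun s => rlKernel p (t - s) * b s) volume 0 t
  · have h := Complex.reCLM.intervalIntegral_comp_comm hi
    simp only [Complex.reCLM_apply] at h
    rw [← h, intervalIntegral.integral_of_le ht]
    refine setIntegral_nonpos measurableSet_Ioc fun s hs => ?_
    rw [rlKernel, Complex.re_ofReal_mul]
    have := Real.Gamma_pos_of_pos hp
    have := sub_nonneg.2 hs.2
    exact mul_nonpos_of_nonneg_of_nonpos (by positivity) (hb s hs.1)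
  -- The default value 0 of an undefined integral also satisfies the inequality, so no integrability
  -- has to be assumed.
  · rw [intervalIntegral.integral_undef hi, Complex.zero_re]

variable {y y' : ℝ → ℂ} {p α μ t : ℝ}

theorem hasDerivAt_norm_sub_sq {s : ℝ} (h : HasDerivAt y (y' s) s) (w : ℂ) :
    HasDerivAt (fun s => ‖y s - w‖ ^ 2) (2 * ((starRingEnd ℂ) (y s - w) * y' s).re) s := by
  have h1 := (h.sub_const w).norm_sq
  convert h1 using 1
  rw [Complex.inner, mul_comm ((starRingEnd ℂ) _)]

/-- Integrate by parts: `2 Re (conj(y(s) - y(t)) y'(s))` is the derivative of `|y(s) - y(t)|²`. The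
boundary term at `s = t` vanishes, the one at 0 is `-t^{-α} |y(0) - y(t)|²`, and `(t-s)^{-α}`
increases in `s`, so the remaining integral also has the good sign. This is the inequality `∂_t^α
|y|² ≤ 2 Re (conj y ∂_t^α y)`. -/
theorem re_lconv_sub_nonpos (hα : α ∈ Ioo (0 : ℝ) 1) (hp : 0 < p)
    (hc : ContinuousOn y (Ici 0)) (hd : ∀ s, 0 < s → HasDerivAt y (y' s) s) (hy' : PowBdd p y')
    (ht : 0 < t) :
    (lconv (rlKernel (1 - α)) (fun s => (starRingEnd ℂ) (y s - y t) * y' s) t).re ≤ 0 := by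
  have hb : PowBdd p (fun s => (starRingEnd ℂ) (y s - y t) * y' s) :=
    hy'.mul_continuous (Complex.continuous_conj.comp_continuousOn (hc.sub continuousOn_const))
  have hα1 : 0 < 1 - α := sub_pos.2 hα.2
  have hint := (powBdd_rlKernel hα1).intervalIntegrable_mul hb hα1 hp ht
  set J : ℝ → ℝ := fun s => (t - s) ^ (-α) * (2 * ((starRingEnd ℂ) (y s - y t) * y' s).re) with hJ
  have hJe : ∀ s, J s = 2 * Real.Gamma (1 - α) *
      (rlKernel (1 - α) (t - s) * ((starRingEnd ℂ) (y s - y t) * y' s)).re := by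
    intro s
    have := (Real.Gamma_pos_of_pos hα1).ne'
    rw [hJ, rlKernel, Complex.re_ofReal_mul, show 1 - α - 1 = -α by ring]
    field_simp
  have hJint : IntervalIntegrable J volume 0 t := by
    have h1 : IntervalIntegrable (fun s => (rlKernel (1 - α) (t - s) *
        ((starRingEnd ℂ) (y s - y t) * y' s)).re) volume 0 t := by
      have := intervalIntegrable_iff.1 hint
      exact intervalIntegrable_iff.2 this.re
    exact (h1.const_mul (2 * Real.Gamma (1 - α))).congr (fun s _ => (hJe s).symm)
  have hval : (lconv (rlKernel (1 - α)) (fun s => (starRingEnd ℂ) (y s - y t) * y' s) t).re =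
      (2 * Real.Gamma (1 - α))⁻¹ * ∫ s in (0 : ℝ)..t, J s := by
    have h := Complex.reCLM.intervalIntegral_comp_comm hint
    simp only [Complex.reCLM_apply] at h
    have hG := (Real.Gamma_pos_of_pos hα1).ne'
    rw [lconv, ← h]
    simp only [hJe]
    rw [intervalIntegral.integral_const_mul]
    field_simp
  rw [hval]
  refine mul_nonpos_of_nonneg_of_nonpos
    (inv_nonneg.2 (mul_nonneg two_pos.le (Real.Gamma_pos_of_pos hα1).le)) ?_
  set F : ℝ → ℝ := fun s => (t - s) ^ (-α) * ‖y s - y t‖ ^ 2 with hF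
  have hle : ∀ x ∈ Ioo 0 t, ∫ s in (0 : ℝ)..x, J s ≤ F x := by
    intro x hx
    have hpos : ∀ s ≤ x, 0 < t - s := fun s hs => by linarith [hx.2]
    -- Only an inequality is needed: `F' = J + α(t-s)^{-α-1} |y(s) - y(t)|² ≥ J` and `F(0) ≥ 0`. One
    -- stops at `x < t` because the weight is singular at `t`.
    have h := intervalIntegral.integral_le_sub_of_hasDeriv_right_of_le (g := F) (φ := J)
      (g' := fun s => J s + α * (t - s) ^ (-α - 1) * ‖y s - y t‖ ^ 2) hx.1.le ?_ ?_ ?_ ?_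
    · refine h.trans (sub_le_self _ ?_)
      simp only [hF, sub_zero]
      positivity
    · refine ContinuousOn.mul ?_ ?_
      · exact ContinuousOn.rpow_const (by fun_prop) fun s hs => Or.inl (hpos s hs.2).ne'
      · exact ((hc.mono Icc_subset_Ici_self).sub continuousOn_const).norm.pow 2
    · intro s hs
      have h1 : HasDerivAt (fun s => (t - s) ^ (-α)) (-1 * (-α) * (t - s) ^ (-α - 1)) s :=
        ((hasDerivAt_id s).const_sub t).rpow_const (Or.inl (hpos s hs.2.le).ne')
      have h2 := hasDerivAt_norm_sub_sq (hd s hs.1) (y t)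
      refine ((h1.mul h2).congr_deriv ?_).hasDerivWithinAt
      rw [hJ]
      ring
    · exact (integrableOn_Icc_iff_integrableOn_Ioc).2 ((intervalIntegrable_iff_integrableOn_Ioc_of_le ht.le).1 hJint |>.mono_set
        (Ioc_subset_Ioc_right hx.2.le))
    · intro s hs
      have := (hpos s hs.2.le).le
      have := hα.1
      have : 0 ≤ α * (t - s) ^ (-α - 1) * ‖y s - y t‖ ^ 2 := by positivity
      linarith
  -- Differentiability at `t` gives `|y(s) - y(t)| = O(t - s)`, so `F = O((t-s)^{2-α})`.
  have hF0 : Tendsto F (𝓝[<] t) (𝓝 0) := by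
    obtain ⟨C, hC⟩ := (hd t ht).differentiableAt.isBigO_sub.bound
    have hev : ∀ᶠ x in 𝓝[<] t, ‖F x‖ ≤ C ^ 2 * (t - x) ^ (2 - α) := by
      filter_upwards [nhdsWithin_le_nhds hC, self_mem_nhdsWithin] with x hx hxt
      have hxt' : 0 < t - x := sub_pos.2 hxt
      rw [Real.norm_of_nonneg (by positivity)]
      have e : ‖x - t‖ = t - x := by rw [norm_sub_rev, Real.norm_of_nonneg hxt'.le]
      rw [e] at hx
      calc F x ≤ (t - x) ^ (-α) * (C * (t - x)) ^ 2 := by simp only [hF]; gcongr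
        _ = C ^ 2 * ((t - x) ^ (-α) * (t - x) ^ (2 : ℝ)) := by rw [Real.rpow_two]; ring
        _ = _ := by rw [← Real.rpow_add hxt']; congr 2; ring
    refine squeeze_zero_norm' hev ?_
    have h2 : 0 < 2 - α := by linarith [hα.2]
    have : ContinuousAt (fun x => C ^ 2 * (t - x) ^ (2 - α)) t :=
      continuousAt_const.mul (ContinuousAt.rpow_const (by fun_prop) (Or.inr h2.le))
    have h3 := this.tendsto
    simp only [sub_self, Real.zero_rpow h2.ne', mul_zero] at h3
    exact h3.mono_left nhdsWithin_le_nhds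
  have hI : Tendsto (fun x => ∫ s in (0 : ℝ)..x, J s) (𝓝[<] t) (𝓝 (∫ s in (0 : ℝ)..t, J s)) := by
    have h := intervalIntegral.continuousOn_primitive_interval'
      (hJint) (left_mem_uIcc)
    rw [uIcc_of_le ht.le] at h
    have h1 := (h t ⟨ht.le, le_rfl⟩).tendsto
    refine h1.mono_left ?_
    rw [← nhdsWithin_Ioo_eq_nhdsLT ht]
    exact nhdsWithin_mono _ Ioo_subset_Icc_self
  refine le_of_tendsto_of_tendsto hI hF0 ?_
  rw [← nhdsWithin_Ioo_eq_nhdsLT ht]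
  filter_upwards [self_mem_nhdsWithin] with x hx using hle x hx

/-- Solutions of `∂_t^α y = iμy` do not grow. -/
theorem norm_le_of_caputo_eq (hα : α ∈ Ioo (0 : ℝ) 1) (hp : 0 < p)
    (hc : ContinuousOn y (Ici 0)) (hd : ∀ s, 0 < s → HasDerivAt y (y' s) s) (hy' : PowBdd p y')
    (heq : ∀ s, 0 < s → lconv (rlKernel (1 - α)) y' s = Complex.I * μ * y s) (ht : 0 ≤ t) :
    ‖y t‖ ≤ ‖y 0‖ := by
  rcases ht.eq_or_lt with rfl | ht
  · exact le_rfl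
  have hα1 : 0 < 1 - α := sub_pos.2 hα.2
  have hb : PowBdd p (fun s => (starRingEnd ℂ) (y s) * y' s) :=
    hy'.mul_continuous (Complex.continuous_conj.comp_continuousOn hc)
  have h1 : ∀ s, 0 < s →
      (lconv (rlKernel (1 - α)) (fun s => (starRingEnd ℂ) (y s) * y' s) s).re ≤ 0 := by
    intro s hs
    have e : lconv (rlKernel (1 - α)) (fun r => (starRingEnd ℂ) (y r) * y' r) s =
        lconv (rlKernel (1 - α)) (fun r => (starRingEnd ℂ) (y r - y s) * y' r) s +
          (starRingEnd ℂ) (y s) * (Complex.I * μ * y s) := by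
      have hb' : PowBdd p (fun r => (starRingEnd ℂ) (y r - y s) * y' r) :=
        hy'.mul_continuous (Complex.continuous_conj.comp_continuousOn (hc.sub continuousOn_const))
      rw [← heq s hs, ← lconv_const_mul_right, lconv, lconv, lconv,
        ← intervalIntegral.integral_add ((powBdd_rlKernel hα1).intervalIntegrable_mul hb' hα1 hp hs)
          ((powBdd_rlKernel hα1).intervalIntegrable_mul (hy'.const_mul _) hα1 hp hs)]
      refine intervalIntegral.integral_congr fun r _ => ?_
      simp only [map_sub]
      ring
    -- Here `μ` being real is essential: the term is `iμ|y|²`.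
    have e2 : ((starRingEnd ℂ) (y s) * (Complex.I * μ * y s)).re = 0 := by
      rw [show (starRingEnd ℂ) (y s) * (Complex.I * μ * y s) =
        (μ * (y s * (starRingEnd ℂ) (y s))) * Complex.I by ring, Complex.mul_conj]
      simp [← Complex.ofReal_mul]
    rw [e, Complex.add_re, e2, add_zero]
    exact re_lconv_sub_nonpos hα hp hc hd hy' hs
  have h2 := re_lconv_rlKernel_nonpos hα.1 ht.le h1
  -- Convolving with the positive kernel `k_α` preserves the sign and undoes `k_{1-α}`, since `k_α *
  -- k_{1-α} = 1`. What is left is the integral of half the derivative of `|y|²`.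
  have h3 : lconv (rlKernel α) (lconv (rlKernel (1 - α)) (fun s => (starRingEnd ℂ) (y s) * y' s)) t =
      ∫ s in (0 : ℝ)..t, (starRingEnd ℂ) (y s) * y' s := by
    rw [← lconv_assoc (powBdd_rlKernel hα.1) (powBdd_rlKernel hα1) hb hα.1 hα1 hp ht,
      ← lconv_one_left]
    refine lconv_congr ht.le (fun s hs => ?_) fun _ _ => rfl
    rw [lconv_rlKernel hα.1 hα1 hs.1, add_sub_cancel, rlKernel_one]
  rw [h3] at h2
  have hbi := hb.intervalIntegrable hp ht
  have h4 : (∫ s in (0 : ℝ)..t, 2 * ((starRingEnd ℂ) (y s) * y' s).re) = ‖y t‖ ^ 2 - ‖y 0‖ ^ 2 := by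
    refine intervalIntegral.integral_eq_sub_of_hasDerivAt_of_le (f := fun s => ‖y s‖ ^ 2) ht.le ?_ ?_ ?_
    · exact (hc.mono Icc_subset_Ici_self).norm.pow 2
    · intro s hs
      simpa using hasDerivAt_norm_sub_sq (hd s hs.1) 0
    · exact (intervalIntegrable_iff.2 (intervalIntegrable_iff.1 hbi).re).const_mul 2
  have h5 := Complex.reCLM.intervalIntegral_comp_comm hbi
  simp only [Complex.reCLM_apply] at h5
  rw [intervalIntegral.integral_const_mul, h5] at h4
  exact le_of_sq_le_sq (by linarith) (norm_nonneg _)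

/-! ### The scalar fractional equation -/

theorem mlKernel_one_zero (hα : 0 < α) : mlKernel α μ 1 0 = 1 := by
  rw [mlKernel, tsum_eq_single 0]
  -- The term `k = 0` at time 0 is `0^0 / Γ(1) = 1`; the other terms have positive exponents and
  -- vanish.
  · simp [rlKernel]
  · intro k hk
    have : (k : ℝ) * α ≠ 0 := by positivity
    simp [rlKernel, Real.zero_rpow this]

theorem mlKernel_one_eq (hα : 0 < α) (ht : 0 ≤ t) :
    mlKernel α μ 1 t = 1 + ∫ s in (0 : ℝ)..t, Complex.I * μ * mlKernel α μ α s := by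
  rcases ht.eq_or_lt with rfl | ht
  · simp [mlKernel_one_zero hα]
  · rw [mlKernel_eq_add hα one_pos ht, rlKernel_one, intervalIntegral.integral_const_mul,
      ← lconv_one_left, ← lconv_mlKernel hα one_pos hα ht]
    congr 3
    ext s
    rw [rlKernel_one]

theorem norm_mlKernel_one_le (hα : α ∈ Ioo (0 : ℝ) 1) (ht : 0 ≤ t) : ‖mlKernel α μ 1 t‖ ≤ 1 := by
  have hK : PowBdd α (fun s => Complex.I * μ * mlKernel α μ α s) :=
    (powBdd_mlKernel hα.1 hα.1).const_mul _
  have hcont : ContinuousOn (mlKernel α μ 1) (Ici 0) := by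
    intro s hs
    have hs1 : (0 : ℝ) < s + 1 := by linarith [show (0 : ℝ) ≤ s from hs]
    have h := intervalIntegral.continuousOn_primitive_interval'
      (hK.intervalIntegrable hα.1 hs1) left_mem_uIcc
    rw [uIcc_of_le hs1.le] at h
    have h1 : ContinuousOn (mlKernel α μ 1) (Icc 0 (s + 1)) :=
      (continuousOn_const.add h).congr fun x hx => mlKernel_one_eq hα.1 hx.1
    refine (h1 s ⟨hs, by linarith⟩).mono_of_mem_nhdsWithin ?_
    rw [mem_nhdsWithin]
    exact ⟨Iio (s + 1), isOpen_Iio, by simp, fun x hx => ⟨hx.2, hx.1.le⟩⟩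
  have hderiv : ∀ s, 0 < s → HasDerivAt (mlKernel α μ 1) (Complex.I * μ * mlKernel α μ α s) s := by
    intro s hs
    have h := (intervalIntegral.integral_hasDerivAt_right (hK.intervalIntegrable hα.1 hs)
      (hK.cont.stronglyMeasurableAtFilter isOpen_Ioi s hs)
      (hK.cont.continuousAt (isOpen_Ioi.mem_nhds hs))).const_add 1
    refine h.congr_of_eventuallyEq ?_
    filter_upwards [isOpen_Ioi.mem_nhds hs] with x hx using mlKernel_one_eq hα.1 (le_of_lt hx)
  have hα1 : 0 < 1 - α := sub_pos.2 hα.2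
  have := norm_le_of_caputo_eq (y := mlKernel α μ 1) (μ := μ) hα hα.1 hcont hderiv hK
    (fun s hs => by
      rw [lconv_const_mul_right, lconv_mlKernel hα.1 hα1 hα.1 hs, sub_add_cancel]) ht
  simpa [mlKernel_one_zero hα.1] using this

/-- `K(t) = -i t^{α-1} E_{α,α}(iμt^α)`, for `t > 0`. -/
def solKernel (α μ t : ℝ) : ℂ := -Complex.I * mlKernel α μ α t

theorem kernel_eq_solKernel {α β lam t : ℝ} (ht : 0 < t) :
    kernel α β lam t = solKernel α (lam ^ β) t := by
  rw [kernel, solKernel, mlKernel_eq ht, mul_assoc]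

variable {α μ t T : ℝ} {h h' : ℝ → ℂ}

theorem powBdd_solKernel (hα : 0 < α) : PowBdd α (solKernel α μ) :=
  (powBdd_mlKernel hα hα).const_mul _

/-- Put the translation on the continuous factor. As it vanishes on negative times, the domain of
integration can be fixed, and dominated convergence applies with a multiple of `|a|`. -/
theorem continuous_lconv {p : ℝ} {a : ℝ → ℂ} (ha : PowBdd p a) (hp : 0 < p) (hc : Continuous h)
    (h0 : ∀ s ≤ 0, h s = 0) : ContinuousOn (lconv a h) (Ici 0) := by
  have hae : ∀ T, 0 < T → IntegrableOn a (Ioc 0 T) := fun T hT =>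
    (intervalIntegrable_iff_integrableOn_Ioc_of_le hT.le).1 (ha.intervalIntegrable hp hT)
  intro t ht
  have ht1 : (0 : ℝ) < t + 1 := by linarith [show (0 : ℝ) ≤ t from ht]
  obtain ⟨C, hC⟩ := isCompact_Icc.exists_bound_of_continuousOn (hc.continuousOn (s := Icc (-(t + 1)) (t + 1)))
  have hcont : ContinuousOn (fun x => ∫ s in Ioc 0 (t + 1), a s * h (x - s)) (Icc 0 (t + 1)) := by
    refine continuousOn_of_dominated (bound := fun s => ‖a s‖ * C) ?_ ?_ ?_ ?_
    · intro x hx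
      exact (hae _ ht1).aestronglyMeasurable.mul
        (hc.comp (by fun_prop : Continuous fun s => x - s)).aestronglyMeasurable
    · intro x hx
      filter_upwards [ae_restrict_mem measurableSet_Ioc] with s hs
      rw [norm_mul]
      exact mul_le_mul_of_nonneg_left (hC _ ⟨by linarith [hx.1, hs.2], by linarith [hx.2, hs.1]⟩)
        (norm_nonneg _)
    · exact (hae _ ht1).norm.mul_const C
    · exact Eventually.of_forall fun s => by fun_prop
  have heq : EqOn (lconv a h) (fun x => ∫ s in Ioc 0 (t + 1), a s * h (x - s)) (Icc 0 (t + 1)) := by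
    intro x hx
    rw [lconv_comm, lconv, intervalIntegral.integral_of_le hx.1]
    simp only [mul_comm (h _)]
    refine (setIntegral_eq_of_subset_of_forall_sdiff_eq_zero measurableSet_Ioc
      (Ioc_subset_Ioc_right hx.2) fun s hs => ?_).symm
    have : x < s := by
      by_contra hsx
      exact hs.2 ⟨hs.1.1, not_lt.1 hsx⟩
    rw [h0 _ (by linarith), mul_zero]
  refine ((hcont.congr heq) t ⟨ht, by linarith⟩).mono_of_mem_nhdsWithin ?_
  rw [mem_nhdsWithin]
  exact ⟨Iio (t + 1), isOpen_Iio, by simp, fun x hx => ⟨hx.2, hx.1.le⟩⟩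

/-- `h` is continuously differentiable with derivative `h'` and vanishes outside `(0, T)`. -/
structure IsBump (T : ℝ) (h h' : ℝ → ℂ) : Prop where
  deriv : ∀ t, HasDerivAt h (h' t) t
  cont : Continuous h'
  zero_left : ∀ t ≤ 0, h t = 0
  zero_right : ∀ t, T ≤ t → h t = 0

/-! ### Duhamel's formula for one mode, with bounds uniform in the frequency -/

namespace IsBump

theorem continuous (hh : IsBump T h h') : Continuous h :=
  continuous_iff_continuousAt.2 fun t => (hh.deriv t).continuousAt

theorem powBdd' (hh : IsBump T h h') : PowBdd 1 h' := .of_continuous hh.cont.continuousOn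

theorem integral_eq (hh : IsBump T h h') (t : ℝ) : ∫ s in (0 : ℝ)..t, h' s = h t := by
  rw [intervalIntegral.integral_eq_sub_of_hasDerivAt (fun s _ => hh.deriv s)
    (hh.cont.intervalIntegrable _ _), hh.zero_left 0 le_rfl, sub_zero]

theorem lconv_one (hh : IsBump T h h') : lconv (fun _ => 1) h' = h :=
  funext fun t => (lconv_one_left h' t).trans (hh.integral_eq t)

theorem powBdd_one : PowBdd 1 fun _ => (1 : ℂ) := .of_continuous continuousOn_const

/-- Associativity and commutativity: `1 * (a * h') = a * (1 * h') = a * h`, the last step because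
`h(0) = 0`. It is the integrated form of `(a * h)' = a * h'`. -/
theorem integral_lconv {p : ℝ} {a : ℝ → ℂ} (hh : IsBump T h h') (ha : PowBdd p a) (hp : 0 < p)
    (ht : 0 ≤ t) : ∫ s in (0 : ℝ)..t, lconv a h' s = lconv a h t := by
  rcases ht.eq_or_lt with rfl | ht
  · simp [lconv]
  rw [← lconv_one_left, ← lconv_assoc powBdd_one ha hh.powBdd' one_pos hp one_pos ht]
  have : lconv (fun _ => 1) a = lconv a (fun _ => 1) := funext fun s => lconv_comm _ _ s
  rw [this, lconv_assoc ha powBdd_one hh.powBdd' hp one_pos one_pos ht, hh.lconv_one]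

/-- Convolve `E = 1 + iμ ∫ t^{α-1} E_{α,α}` with `h'` and move the integration onto `h'`. The factor
`μ` is traded for a derivative of the source, against the bounded kernel `E`. -/
theorem mul_lconv_solKernel (hh : IsBump T h h') (hα : 0 < α) (ht : 0 < t) :
    μ * lconv (solKernel α μ) h t = h t - lconv (mlKernel α μ 1) h' t := by
  have hml := powBdd_mlKernel (μ := μ) hα hα
  have e1 : lconv (mlKernel α μ 1) h' t =
      lconv (fun s => 1 + Complex.I * μ * lconv (fun _ => 1) (mlKernel α μ α) s) h' t := by
    refine lconv_congr ht.le (fun s hs => ?_) fun _ _ => rfl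
    rw [mlKernel_one_eq hα hs.1.le, lconv_one_left, intervalIntegral.integral_const_mul]
  have e2 : lconv (fun s => 1 + Complex.I * μ * lconv (fun _ => 1) (mlKernel α μ α) s) h' t =
      h t + Complex.I * μ * lconv (lconv (fun _ => 1) (mlKernel α μ α)) h' t := by
    have hq : PowBdd (1 + α) (lconv (fun _ => 1) (mlKernel α μ α)) := by
      have e : EqOn (lconv (fun _ => 1) (mlKernel α μ α)) (mlKernel α μ (1 + α)) (Ioi 0) := by
        intro s hs
        rw [← lconv_mlKernel hα one_pos hα hs]
        congr 1
        ext s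
        rw [rlKernel_one]
      have h0 := powBdd_mlKernel (μ := μ) hα (show 0 < 1 + α by linarith)
      refine ⟨h0.cont.congr e, fun T hT => ?_⟩
      obtain ⟨C, hC, hb⟩ := h0.bdd T hT
      exact ⟨C, hC, fun t ht => by rw [e ht.1]; exact hb t ht⟩
    rw [← hh.integral_eq, ← lconv_one_left, ← lconv_const_mul_left, lconv, lconv, lconv,
      ← intervalIntegral.integral_add (powBdd_one.intervalIntegrable_mul hh.powBdd' one_pos one_pos ht)
        ((hq.const_mul _).intervalIntegrable_mul hh.powBdd' (by linarith) one_pos ht)]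
    simp only [add_mul]
  have e3 : lconv (lconv (fun _ => 1) (mlKernel α μ α)) h' t = lconv (mlKernel α μ α) h t := by
    rw [lconv_assoc powBdd_one hml hh.powBdd' one_pos hα one_pos ht, lconv_one_left,
      hh.integral_lconv hml hα ht.le]
  have e4 : lconv (solKernel α μ) h t = -Complex.I * lconv (mlKernel α μ α) h t :=
    lconv_const_mul_left _ _ _ _
  rw [e1, e2, e3, e4]
  ring

/-- `v = K * h` solves `i ∂_t^α v + μ v = h`. -/
theorem lconv_solKernel_eq (hh : IsBump T h h') (hα : α ∈ Ioo (0 : ℝ) 1) (ht : 0 < t) :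
    Complex.I * lconv (rlKernel (1 - α)) (lconv (solKernel α μ) h') t +
      μ * lconv (solKernel α μ) h t = h t := by
  have hα1 : 0 < 1 - α := sub_pos.2 hα.2
  -- `k_{1-α} * K = -iE`, so `i ∂_t^α v = E * h'`, which cancels against `μ v = h - E * h'`.
  have e : lconv (lconv (rlKernel (1 - α)) (solKernel α μ)) h' t =
      -Complex.I * lconv (mlKernel α μ 1) h' t := by
    rw [← lconv_const_mul_left]
    refine lconv_congr ht.le (fun s hs => ?_) fun _ _ => rfl
    have : lconv (rlKernel (1 - α)) (solKernel α μ) s = _ := lconv_const_mul_right _ _ _ _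
    rw [this, lconv_mlKernel hα.1 hα1 hα.1 hs.1, sub_add_cancel]
  rw [← lconv_assoc (powBdd_rlKernel hα1) (powBdd_solKernel hα.1) hh.powBdd' hα1 hα.1 one_pos ht, e,
    hh.mul_lconv_solKernel hα.1 ht]
  linear_combination (-lconv (mlKernel α μ 1) h' t) * Complex.I_mul_I

theorem deriv_zero (hh : IsBump T h h') {s : ℝ} (hs : T ≤ s) : h' s = 0 := by
  -- Comparing right derivatives includes the endpoint `s = T`.
  have h1 := (hh.deriv s).hasDerivWithinAt (s := Ici s)
  have h2 : HasDerivWithinAt h 0 (Ici s) s :=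
    (hasDerivWithinAt_const s (Ici s) (0 : ℂ)).congr (fun x hx => hh.zero_right x (hs.trans hx))
      (hh.zero_right s hs)
  exact (uniqueDiffOn_Ici s s self_mem_Ici).eq_deriv _ h1 h2

theorem integral_norm_le (hh : IsBump T h h') (ht : 0 ≤ t) :
    ∫ s in (0 : ℝ)..t, ‖h' s‖ ≤ ∫ s in (0 : ℝ)..T, ‖h' s‖ := by
  have hi : ∀ a b, IntervalIntegrable (fun s => ‖h' s‖) volume a b :=
    fun a b => hh.cont.norm.intervalIntegrable a b
  rcases le_total t T with htT | htT
  · exact intervalIntegral.integral_mono_interval le_rfl ht htT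
      (Eventually.of_forall fun s => norm_nonneg _) (hi _ _)
  · rw [← intervalIntegral.integral_add_adjacent_intervals (hi 0 T) (hi T t)]
    have : ∫ s in T..t, ‖h' s‖ = 0 := by
      rw [intervalIntegral.integral_congr (g := fun _ => (0 : ℝ))]
      · simp
      · intro s hs
        rw [uIcc_of_le htT] at hs
        simp [hh.deriv_zero hs.1]
    rw [this, add_zero]

theorem norm_le (hh : IsBump T h h') (hT : 0 ≤ T) (t : ℝ) :
    ‖h t‖ ≤ ∫ s in (0 : ℝ)..T, ‖h' s‖ := by
  rcases le_total t 0 with ht | ht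
  · rw [hh.zero_left t ht, norm_zero]
    exact intervalIntegral.integral_nonneg hT fun s _ => norm_nonneg _
  · rw [← hh.integral_eq t]
    exact (intervalIntegral.norm_integral_le_integral_norm ht).trans (hh.integral_norm_le ht)

/-- In `h - E * h'` both terms are at most `∫ |h'|`, because `|E| ≤ 1`. The bound depends on neither
`μ` nor `t`. -/
theorem mul_norm_lconv_le (hh : IsBump T h h') (hT : 0 ≤ T) (hα : α ∈ Ioo (0 : ℝ) 1) (hμ : 0 ≤ μ)
    (ht : 0 ≤ t) : μ * ‖lconv (solKernel α μ) h t‖ ≤ 2 * ∫ s in (0 : ℝ)..T, ‖h' s‖ := by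
  have hpos : 0 ≤ ∫ s in (0 : ℝ)..T, ‖h' s‖ :=
    intervalIntegral.integral_nonneg hT fun s _ => norm_nonneg _
  rcases ht.eq_or_lt with rfl | ht
  · simp [lconv, hpos]
  have e : μ * ‖lconv (solKernel α μ) h t‖ = ‖h t - lconv (mlKernel α μ 1) h' t‖ := by
    rw [← hh.mul_lconv_solKernel hα.1 ht, norm_mul, Complex.norm_real, Real.norm_of_nonneg hμ]
  have h2 : ‖lconv (mlKernel α μ 1) h' t‖ ≤ ∫ s in (0 : ℝ)..T, ‖h' s‖ := by
    refine le_trans ?_ (hh.integral_norm_le ht.le)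
    refine intervalIntegral.norm_integral_le_of_norm_le ht.le (Eventually.of_forall fun s hs => ?_)
      (hh.cont.norm.intervalIntegrable _ _)
    rw [norm_mul]
    exact mul_le_of_le_one_left (norm_nonneg _) (norm_mlKernel_one_le hα (sub_nonneg.2 hs.2))
  rw [e]
  linarith [norm_sub_le (h t) (lconv (mlKernel α μ 1) h' t), hh.norm_le hT t]

/-- For `μ = 0` the kernel is, up to `-i`, `t^{α-1}/Γ(α)`, which is not integrable at infinity. Up
to time `T + 1` integrate the kernel; afterwards `t - s ≥ 1` wherever `h(s) ≠ 0`, so the kernel is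
at most `1/Γ(α)` on an interval of length `T`. -/
theorem norm_lconv_zero_le (hh : IsBump T h h') (hT : 0 ≤ T) (hα : α ∈ Ioo (0 : ℝ) 1) (ht : 0 ≤ t) :
    ‖lconv (solKernel α 0) h t‖ ≤
      ((Real.Gamma α)⁻¹ * ((T + 1) ^ α / α + T)) * ∫ s in (0 : ℝ)..T, ‖h' s‖ := by
  set N := ∫ s in (0 : ℝ)..T, ‖h' s‖ with hN
  have hpos : 0 ≤ N := intervalIntegral.integral_nonneg hT fun s _ => norm_nonneg _
  have hG := Real.Gamma_pos_of_pos hα.1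
  have hα0 := hα.1
  have hT0 : (0 : ℝ) ≤ T := hT
  have e : lconv (solKernel α 0) h t = -Complex.I * lconv (rlKernel α) h t := by
    rw [← lconv_const_mul_left]
    refine lconv_congr ht (fun s hs => ?_) fun _ _ => rfl
    rw [solKernel, mlKernel_eq_add hα.1 hα.1 hs.1]
    simp
  rw [e, norm_mul, norm_neg, Complex.norm_I, one_mul]
  have hker : ∀ s, 0 ≤ s → ‖rlKernel α s‖ = (Real.Gamma α)⁻¹ * s ^ (α - 1) := fun s hs => by
    rw [rlKernel, Complex.norm_real, Real.norm_of_nonneg (by positivity), div_eq_inv_mul]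
  rcases le_total t (T + 1) with htT | htT
  · have h1 : ‖lconv (rlKernel α) h t‖ ≤
        ∫ s in (0 : ℝ)..t, (Real.Gamma α)⁻¹ * (t - s) ^ (α - 1) * N := by
      refine intervalIntegral.norm_integral_le_of_norm_le ht (Eventually.of_forall fun s hs => ?_) ?_
      · rw [norm_mul, hker _ (sub_nonneg.2 hs.2)]
        have := sub_nonneg.2 hs.2
        exact mul_le_mul_of_nonneg_left (hh.norm_le hT s) (by positivity)
      · have := (intervalIntegral.intervalIntegrable_rpow' (a := 0) (b := t)
          (r := α - 1) (by linarith)).comp_sub_left t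
        simp only [sub_zero, sub_self] at this
        exact (this.symm.const_mul _).mul_const _
    have h2 : ∫ s in (0 : ℝ)..t, (Real.Gamma α)⁻¹ * (t - s) ^ (α - 1) * N =
        (Real.Gamma α)⁻¹ * (t ^ α / α) * N := by
      rw [intervalIntegral.integral_mul_const, intervalIntegral.integral_const_mul,
        intervalIntegral.integral_comp_sub_left (fun s => s ^ (α - 1)), sub_self, sub_zero,
        integral_rpow (Or.inl (by linarith)), sub_add_cancel, Real.zero_rpow hα.1.ne', sub_zero]
    rw [h2] at h1
    refine h1.trans ?_
    have : t ^ α / α ≤ (T + 1) ^ α / α := by gcongr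
    gcongr
    linarith
  · have h1 : ‖lconv (rlKernel α) h t‖ ≤ ∫ s in (0 : ℝ)..t, (Iic T).indicator (fun _ => (Real.Gamma α)⁻¹ * N) s := by
      refine intervalIntegral.norm_integral_le_of_norm_le ht (Eventually.of_forall fun s hs => ?_) ?_
      · by_cases hsT : s ≤ T
        · rw [norm_mul, hker _ (sub_nonneg.2 hs.2), indicator_of_mem (show s ∈ Iic T from hsT)]
          have : (t - s) ^ (α - 1) ≤ 1 :=
            Real.rpow_le_one_of_one_le_of_nonpos (by linarith) (by linarith [hα.2])
          have h3 := hh.norm_le hT s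
          calc _ ≤ (Real.Gamma α)⁻¹ * 1 * N := by gcongr
            _ = _ := by ring
        · rw [hh.zero_right s (le_of_not_ge hsT), mul_zero, norm_zero]
          exact indicator_nonneg (fun _ _ => by positivity) _
      · rw [intervalIntegrable_iff]
        exact (integrableOn_const (by simp)).indicator measurableSet_Iic
    have h2 : ∫ s in (0 : ℝ)..t, (Iic T).indicator (fun _ => (Real.Gamma α)⁻¹ * N) s =
        (Real.Gamma α)⁻¹ * T * N := by
      refine (intervalIntegral.integral_indicator (a₂ := T) ⟨hT, by linarith⟩).trans ?_
      rw [intervalIntegral.integral_const, smul_eq_mul]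
      ring
    rw [h2] at h1
    refine h1.trans ?_
    have : 0 ≤ (T + 1) ^ α / α := by positivity
    gcongr
    linarith

end IsBump

/-- The homogeneous equation `i ∂_t^α w + μ w = 0`, `w(0) = 0` has only the trivial solution. -/
theorem eq_zero_of_caputo_eq {w w' : ℝ → ℂ} (hα : α ∈ Ioo (0 : ℝ) 1) (hc : ContinuousOn w (Ici 0))
    (hd : ∀ s, 0 < s → HasDerivAt w (w' s) s) (hw' : ContinuousOn w' (Ici 0))
    (heq : ∀ s, 0 < s → Complex.I * lconv (rlKernel (1 - α)) w' s + μ * w s = 0) (h0 : w 0 = 0)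
    (ht : 0 ≤ t) : w t = 0 := by
  have h := norm_le_of_caputo_eq (μ := μ) hα one_pos hc hd (.of_continuous hw') (fun s hs => by
    linear_combination (-Complex.I) * heq s hs + lconv (rlKernel (1 - α)) w' s * Complex.I_mul_I) ht
  rw [h0, norm_zero] at h
  exact norm_le_zero_iff.1 h

/-! ### Square summable sequences -/

/-- The Hilbert space of square summable sequences. -/
abbrev Seq2 := lp (fun _ : ℕ => ℂ) 2

theorem Seq2.hasSum_norm_sq (x : Seq2) : HasSum (fun k => ‖x k‖ ^ 2) (‖x‖ ^ 2) := by
  have h := lp.hasSum_norm (p := 2) (by norm_num) x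
  simpa using h

theorem Seq2.norm_sq_le {x : Seq2} {b : ℕ → ℝ} (hb : Summable fun k => b k ^ 2)
    (hx : ∀ k, ‖x k‖ ≤ b k) : ‖x‖ ^ 2 ≤ ∑' k, b k ^ 2 :=
  hasSum_le (fun k => pow_le_pow_left₀ (norm_nonneg _) (hx k) 2) (Seq2.hasSum_norm_sq x) hb.hasSum

theorem memℓp_two {x : ℕ → ℂ} {b : ℕ → ℝ} (hb : Summable fun k => b k ^ 2)
    (hx : ∀ k, ‖x k‖ ≤ b k) : Memℓp x 2 := by
  refine memℓp_gen ?_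
  simp only [ENNReal.toReal_ofNat, Real.rpow_ofNat]
  exact hb.of_nonneg_of_le (fun k => by positivity)
    fun k => pow_le_pow_left₀ (norm_nonneg _) (hx k) 2

/-- A square summable majorant upgrades coordinatewise continuity to norm continuity: `‖x t - x
t₀‖²` is a series of continuous functions dominated by `4 bₖ²`. -/
theorem continuous_seq2 {X : Type*} [TopologicalSpace X] {x : X → Seq2} {b : ℕ → ℝ}
    (hb : Summable fun k => b k ^ 2) (hx : ∀ t k, ‖x t k‖ ≤ b k)
    (hc : ∀ k, Continuous fun t => x t k) : Continuous x := by
  refine continuous_iff_continuousAt.2 fun t₀ => ?_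
  have h1 : Continuous fun t => ‖x t - x t₀‖ ^ 2 := by
    have : (fun t => ‖x t - x t₀‖ ^ 2) = fun t => ∑' k, ‖x t k - x t₀ k‖ ^ 2 := by
      ext t
      rw [← (Seq2.hasSum_norm_sq (x t - x t₀)).tsum_eq]
      rfl
    rw [this]
    refine continuous_tsum (fun k => ((hc k).sub continuous_const).norm.pow 2) (hb.mul_left 4) ?_
    intro k t
    have h1 := (norm_sub_le (x t k) (x t₀ k)).trans (add_le_add (hx t k) (hx t₀ k))
    rw [norm_pow, norm_norm]
    calc ‖x t k - x t₀ k‖ ^ 2 ≤ (b k + b k) ^ 2 := pow_le_pow_left₀ (norm_nonneg _) h1 2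
      _ = _ := by ring
  have h2 := h1.continuousAt (x := t₀)
  have h3 : Tendsto (fun t => ‖x t - x t₀‖ ^ 2) (𝓝 t₀) (𝓝 0) := by simpa [ContinuousAt] using h2
  have h4 := h3.sqrt
  simp only [Real.sqrt_zero, Real.sqrt_sq (norm_nonneg _)] at h4
  exact tendsto_iff_norm_sub_tendsto_zero.2 h4

variable {n : ℕ} {M : Type*} [TopologicalSpace M]
  [ChartedSpace (EuclideanSpace ℝ (Fin n)) M] [IsManifold (𝓡 n) ∞ M] [MeasurableSpace M]
  {g : Metric n M} (e : EigenBasis g) (r : ℝ)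

/-! ### Sobolev spaces in terms of Fourier coefficients -/

namespace EigenBasis

/-- The weight `(1 + λₖ^r)^{1/2}`. -/
def wt (k : ℕ) : ℝ := Real.sqrt (1 + e.lam k ^ r)

theorem one_le_wt (k : ℕ) : 1 ≤ e.wt r k := by
  have := Real.rpow_nonneg (e.lam_nonneg k) r
  exact Real.one_le_sqrt.2 (by linarith)

theorem wt_pos (k : ℕ) : 0 < e.wt r k := one_pos.trans_le (e.one_le_wt r k)

theorem weighted_apply (u : e.H r) (k : ℕ) :
    weighted e r u k = (e.wt r k : ℂ) * e.coeff k u.toL2 := rfl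

theorem norm_weighted (u : e.H r) : ‖weighted e r u‖ = ‖u‖ := rfl

theorem coeff_eq_repr (k : ℕ) (u : L2 g) : e.coeff k u = e.φ.repr u k :=
  (HilbertBasis.repr_apply_apply _ _ _).symm

theorem L2_ext {u v : L2 g} (h : ∀ k, e.coeff k u = e.coeff k v) : u = v := by
  apply e.φ.repr.injective
  ext k
  rw [← coeff_eq_repr, ← coeff_eq_repr, h]

/-- The weights are at least 1, so dividing by them stays in `ℓ²`. Curves in `H^r(M)` can therefore
be built and differentiated in `ℓ²`. -/
theorem weighted_surjective : Function.Surjective (weighted e r) := by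
  intro s
  have hw : ∀ k, ‖s k / (e.wt r k : ℂ)‖ ≤ ‖s k‖ := fun k => by
    rw [norm_div, Complex.norm_real, Real.norm_of_nonneg (e.wt_pos r k).le]
    exact div_le_self (norm_nonneg _) (e.one_le_wt r k)
  set c : Seq2 := ⟨fun k => s k / (e.wt r k : ℂ), memℓp_two (Seq2.hasSum_norm_sq s).summable hw⟩
  have hc : ∀ k, e.coeff k (e.φ.repr.symm c) = s k / (e.wt r k : ℂ) := fun k => by
    rw [coeff_eq_repr, LinearIsometryEquiv.apply_symm_apply]
  have hw2 : ∀ k, e.wt r k ^ 2 = 1 + e.lam k ^ r := weight_sq e r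
  refine ⟨⟨e.φ.repr.symm c, ?_⟩, ?_⟩
  · refine (Seq2.hasSum_norm_sq s).summable.of_nonneg_of_le (fun k => ?_) (fun k => ?_)
    · have := Real.rpow_nonneg (e.lam_nonneg k) r
      positivity
    · have hwk := e.wt_pos r k
      rw [hc, norm_div, Complex.norm_real, Real.norm_of_nonneg hwk.le, div_pow, mul_div_assoc',
        div_le_iff₀ (by positivity), hw2, mul_comm]
      have := sq_nonneg ‖s k‖
      nlinarith
  · ext k
    have hwk : (e.wt r k : ℂ) ≠ 0 := Complex.ofReal_ne_zero.2 (e.wt_pos r k).ne'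
    refine (congrArg ((e.wt r k : ℂ) * ·) (hc k)).trans ?_
    dsimp only
    field_simp

/-- `H^r(M)` is isometric to `ℓ²` through the weighted coefficients. -/
def weightedEquiv : e.H r ≃ₗᵢ[ℂ] Seq2 where
  toLinearEquiv := LinearEquiv.ofBijective (weighted e r)
    ⟨weighted_injective e r, e.weighted_surjective r⟩
  norm_map' _ := rfl

theorem weightedEquiv_apply (u : e.H r) : e.weightedEquiv r u = weighted e r u := rfl

theorem coeff_weightedEquiv_symm (s : Seq2) (k : ℕ) :
    e.coeff k ((e.weightedEquiv r).symm s).toL2 = s k / (e.wt r k : ℂ) := by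
  have h := e.weighted_apply r ((e.weightedEquiv r).symm s) k
  rw [← weightedEquiv_apply, LinearIsometryEquiv.apply_symm_apply] at h
  rw [h, mul_div_cancel_left₀ _ (Complex.ofReal_ne_zero.2 (e.wt_pos r k).ne')]

theorem norm_toL2_le (u : e.H r) : ‖u.toL2‖ ≤ ‖u‖ := by
  rw [← e.norm_weighted r u, ← e.φ.repr.norm_map]
  refine le_of_sq_le_sq ?_ (norm_nonneg _)
  refine hasSum_le (fun k => ?_) (Seq2.hasSum_norm_sq _) (Seq2.hasSum_norm_sq _)
  rw [weighted_apply, norm_mul, Complex.norm_real, Real.norm_of_nonneg (e.wt_pos r k).le,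
    ← coeff_eq_repr]
  exact pow_le_pow_left₀ (norm_nonneg _)
    (le_mul_of_one_le_left (norm_nonneg _) (e.one_le_wt r k)) 2

/-- The inclusion of `H^r(M)` in `L²(M)`, as a continuous linear map. -/
def toL2L : e.H r →L[ℂ] L2 g :=
  LinearMap.mkContinuous H.toL2 1 fun u => by rw [one_mul]; exact e.norm_toL2_le r u

/-- The Fourier coefficient as a continuous linear functional. -/
def coeffL (k : ℕ) : L2 g →L[ℂ] ℂ := innerSL ℂ (e.φ k)

theorem weightedEquiv_symm_single (k : ℕ) (c : ℂ) :
    (e.weightedEquiv r).symm (lp.single 2 k ((e.wt r k : ℂ) * c)) = c • e.φH r k := by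
  rw [LinearIsometryEquiv.symm_apply_eq, map_smul]
  ext j
  rw [weightedEquiv_apply, lp.coeFn_smul, Pi.smul_apply, weighted_apply]
  have h : e.coeff j (e.φH r k).toL2 = if j = k then 1 else 0 :=
    orthonormal_iff_ite.1 e.φ.orthonormal j k
  rw [h]
  by_cases hj : j = k
  · subst hj
    simp [mul_comm]
  · simp [hj]

variable {r}

theorem coeff_fracLaplacian (u : e.H (2 * r)) (k : ℕ) :
    e.coeff k (e.fracLaplacian u) = ((e.lam k ^ r : ℝ) : ℂ) * e.coeff k u.toL2 := by
  have hx : ∀ k, ‖((e.lam k ^ r : ℝ) : ℂ) * e.coeff k u.toL2‖ ^ 2 =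
      e.lam k ^ (2 * r) * ‖e.coeff k u.toL2‖ ^ 2 := fun k => by
    have h2 : e.lam k ^ (2 * r) = (e.lam k ^ r) ^ 2 := by
      rw [mul_comm 2 r, Real.rpow_mul (e.lam_nonneg k), Real.rpow_two]
    rw [norm_mul, mul_pow, Complex.norm_real,
      Real.norm_of_nonneg (Real.rpow_nonneg (e.lam_nonneg k) _), h2]
  set s : Seq2 := ⟨fun k => ((e.lam k ^ r : ℝ) : ℂ) * e.coeff k u.toL2,
    memℓp_two (u.summable.congr fun k => (hx k).symm) fun _ => le_rfl⟩
  have h := e.φ.hasSum_repr_symm s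
  rw [fracLaplacian, h.tsum_eq, coeff_eq_repr, LinearIsometryEquiv.apply_symm_apply]

end EigenBasis

/-! ### The Caputo derivative of curves in Sobolev spaces -/

variable {e} {α : ℝ} {r}

theorem hasDerivWithinAt_timeDeriv {E : Type*} [NormedAddCommGroup E] [NormedSpace ℝ E] {u : ℝ → E}
    (hu : ContDiffOn ℝ 1 u (Ici 0)) {t : ℝ} (ht : 0 ≤ t) :
    HasDerivWithinAt u (timeDeriv u t) (Ici 0) t :=
  ((hu t ht).differentiableWithinAt one_ne_zero).hasDerivWithinAt

theorem continuousOn_timeDeriv {E : Type*} [NormedAddCommGroup E] [NormedSpace ℝ E] {u : ℝ → E}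
    (hu : ContDiffOn ℝ 1 u (Ici 0)) : ContinuousOn (timeDeriv u) (Ici 0) :=
  hu.continuousOn_derivWithin (uniqueDiffOn_Ici 0) le_rfl

/-- The `k`-th Fourier coefficient of the time derivative of a curve. -/
def coeffDeriv (e : EigenBasis g) (k : ℕ) (u : ℝ → e.H r) (t : ℝ) : ℂ :=
  e.coeff k (timeDeriv u t).toL2

variable {u : ℝ → e.H r} {t : ℝ}

theorem hasDerivWithinAt_coeff (hu : ContDiffOn ℝ 1 u (Ici 0)) (k : ℕ) (ht : 0 ≤ t) :
    HasDerivWithinAt (fun s => e.coeff k (u s).toL2) (coeffDeriv e k u t) (Ici 0) t := by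
  have := (((e.coeffL k).comp (e.toL2L r)).restrictScalars ℝ).hasFDerivAt.comp_hasDerivWithinAt t
    (hasDerivWithinAt_timeDeriv hu ht)
  exact this

theorem continuousOn_coeffDeriv (hu : ContDiffOn ℝ 1 u (Ici 0)) (k : ℕ) :
    ContinuousOn (coeffDeriv e k u) (Ici 0) :=
  ((e.coeffL k).comp (e.toL2L r)).continuous.comp_continuousOn (continuousOn_timeDeriv hu)

/-- A Fourier coefficient is a continuous linear functional, so it passes through the time
derivative and through the integral, whose weight `(t-τ)^{-α}` is integrable since `α < 1`. -/
theorem coeff_caputo (hα : α ∈ Ioo (0 : ℝ) 1) (hu : ContDiffOn ℝ 1 u (Ici 0)) (k : ℕ) (ht : 0 < t) :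
    e.coeff k (caputo α (fun s => (u s).toL2) t) =
      lconv (rlKernel (1 - α)) (coeffDeriv e k u) t := by
  have hder : ∀ s, 0 ≤ s → timeDeriv (fun s => (u s).toL2) s = (timeDeriv u s).toL2 := by
    intro s hs
    have := ((e.toL2L r).restrictScalars ℝ).hasFDerivAt.comp_hasDerivWithinAt s
      (hasDerivWithinAt_timeDeriv hu hs)
    exact this.derivWithin (uniqueDiffOn_Ici (0 : ℝ) s hs)
  have hcont : ContinuousOn (fun s => (timeDeriv u s).toL2) (Ici 0) :=
    (e.toL2L r).continuous.comp_continuousOn (continuousOn_timeDeriv hu)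
  have hint : IntervalIntegrable (fun τ => (t - τ) ^ (-α) • (timeDeriv u τ).toL2) volume 0 t := by
    refine IntervalIntegrable.smul_continuousOn ?_ (hcont.mono ?_)
    · have := (intervalIntegral.intervalIntegrable_rpow' (a := 0) (b := t)
        (r := -α) (by linarith [hα.2])).comp_sub_left t
      simp only [sub_zero, sub_self] at this
      exact this.symm
    · rw [uIcc_of_le ht.le]
      exact Icc_subset_Ici_self
  have h1 : ∫ τ in (0 : ℝ)..t, (t - τ) ^ (-α) • timeDeriv (fun s => (u s).toL2) τ =
      ∫ τ in (0 : ℝ)..t, (t - τ) ^ (-α) • (timeDeriv u τ).toL2 := by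
    refine intervalIntegral.integral_congr fun s hs => ?_
    rw [uIcc_of_le ht.le] at hs
    simp only [hder s hs.1]
  have h2 := ((e.coeffL k).restrictScalars ℝ).intervalIntegral_comp_comm hint
  rw [caputo, h1]
  change (e.coeffL k).restrictScalars ℝ _ = _
  rw [map_smul, ← h2, lconv, ← intervalIntegral.integral_smul]
  refine intervalIntegral.integral_congr fun s _ => ?_
  rw [map_smul, smul_smul, Complex.real_smul, rlKernel, show 1 - α - 1 = -α by ring,
    div_eq_inv_mul]
  rfl

/-! ### Existence and uniqueness for the fractional Schrödinger equation -/

variable {n : ℕ} {M : Type*} [TopologicalSpace M]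
  [ChartedSpace (EuclideanSpace ℝ (Fin n)) M] [IsManifold (𝓡 n) ∞ M] [MeasurableSpace M]
  {g : Metric n M} {e : EigenBasis g} {α β T : ℝ}

/-- Expand the nonnegative integral of `(φ - N/T)²`, where `N/T` is the mean of `φ`. -/
theorem sq_integral_le {φ : ℝ → ℝ} (hφ : Continuous φ) (hT : 0 < T) :
    (∫ s in (0 : ℝ)..T, φ s) ^ 2 ≤ T * ∫ s in (0 : ℝ)..T, φ s ^ 2 := by
  set N := ∫ s in (0 : ℝ)..T, φ s
  have h : 0 ≤ ∫ s in (0 : ℝ)..T, (φ s - N / T) ^ 2 :=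
    intervalIntegral.integral_nonneg hT.le fun s _ => sq_nonneg _
  have h2 : ∫ s in (0 : ℝ)..T, (φ s - N / T) ^ 2 =
      (∫ s in (0 : ℝ)..T, φ s ^ 2) - 2 * (N / T) * N + T * (N / T) ^ 2 := by
    have e : ∀ s, (φ s - N / T) ^ 2 = φ s ^ 2 - 2 * (N / T) * φ s + (N / T) ^ 2 := fun s => by ring
    simp only [e]
    rw [intervalIntegral.integral_add, intervalIntegral.integral_sub,
      intervalIntegral.integral_const_mul, intervalIntegral.integral_const]
    · simp [N]
    all_goals exact Continuous.intervalIntegrable (by fun_prop) _ _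
  rw [h2] at h
  have h3 : (∫ s in (0 : ℝ)..T, φ s ^ 2) - 2 * (N / T) * N + T * (N / T) ^ 2 =
      (T * (∫ s in (0 : ℝ)..T, φ s ^ 2) - N ^ 2) / T := by
    field_simp
    ring
  rw [h3] at h
  have h4 := mul_nonneg h hT.le
  rw [div_mul_cancel₀ _ hT.ne'] at h4
  linarith

theorem continuous_coeff {F : ℝ → L2 g} (hF : Continuous F) (k : ℕ) :
    Continuous fun s => e.coeff k (F s) := (e.coeffL k).continuous.comp hF

/-- Cauchy-Schwarz in time, then Bessel's inequality at each time, bound all partial sums by `T ∫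
‖F‖²`. -/
theorem summable_sq_integral_coeff {F : ℝ → L2 g} (hF : Continuous F) (hT : 0 < T) :
    Summable fun k => (∫ s in (0 : ℝ)..T, ‖e.coeff k (F s)‖) ^ 2 := by
  refine summable_of_sum_le (c := T * ∫ s in (0 : ℝ)..T, ‖F s‖ ^ 2) (fun k => sq_nonneg _) fun S => ?_
  calc ∑ k ∈ S, (∫ s in (0 : ℝ)..T, ‖e.coeff k (F s)‖) ^ 2
      ≤ ∑ k ∈ S, T * ∫ s in (0 : ℝ)..T, ‖e.coeff k (F s)‖ ^ 2 :=
        Finset.sum_le_sum fun k _ => sq_integral_le (continuous_coeff hF k).norm hT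
    _ = T * ∫ s in (0 : ℝ)..T, ∑ k ∈ S, ‖e.coeff k (F s)‖ ^ 2 := by
        rw [← Finset.mul_sum, intervalIntegral.integral_finsetSum]
        exact fun k _ => ((continuous_coeff hF k).norm.pow 2).intervalIntegrable _ _
    _ ≤ _ := by
        refine mul_le_mul_of_nonneg_left ?_ hT.le
        refine intervalIntegral.integral_mono_on hT.le ?_ ?_ fun s _ => ?_
        · exact (continuous_finsetSum _ fun k _ => (continuous_coeff hF k).norm.pow 2).intervalIntegrable _ _
        · exact (hF.norm.pow 2).intervalIntegrable _ _
        · exact e.φ.orthonormal.sum_inner_products_le (F s)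

theorem isBump_coeff {F F' : ℝ → L2 g} (hd : ∀ t, HasDerivAt F (F' t) t) (hc : Continuous F')
    (h0 : ∀ t ≤ 0, F t = 0) (hT : ∀ t, T ≤ t → F t = 0) (k : ℕ) :
    IsBump T (fun t => e.coeff k (F t)) (fun t => e.coeff k (F' t)) where
  deriv t := ((e.coeffL k).restrictScalars ℝ).hasFDerivAt.comp_hasDerivAt t (hd t)
  cont := continuous_coeff hc k
  zero_left t ht := by simp [h0 t ht, EigenBasis.coeff]
  zero_right t ht := by simp [hT t ht, EigenBasis.coeff]

namespace EigenBasis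

/-- The spectral gap: `m` comes from the first positive eigenvalue. Several eigenvalues may vanish,
since `M` is not assumed connected. -/
theorem exists_le_of_rpow_ne_zero (e : EigenBasis g) (hβ : 0 < β) :
    ∃ m : ℝ, 0 < m ∧ ∀ k, e.lam k ^ β = 0 ∨ m ≤ e.lam k ^ β := by
  classical
  have hex : ∃ k, 0 < e.lam k := (e.lam_tendsto.eventually_gt_atTop 0).exists
  refine ⟨e.lam (Nat.find hex) ^ β, Real.rpow_pos_of_pos (Nat.find_spec hex) _, fun k => ?_⟩
  rcases lt_or_ge k (Nat.find hex) with hk | hk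
  · left
    rw [le_antisymm (not_lt.1 (Nat.find_min hex hk)) (e.lam_nonneg k), Real.zero_rpow hβ.ne']
  · exact Or.inr (Real.rpow_le_rpow (e.lam_nonneg _) (e.lam_mono hk) hβ.le)

theorem wt_le (e : EigenBasis g) (β : ℝ) (k : ℕ) : e.wt (2 * β) k ≤ 1 + e.lam k ^ β := by
  have h := Real.rpow_nonneg (e.lam_nonneg k) β
  rw [wt, Real.sqrt_le_left (by linarith), mul_comm 2 β, Real.rpow_mul (e.lam_nonneg k),
    Real.rpow_two]
  nlinarith

/-- Since the weight is at most `1 + λₖ^β`, one must bound `|v|` and `λₖ^β |v|`. For `λₖ ≠ 0` the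
second is at most `2 ∫ |h'|`, and the gap `m` then bounds the first; for `λₖ = 0` only the first is
present. One constant serves all modes and all times. -/
theorem exists_wt_mul_lconv_le (e : EigenBasis g) (hα : α ∈ Ioo (0 : ℝ) 1) (hβ : 0 < β)
    (hT : 0 ≤ T) :
    ∃ C : ℝ, ∀ k, ∀ h h' : ℝ → ℂ, IsBump T h h' → ∀ t, 0 ≤ t →
      ‖(e.wt (2 * β) k : ℂ) * lconv (solKernel α (e.lam k ^ β)) h t‖ ≤
        C * ∫ s in (0 : ℝ)..T, ‖h' s‖ := by
  obtain ⟨m, hm, hmk⟩ := e.exists_le_of_rpow_ne_zero hβ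
  have hG := Real.Gamma_pos_of_pos hα.1
  have hα0 := hα.1
  set C₀ := (Real.Gamma α)⁻¹ * ((T + 1) ^ α / α + T) with hC₀
  have hC₀' : 0 ≤ C₀ := by positivity
  refine ⟨C₀ + 2 * (1 / m + 1), fun k h h' hh t ht => ?_⟩
  have hN : 0 ≤ ∫ s in (0 : ℝ)..T, ‖h' s‖ := intervalIntegral.integral_nonneg hT fun s _ => norm_nonneg _
  rw [norm_mul, Complex.norm_real, Real.norm_of_nonneg (e.wt_pos _ k).le]
  have hw := mul_le_mul_of_nonneg_right (e.wt_le β k)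
    (norm_nonneg (lconv (solKernel α (e.lam k ^ β)) h t))
  refine hw.trans ?_
  rcases hmk k with hk | hk
  · rw [hk]
    have h1 := hh.norm_lconv_zero_le hT hα ht
    rw [add_zero, one_mul]
    refine h1.trans (mul_le_mul_of_nonneg_right ?_ hN)
    have : 0 ≤ 2 * (1 / m + 1) := by positivity
    linarith
  · have h1 := hh.mul_norm_lconv_le hT hα (hm.le.trans hk) ht
    set V := ‖lconv (solKernel α (e.lam k ^ β)) h t‖
    have hV : 0 ≤ V := norm_nonneg _
    have h2 : V ≤ 1 / m * (2 * ∫ s in (0 : ℝ)..T, ‖h' s‖) := by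
      rw [one_div, inv_mul_eq_div, le_div_iff₀ hm, mul_comm]
      exact (mul_le_mul_of_nonneg_right hk hV).trans h1
    have h3 : 0 ≤ C₀ * ∫ s in (0 : ℝ)..T, ‖h' s‖ := mul_nonneg hC₀' hN
    calc (1 + e.lam k ^ β) * V = V + e.lam k ^ β * V := by ring
      _ ≤ 1 / m * (2 * ∫ s in (0 : ℝ)..T, ‖h' s‖) + 2 * ∫ s in (0 : ℝ)..T, ‖h' s‖ := add_le_add h2 h1
      _ ≤ _ := by linarith

end EigenBasis

/-- The equation in terms of Fourier coefficients. -/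
theorem equation_iff {f : ℝ → L2 g} {u : ℝ → e.H (2 * β)} (hα : α ∈ Ioo (0 : ℝ) 1)
    (hu : ContDiffOn ℝ 1 u (Ici 0)) {t : ℝ} (ht : 0 < t) :
    Complex.I • caputo α (fun s => (u s).toL2) t + e.fracLaplacian (u t) = f t ↔
      ∀ k, Complex.I * lconv (rlKernel (1 - α)) (coeffDeriv e k u) t +
        ((e.lam k ^ β : ℝ) : ℂ) * e.coeff k (u t).toL2 = e.coeff k (f t) := by
  have h : ∀ k, e.coeff k (Complex.I • caputo α (fun s => (u s).toL2) t + e.fracLaplacian (u t)) =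
      Complex.I * lconv (rlKernel (1 - α)) (coeffDeriv e k u) t +
        ((e.lam k ^ β : ℝ) : ℂ) * e.coeff k (u t).toL2 := fun k => by
    rw [← coeff_caputo hα hu k ht, ← e.coeff_fracLaplacian]
    simp [EigenBasis.coeff, inner_add_right, inner_smul_right]
  refine ⟨fun heq k => by rw [← h, heq], fun heq => e.L2_ext fun k => by rw [h, heq]⟩

/-- Each Fourier coefficient of the difference solves the homogeneous scalar equation with zero
initial value. -/
theorem IsSolution.unique {f : ℝ → L2 g} {u v : ℝ → e.H (2 * β)} (hα : α ∈ Ioo (0 : ℝ) 1)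
    (hu : IsSolution e α β f u) (hv : IsSolution e α β f v) {t : ℝ} (ht : 0 ≤ t) : v t = u t := by
  have key : ∀ k, e.coeff k (v t).toL2 - e.coeff k (u t).toL2 = 0 := by
    intro k
    have hα1 : 0 < 1 - α := sub_pos.2 hα.2
    have hcu := continuousOn_coeffDeriv hu.contDiffOn k
    have hcv := continuousOn_coeffDeriv hv.contDiffOn k
    refine eq_zero_of_caputo_eq (μ := e.lam k ^ β)
      (w := fun s => e.coeff k (v s).toL2 - e.coeff k (u s).toL2)
      (w' := fun s => coeffDeriv e k v s - coeffDeriv e k u s) hα ?_ ?_ (hcv.sub hcu) ?_ ?_ ht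
    · exact fun s hs => ((hasDerivWithinAt_coeff hv.contDiffOn k hs).sub
        (hasDerivWithinAt_coeff hu.contDiffOn k hs)).continuousWithinAt
    · exact fun s hs => ((hasDerivWithinAt_coeff hv.contDiffOn k hs.le).sub
        (hasDerivWithinAt_coeff hu.contDiffOn k hs.le)).hasDerivAt (Ici_mem_nhds hs)
    · intro s hs
      have h1 := (equation_iff hα hu.contDiffOn hs).1 (hu.equation s hs) k
      have h2 := (equation_iff hα hv.contDiffOn hs).1 (hv.equation s hs) k
      have h3 : lconv (rlKernel (1 - α)) (fun s => coeffDeriv e k v s - coeffDeriv e k u s) s =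
          lconv (rlKernel (1 - α)) (coeffDeriv e k v) s -
            lconv (rlKernel (1 - α)) (coeffDeriv e k u) s := by
        rw [lconv, lconv, lconv, ← intervalIntegral.integral_sub
          ((powBdd_rlKernel hα1).intervalIntegrable_mul (.of_continuous hcv) hα1 one_pos hs)
          ((powBdd_rlKernel hα1).intervalIntegrable_mul (.of_continuous hcu) hα1 one_pos hs)]
        simp only [mul_sub]
      rw [h3]
      linear_combination h2 - h1
    · simp only [hu.initial, hv.initial, sub_self]
  exact Subtype.ext (e.L2_ext fun k => sub_eq_zero.1 (key k))

/-- The time derivative is built first: the sequence `W` of weighted `Kₖ * fₖ'` has the square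
summable majorant coming from `f''`, so it is a continuous curve in `ℓ²`. Its primitive `U` has the
coefficients `Kₖ * fₖ` because convolution commutes with integration. No series is differentiated
term by term. -/
theorem exists_isSolution {f : ℝ → L2 g} (e : EigenBasis g) (hα : α ∈ Ioo (0 : ℝ) 1) (hβ : 0 < β)
    (hf : IsSource f) :
    ∃ u : ℝ → e.H (2 * β), IsSolution e α β f u ∧ ∀ t, 0 ≤ t → ∀ k,
      e.coeff k (u t).toL2 = lconv (solKernel α (e.lam k ^ β)) (fun s => e.coeff k (f s)) t := by
  obtain ⟨T, hT, hfT⟩ : ∃ T : ℝ, 0 < T ∧ ∀ t, T ≤ t → t ∉ tsupport f := by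
    obtain ⟨B, hB⟩ := hf.hasCompactSupport.isCompact.bddAbove
    refine ⟨max B 0 + 1, by positivity, fun t ht hts => ?_⟩
    have := hB hts
    linarith [le_max_left B 0]
  have hf0 : ∀ t ≤ 0, t ∉ tsupport f := fun t ht hts => (hf.tsupport_subset hts).not_ge ht
  have hz : ∀ t, t ∉ tsupport f → f t = 0 := fun t ht => image_eq_zero_of_notMem_tsupport ht
  have hz' : ∀ t, t ∉ tsupport f → deriv f t = 0 := fun t ht =>
    Function.notMem_support.1 fun h => ht (support_deriv_subset h)
  have hc1 : ContDiff ℝ 1 (deriv f) := hf.contDiff.deriv'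
  have hd0 : ∀ t, HasDerivAt f (deriv f t) t := fun t =>
    (hf.contDiff.differentiable two_ne_zero t).hasDerivAt
  have hd1 : ∀ t, HasDerivAt (deriv f) (deriv (deriv f) t) t := fun t =>
    (hc1.differentiable one_ne_zero t).hasDerivAt
  have hc2 : Continuous (deriv (deriv f)) := hc1.continuous_deriv le_rfl
  set h : ℕ → ℝ → ℂ := fun k s => e.coeff k (f s)
  set h' : ℕ → ℝ → ℂ := fun k s => e.coeff k (deriv f s)
  set h'' : ℕ → ℝ → ℂ := fun k s => e.coeff k (deriv (deriv f) s)
  have hb0 : ∀ k, IsBump T (h k) (h' k) := isBump_coeff hd0 hc1.continuous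
    (fun t ht => hz t (hf0 t ht)) fun t ht => hz t (hfT t ht)
  have hb1 : ∀ k, IsBump T (h' k) (h'' k) := isBump_coeff hd1 hc2
    (fun t ht => hz' t (hf0 t ht)) fun t ht => hz' t (hfT t ht)
  set K : ℕ → ℝ → ℂ := fun k => solKernel α (e.lam k ^ β)
  have hK : ∀ k, PowBdd α (K k) := fun k => powBdd_solKernel hα.1
  obtain ⟨C, hC⟩ := e.exists_wt_mul_lconv_le hα hβ hT.le
  have hs0 : Summable fun k => (C * ∫ s in (0 : ℝ)..T, ‖h' k s‖) ^ 2 := by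
    simp only [mul_pow]
    exact (summable_sq_integral_coeff hc1.continuous hT).mul_left _
  have hs1 : Summable fun k => (C * ∫ s in (0 : ℝ)..T, ‖h'' k s‖) ^ 2 := by
    simp only [mul_pow]
    exact (summable_sq_integral_coeff hc2 hT).mul_left _
  have hWb : ∀ t k, ‖(e.wt (2 * β) k : ℂ) * lconv (K k) (h' k) (max t 0)‖ ≤
      C * ∫ s in (0 : ℝ)..T, ‖h'' k s‖ := fun t k => hC k _ _ (hb1 k) _ (le_max_right _ _)
  -- Replacing `t` by `max t 0` continues the curve constantly to negative times, so that it is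
  -- continuous and bounded on the whole line.
  set W : ℝ → Seq2 := fun t =>
    ⟨fun k => (e.wt (2 * β) k : ℂ) * lconv (K k) (h' k) (max t 0), memℓp_two hs1 (hWb t)⟩
  have hWc : Continuous W := by
    refine continuous_seq2 hs1 hWb fun k => continuous_const.mul ?_
    exact (continuous_lconv (hK k) hα.1 (hb1 k).continuous (hb1 k).zero_left).comp_continuous
      (by fun_prop) fun t => mem_Ici.2 (le_max_right t 0)
  set U : ℝ → Seq2 := fun t => ∫ s in (0 : ℝ)..t, W s
  have hU : ∀ t, HasDerivAt U (W t) t := fun t => intervalIntegral.integral_hasDerivAt_right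
    (hWc.intervalIntegrable _ _) hWc.stronglyMeasurable.stronglyMeasurableAtFilter hWc.continuousAt
  have hUk : ∀ t, 0 ≤ t → ∀ k, U t k = (e.wt (2 * β) k : ℂ) * lconv (K k) (h k) t := by
    intro t ht k
    have h1 := ((lp.evalCLM ℝ (fun _ : ℕ => ℂ) (p := 2) k)).intervalIntegral_comp_comm
      (hWc.intervalIntegrable (μ := volume) 0 t)
    have h2 : U t k = lp.evalCLM ℝ (fun _ : ℕ => ℂ) (p := 2) k (U t) := rfl
    rw [h2, ← h1, ← (hb0 k).integral_lconv (hK k) hα.1 ht, ← intervalIntegral.integral_const_mul]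
    refine intervalIntegral.integral_congr fun s hs => ?_
    rw [uIcc_of_le ht] at hs
    change (e.wt (2 * β) k : ℂ) * lconv (K k) (h' k) (max s 0) = _
    rw [max_eq_left hs.1]
  have hUb : ∀ t, 0 ≤ t → ‖U t‖ ≤ Real.sqrt (∑' k, (C * ∫ s in (0 : ℝ)..T, ‖h' k s‖) ^ 2) := by
    intro t ht
    refine Real.le_sqrt_of_sq_le (Seq2.norm_sq_le hs0 fun k => ?_)
    rw [hUk t ht]
    exact hC k _ _ (hb0 k) _ ht
  have hWb' : ∀ t, ‖W t‖ ≤ Real.sqrt (∑' k, (C * ∫ s in (0 : ℝ)..T, ‖h'' k s‖) ^ 2) :=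
    fun t => Real.le_sqrt_of_sq_le (Seq2.norm_sq_le hs1 (hWb t))
  set Φ := (e.weightedEquiv (2 * β)).symm
  set u : ℝ → e.H (2 * β) := fun t => Φ (U t)
  have hu' : ∀ t, HasDerivAt u (Φ (W t)) t := fun t =>
    ((Φ : Seq2 →L[ℂ] e.H (2 * β)).restrictScalars ℝ).hasFDerivAt.comp_hasDerivAt t (hU t)
  have huc : ContDiff ℝ 1 u := by
    rw [contDiff_one_iff_deriv]
    refine ⟨fun t => (hu' t).differentiableAt, ?_⟩
    rw [show deriv u = fun t => Φ (W t) from funext fun t => (hu' t).deriv]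
    exact Φ.continuous.comp hWc
  have htd : ∀ t, 0 ≤ t → timeDeriv u t = Φ (W t) := fun t ht =>
    (hu' t).hasDerivWithinAt.derivWithin (uniqueDiffOn_Ici (0 : ℝ) t ht)
  have hwk : ∀ k, (e.wt (2 * β) k : ℂ) ≠ 0 := fun k =>
    Complex.ofReal_ne_zero.2 (e.wt_pos _ k).ne'
  have hcoeff : ∀ t, 0 ≤ t → ∀ k, e.coeff k (u t).toL2 = lconv (K k) (h k) t := by
    intro t ht k
    rw [e.coeff_weightedEquiv_symm, hUk t ht, mul_div_cancel_left₀ _ (hwk k)]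
  have hcoeffD : ∀ t, 0 ≤ t → ∀ k, coeffDeriv e k u t = lconv (K k) (h' k) t := by
    intro t ht k
    rw [coeffDeriv, htd t ht, e.coeff_weightedEquiv_symm]
    change (e.wt (2 * β) k : ℂ) * lconv (K k) (h' k) (max t 0) / _ = _
    rw [mul_div_cancel_left₀ _ (hwk k), max_eq_left ht]
  refine ⟨u, ⟨huc.contDiffOn, ?_, ?_, ?_, ?_⟩, hcoeff⟩
  · refine memLp_top_of_bound huc.continuous.aestronglyMeasurable
      (Real.sqrt (∑' k, (C * ∫ s in (0 : ℝ)..T, ‖h' k s‖) ^ 2)) ?_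
    filter_upwards [ae_restrict_mem measurableSet_Ioi] with t ht
    rw [Φ.norm_map]
    exact hUb t (le_of_lt ht)
  · have hm : MemLp (fun t => Φ (W t)) ⊤ (volume.restrict (Ioi 0)) :=
      memLp_top_of_bound (Φ.continuous.comp hWc).aestronglyMeasurable _
        (Eventually.of_forall fun t => by rw [Φ.norm_map]; exact hWb' t)
    refine hm.ae_eq ?_
    filter_upwards [ae_restrict_mem measurableSet_Ioi] with t ht
    exact (htd t (le_of_lt ht)).symm
  · intro t ht
    rw [equation_iff hα huc.contDiffOn ht]
    intro k
    rw [hcoeff t ht.le, lconv_congr ht.le (fun _ _ => rfl) fun s hs => hcoeffD s hs.1.le k]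
    exact (hb0 k).lconv_solKernel_eq hα ht
  · simp [u, U]

/-- The expansion of an `ℓ²` sequence in unit vectors, carried over by the isometry; hence the
convergence is in `H^r(M)`. -/
theorem hasSum_of_coeff {r : ℝ} {u : e.H r} {c : ℕ → ℂ} (hc : ∀ k, e.coeff k u.toL2 = c k) :
    HasSum (fun k => c k • e.φH r k) u := by
  have h := (lp.hasSum_single (by norm_num) (e.weightedEquiv r u)).mapL
    (((e.weightedEquiv r).symm : Seq2 →L[ℂ] e.H r))
  convert h using 1
  · ext1 k
    rw [← e.weightedEquiv_symm_single, ← hc]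
    rfl
  · exact ((e.weightedEquiv r).symm_apply_apply u).symm

theorem exists_unique_solution (e : EigenBasis g) (hα : α ∈ Ioo (0 : ℝ) 1) (hβ : 0 < β)
    {f : ℝ → L2 g} (hf : IsSource f) :
    ∃ u : ℝ → e.H (2 * β), IsSolution e α β f u ∧
      (∀ v : ℝ → e.H (2 * β), IsSolution e α β f v → ∀ t, 0 ≤ t → v t = u t) ∧
      ∀ t, 0 ≤ t → HasSum (fun k => (∫ τ in (0 : ℝ)..t,
        kernel α β (e.lam k) (t - τ) * e.coeff k (f τ)) • e.φH (2 * β) k) (u t) := by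
  obtain ⟨u, hu, huk⟩ := exists_isSolution e hα hβ hf
  refine ⟨u, hu, fun v hv t ht => hu.unique hα hv ht, fun t ht => hasSum_of_coeff fun k => ?_⟩
  rw [huk t ht k]
  exact (lconv_congr ht (fun s hs => kernel_eq_solKernel hs.1) fun _ _ => rfl).symm

/-! ### Spectral theory of forms with compact resolvent -/

/-- A family of real numbers with finite sublevel sets can be listed in increasing order. -/
theorem exists_equiv_monotone {ι : Type*} [Infinite ι] (f : ι → ℝ) (hf : ∀ C, {i | f i ≤ C}.Finite) :
    ∃ σ : ℕ ≃ ι, Monotone (f ∘ σ) ∧ Tendsto (f ∘ σ) atTop atTop := by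
  classical
  have hcount : Countable ι := by
    have : (univ : Set ι) = ⋃ n : ℕ, {i | f i ≤ n} := by
      ext i
      simpa using exists_nat_ge (f i)
    rw [← countable_univ_iff, this]
    exact countable_iUnion fun n => (hf n).countable
  obtain ⟨enc, henc⟩ := exists_injective_nat ι
  -- The enumeration of `ι` breaks ties between equal values, so that ranks are distinct.
  set key : ι → ℝ ×ₗ ℕ := fun i => toLex (f i, enc i)
  have hkey : Function.Injective key := fun i j hij => henc (Prod.ext_iff.1 (toLex.injective hij)).2
  have hle : ∀ i j, key i ≤ key j → f i ≤ f j := fun i j hij => by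
    rcases (Prod.Lex.toLex_le_toLex).1 hij with h | h
    · exact h.le
    · exact h.1.le
  have hfin : ∀ i, {j | key j < key i}.Finite := fun i =>
    (hf (f i)).subset fun j hj => hle j i (le_of_lt hj)
  set r : ι → ℕ := fun i => {j | key j < key i}.ncard
  have hr : ∀ i j, key i < key j → r i < r j := fun i j hij =>
    ncard_lt_ncard ⟨fun k hk => lt_trans hk hij, fun h => lt_irrefl (key i) (h hij)⟩ (hfin j)
  have hrinj : Function.Injective r := fun i j hij => by
    by_contra hne
    rcases lt_or_gt_of_ne (hkey.ne hne) with h | h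
    · exact (hr _ _ h).ne hij
    · exact (hr _ _ h).ne' hij
  -- An infinite subset of `ℕ` is order isomorphic to `ℕ`, so it is not necessary to know that every
  -- rank occurs.
  have : Infinite (range r) := (infinite_range_of_injective hrinj).to_subtype
  set σ : ℕ ≃ ι := (Nat.Subtype.orderIsoOfNat (range r)).toEquiv.trans (Equiv.ofInjective r hrinj).symm
  have hσ : ∀ m, r (σ m) = Nat.Subtype.orderIsoOfNat (range r) m := fun m =>
    Equiv.apply_ofInjective_symm hrinj _
  have hmono : Monotone (f ∘ σ) := by
    intro m k hmk
    refine hle _ _ (not_lt.1 fun h => ?_)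
    have h1 := hr _ _ h
    rw [hσ, hσ] at h1
    exact (not_lt.2 ((Nat.Subtype.orderIsoOfNat (range r)).monotone hmk)) h1
  refine ⟨σ, hmono, tendsto_atTop.2 fun C => ?_⟩
  have h1 : (σ ⁻¹' {i | f i ≤ C}).Finite := (hf C).preimage σ.injective.injOn
  rw [← Nat.cofinite_eq_atTop]
  filter_upwards [h1.compl_mem_cofinite] with k hk
  exact (not_le.1 (show ¬ f (σ k) ≤ C from hk)).le

/-! ### Compact positive operators -/

section Operator

variable {H : Type*} [NormedAddCommGroup H] [InnerProductSpace ℂ H]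

/-- For a compact operator, orthonormal eigenvectors with eigenvalues bounded below are finite
in number. -/
theorem finite_eigenvalues_ge {T : H →L[ℂ] H} (hT : IsCompactOperator T) {ι : Type*} {v : ι → H}
    (hv : Orthonormal ℂ v) {μ : ι → ℝ} (hTv : ∀ i, T (v i) = (μ i : ℂ) • v i) {δ : ℝ} (hδ : 0 < δ) :
    {i | δ ≤ μ i}.Finite := by
  have hK := hT.isCompact_closure_image_closedBall 1
  obtain ⟨t, -, htfin, htcov⟩ := hK.finite_cover_balls (half_pos hδ)
  have hmem : ∀ i, ∃ y ∈ t, T (v i) ∈ Metric.ball y (δ / 2) := fun i => by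
    have h1 : T (v i) ∈ closure (T '' Metric.closedBall 0 1) :=
      subset_closure ⟨v i, by simp [hv.1 i], rfl⟩
    simpa using htcov h1
  choose c hct hcb using hmem
  -- The images `T vᵢ` with `μᵢ ≥ δ` are pairwise at distance at least `δ`, so two of them cannot
  -- share a ball of radius `δ/2`, and finitely many balls cover all of them.
  refine Set.Finite.of_finite_image (f := c) (htfin.subset (image_subset_iff.2 fun i _ => hct i)) ?_
  intro i hi k hk hik
  by_contra hne
  have h1 : dist (T (v i)) (T (v k)) < δ := by
    have e1 := hcb i
    have e2 := hcb k
    rw [Metric.mem_ball] at e1 e2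
    rw [← hik] at e2
    have := dist_triangle_right (T (v i)) (T (v k)) (c i)
    linarith
  have h2 : δ ≤ dist (T (v i)) (T (v k)) := by
    -- Pairing with the unit vector `vᵢ` leaves exactly `μᵢ`.
    have h3 : ‖⟪v i, T (v i) - T (v k)⟫_ℂ‖ ≤ ‖T (v i) - T (v k)‖ := by
      have := norm_inner_le_norm (𝕜 := ℂ) (v i) (T (v i) - T (v k))
      rwa [hv.1 i, one_mul] at this
    rw [inner_sub_right, hTv, hTv, inner_smul_right, inner_smul_right, hv.inner_eq_zero hne,
      inner_self_eq_norm_sq_to_K, hv.1 i] at h3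
    rw [dist_eq_norm]
    simp only [← hTv] at h3
    refine le_trans ?_ h3
    simpa using hi.trans (le_abs_self _)
  linarith

variable [CompleteSpace H]

/-- Spectral theorem: a compact positive injective operator has an orthonormal basis of eigenvectors,
listed by decreasing eigenvalues. -/
theorem exists_hilbertBasis_of_compact (hinf : ¬ FiniteDimensional ℂ H) {T : H →L[ℂ] H}
    (hT : IsCompactOperator T) (hsymm : (T : H →ₗ[ℂ] H).IsSymmetric)
    (hpos : ∀ x, 0 ≤ (⟪T x, x⟫_ℂ).re) (hinj : ∀ x, T x = 0 → x = 0) :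
    ∃ (b : HilbertBasis ℕ ℂ H) (ν : ℕ → ℝ), Monotone ν ∧ Tendsto ν atTop atTop ∧
      (∀ k, 0 < ν k) ∧ ∀ k, T (b k) = ((ν k)⁻¹ : ℂ) • b k := by
  set E : {μ : ℝ // 0 < μ} → Submodule ℂ H :=
    fun μ => Module.End.eigenspace (T : H →ₗ[ℂ] H) (μ : ℝ)
  have hfd : ∀ μ, FiniteDimensional ℂ (E μ) := fun μ =>
    ContinuousLinearMap.finite_dimensional_eigenspace hT _ (Complex.ofReal_ne_zero.2 μ.2.ne')
  set ι := Σ μ : {μ : ℝ // 0 < μ}, Fin (Module.finrank ℂ (E μ))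
  set v : ι → H := fun i => (stdOrthonormalBasis ℂ (E i.1) i.2 : H)
  have hv : Orthonormal ℂ v := by
    have h1 : OrthogonalFamily ℂ (fun μ => E μ) fun μ => (E μ).subtypeₗᵢ :=
      hsymm.orthogonalFamily_eigenspaces.comp
        (f := fun μ : {μ : ℝ // 0 < μ} => ((μ : ℝ) : ℂ))
        fun a b h => Subtype.ext (Complex.ofReal_injective h)
    exact h1.orthonormal_sigma_orthonormal fun μ => (stdOrthonormalBasis ℂ (E μ)).orthonormal
  have hTv : ∀ i, T (v i) = ((i.1 : ℝ) : ℂ) • v i := fun i =>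
    Module.End.mem_eigenspace_iff.1 (stdOrthonormalBasis ℂ (E i.1) i.2).2
  -- Every eigenvalue is real by symmetry, nonnegative by positivity and nonzero by injectivity. So
  -- the eigenspaces with positive eigenvalue, from which `v` is made, are all of them.
  have hspan : (Submodule.span ℂ (range v))ᗮ = ⊥ := by
    rw [eq_bot_iff, ← ContinuousLinearMap.orthogonalComplement_iSup_eigenspaces_eq_bot hT hsymm]
    refine Submodule.orthogonal_le (iSup_le fun μ => ?_)
    by_cases hμ : Module.End.HasEigenvalue (T : H →ₗ[ℂ] H) μ
    · obtain ⟨x, hx⟩ := hμ.exists_hasEigenvector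
      have hreal : ((μ.re : ℝ) : ℂ) = μ := by
        have := hsymm.conj_eigenvalue_eq_self hμ
        exact Complex.conj_eq_iff_re.1 this
      have hxp : 0 < ‖x‖ ^ 2 := by
        have := norm_pos_iff.2 hx.2
        positivity
      have hx1 : T x = μ • x := hx.apply_eq_smul
      have hμ0 : 0 < μ.re := by
        have h1 := hpos x
        rw [hx1, inner_smul_left, inner_self_eq_norm_sq_to_K, ← hreal] at h1
        have h2 : ((starRingEnd ℂ) (μ.re : ℂ) * ((‖x‖ : ℂ)) ^ 2).re = μ.re * ‖x‖ ^ 2 := by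
          rw [Complex.conj_ofReal, Complex.re_ofReal_mul]
          norm_cast
        have h3 : 0 ≤ μ.re * ‖x‖ ^ 2 := h2 ▸ h1
        have h4 : 0 ≤ μ.re := nonneg_of_mul_nonneg_left h3 hxp
        refine h4.lt_of_ne fun h => hx.2 (hinj x ?_)
        rw [hx1, ← hreal, ← h]
        simp
      have hE : Module.End.eigenspace (T : H →ₗ[ℂ] H) μ = E ⟨μ.re, hμ0⟩ := by
        simp only [E]
        rw [hreal]
      rw [hE]
      intro y hy
      have h5 := (stdOrthonormalBasis ℂ (E ⟨μ.re, hμ0⟩)).sum_repr ⟨y, hy⟩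
      have h6 : Subtype.val _ = y := congrArg Subtype.val h5
      rw [← h6]
      simp only [Submodule.coe_sum, Submodule.coe_smul]
      exact Submodule.sum_mem _ fun i _ => Submodule.smul_mem _ _
        (Submodule.subset_span ⟨⟨⟨μ.re, hμ0⟩, i⟩, rfl⟩)
    · rw [Module.End.hasEigenvalue_iff, not_not] at hμ
      exact hμ.le.trans bot_le
  set b₀ := HilbertBasis.mkOfOrthogonalEqBot hv hspan
  have hb₀ : ⇑b₀ = v := HilbertBasis.coe_mkOfOrthogonalEqBot _ _
  have hιinf : Infinite ι := by
    by_contra hfin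
    rw [not_infinite_iff_finite] at hfin
    have := Fintype.ofFinite ι
    exact hinf (b₀.toOrthonormalBasis.toBasis.finiteDimensional_of_finite)
  have hsub : ∀ C : ℝ, {i : ι | (i.1 : ℝ)⁻¹ ≤ C}.Finite := by
    intro C
    refine (finite_eigenvalues_ge hT hv hTv (δ := (max C 1)⁻¹) (by positivity)).subset fun i hi => ?_
    exact inv_le_of_inv_le₀ i.1.2 ((show (i.1 : ℝ)⁻¹ ≤ C from hi).trans (le_max_left _ _))
  obtain ⟨σ, hσm, hσt⟩ := exists_equiv_monotone (fun i : ι => (i.1 : ℝ)⁻¹) hsub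
  have hv' : Orthonormal ℂ (v ∘ σ) := hv.comp σ σ.injective
  have hspan' : (Submodule.span ℂ (range (v ∘ σ)))ᗮ = ⊥ := by
    rw [σ.surjective.range_comp, hspan]
  refine ⟨HilbertBasis.mkOfOrthogonalEqBot hv' hspan', _, hσm, hσt, fun k => inv_pos.2 (σ k).1.2,
    fun k => ?_⟩
  rw [HilbertBasis.coe_mkOfOrthogonalEqBot]
  simp [hTv]

end Operator

/-! ### Forms, compact embeddings and their spectra -/

section Form

variable {H : Type*} [NormedAddCommGroup H] [InnerProductSpace ℂ H] [CompleteSpace H]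

/-- An operator is compact if its norm is controlled, up to an arbitrarily small multiple of the
norm, by finitely many functionals. -/
theorem isCompactOperator_of_forall_functionals {D V : Type*} [SeminormedAddCommGroup D]
    [InnerProductSpace ℂ D] [NormedAddCommGroup V] [InnerProductSpace ℂ V] (i : D →L[ℂ] V)
    (hi : DenseRange i) (hin : ∀ x, ‖i x‖ = ‖x‖) (J : V →L[ℂ] H)
    (hJ : ∀ ε > 0, ∃ (ι : Type) (_ : Fintype ι) (L : ι → D →ₗ[ℂ] ℂ) (C : ℝ),
      (∀ k x, ‖L k x‖ ≤ C * ‖x‖) ∧ ∀ x, ‖J (i x)‖ ^ 2 ≤ ε * ‖x‖ ^ 2 + ∑ k, ‖L k x‖ ^ 2) :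
    IsCompactOperator J := by
  refine (isCompactOperator_iff_isCompact_closure_image_ball (J : V →ₗ[ℂ] H) zero_lt_one).2 ?_
  set S := (fun x => J (i x)) '' Metric.ball (0 : D) 1
  have hS : TotallyBounded S := by
    rw [Metric.totallyBounded_iff]
    intro ε hε
    -- Two points of the unit ball differ by at most 2 in norm, so this term costs `ε²/4`; `η` below
    -- makes the functionals cost at most `ε²/4` as well.
    obtain ⟨ι, _, L, C, hL, hJL⟩ := hJ (ε ^ 2 / 16) (by positivity)
    have hC0 : 0 ≤ max C 0 := le_max_right _ _
    have hR : ∀ x ∈ Metric.ball (0 : D) 1, ∀ k, ‖L k x‖ ≤ max C 0 := fun x hx k => by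
      have hx1 : ‖x‖ ≤ 1 := (mem_ball_zero_iff.1 hx).le
      calc ‖L k x‖ ≤ C * ‖x‖ := hL k x
        _ ≤ max C 0 * 1 := by gcongr; exact le_max_left _ _
        _ = _ := mul_one _
    have hbdd : TotallyBounded ((fun x k => L k x) '' Metric.ball (0 : D) 1 : Set (ι → ℂ)) := by
      refine (isCompact_closedBall (0 : ι → ℂ) (max C 0)).totallyBounded.subset ?_
      rintro _ ⟨x, hx, rfl⟩
      rw [mem_closedBall_zero_iff, pi_norm_le_iff_of_nonneg hC0]
      exact hR x hx
    set η : ℝ := ε / (2 * (Fintype.card ι + 1))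
    have hη : 0 < η := by positivity
    rw [Metric.totallyBounded_iff] at hbdd
    obtain ⟨t, htfin, htcov⟩ := hbdd (η / 2) (half_pos hη)
    -- The centres `y` of the finite net need not be values of the functionals. Each is replaced by
    -- a point of the unit ball whose values lie near `y`, if there is one, and by 0 otherwise.
    have hpick : ∀ y : ι → ℂ, ∃ z : D, ∀ x ∈ Metric.ball (0 : D) 1,
        (fun k => L k x) ∈ Metric.ball y (η / 2) →
        z ∈ Metric.ball (0 : D) 1 ∧ (fun k => L k z) ∈ Metric.ball y (η / 2) := by
      intro y
      by_cases h : ∃ x ∈ Metric.ball (0 : D) 1, (fun k => L k x) ∈ Metric.ball y (η / 2)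
      · obtain ⟨x, h1, h2⟩ := h
        exact ⟨x, fun _ _ _ => ⟨h1, h2⟩⟩
      · exact ⟨0, fun x hx hy => absurd ⟨x, hx, hy⟩ h⟩
    choose z hz using hpick
    refine ⟨(fun y => J (i (z y))) '' t, htfin.image _, ?_⟩
    rintro _ ⟨x, hx, rfl⟩
    obtain ⟨y, hyt, hxy⟩ : ∃ y ∈ t, (fun k => L k x) ∈ Metric.ball y (η / 2) := by
      simpa using htcov ⟨x, hx, rfl⟩
    obtain ⟨hz1, hz2⟩ := hz y x hx hxy
    simp only [mem_iUnion]
    refine ⟨_, ⟨y, hyt, rfl⟩, ?_⟩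
    rw [Metric.mem_ball, dist_eq_norm, ← map_sub, ← map_sub]
    have hk : ∀ k, ‖L k (x - z y)‖ ≤ η := fun k => by
      rw [map_sub, ← dist_eq_norm]
      have e1 := (dist_le_pi_dist (fun k => L k x) y k).trans_lt (Metric.mem_ball.1 hxy)
      have e2 := (dist_le_pi_dist (fun k => L k (z y)) y k).trans_lt (Metric.mem_ball.1 hz2)
      have := dist_triangle_right (L k x) (L k (z y)) (y k)
      linarith
    have hn : ‖x - z y‖ ≤ 2 := by
      have := norm_sub_le x (z y)
      have e1 := mem_ball_zero_iff.1 hx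
      have e2 := mem_ball_zero_iff.1 hz1
      linarith
    have hsum : ∑ k, ‖L k (x - z y)‖ ^ 2 ≤ ε ^ 2 / 4 := by
      calc ∑ k, ‖L k (x - z y)‖ ^ 2 ≤ ∑ _k : ι, η ^ 2 :=
            Finset.sum_le_sum fun k _ => pow_le_pow_left₀ (norm_nonneg _) (hk k) 2
        _ = Fintype.card ι * η ^ 2 := by simp
        _ ≤ (Fintype.card ι + 1) ^ 2 * η ^ 2 := by
            have : (0 : ℝ) ≤ Fintype.card ι := by positivity
            gcongr
            nlinarith
        _ = ε ^ 2 / 4 := by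
            simp only [η]
            field_simp
            norm_num
    have h1 := hJL (x - z y)
    have h2 : ε ^ 2 / 16 * ‖x - z y‖ ^ 2 ≤ ε ^ 2 / 16 * 2 ^ 2 := by gcongr
    refine lt_of_pow_lt_pow_left₀ 2 hε.le ?_
    nlinarith
  refine isCompact_iff_totallyBounded_isComplete.2
    ⟨hS.closure.subset ?_, isClosed_closure.isComplete⟩
  refine closure_minimal ?_ isClosed_closure
  rintro _ ⟨w, hw, rfl⟩
  have hw' : w ∈ closure (i '' Metric.ball (0 : D) 1) := by
    have h1 : w ∈ closure (Metric.ball (0 : V) 1 ∩ range i) := by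
      have := hi.open_subset_closure_inter (Metric.isOpen_ball (x := (0 : V)) (ε := 1)) 
      exact this hw
    refine closure_mono ?_ h1
    rintro _ ⟨hx, x, rfl⟩
    refine ⟨x, ?_, rfl⟩
    rw [mem_ball_zero_iff] at hx ⊢
    rwa [← hin]
  have := image_closure_subset_closure_image (s := i '' Metric.ball (0 : D) 1) J.continuous ⟨w, hw', rfl⟩
  rwa [image_image] at this

/-- Spectral theorem for the operator associated with the inner product of a space that embeds
compactly in `H`. -/
theorem exists_hilbertBasis_of_embedding (hinf : ¬ FiniteDimensional ℂ H) {D : Type*}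
    [SeminormedAddCommGroup D] [InnerProductSpace ℂ D] (j : D →L[ℂ] H) (hj : DenseRange j)
    (hJ : ∀ ε > 0, ∃ (ι : Type) (_ : Fintype ι) (L : ι → D →ₗ[ℂ] ℂ) (C : ℝ),
      (∀ k x, ‖L k x‖ ≤ C * ‖x‖) ∧ ∀ x, ‖j x‖ ^ 2 ≤ ε * ‖x‖ ^ 2 + ∑ k, ‖L k x‖ ^ 2) :
    ∃ (b : HilbertBasis ℕ ℂ H) (ν : ℕ → ℝ), Monotone ν ∧ Tendsto ν atTop atTop ∧
      (∀ k, ∃ φ : ℕ → D, Tendsto (fun m => j (φ m)) atTop (𝓝 (b k)) ∧ CauchySeq φ ∧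
        ∀ ψ, Tendsto (fun m => ⟪ψ, φ m⟫_ℂ) atTop (𝓝 (ν k * ⟪j ψ, b k⟫_ℂ))) ∧
      (∀ k, ∀ x : D, ∀ c : ℂ, (∀ ψ, ⟪ψ, x⟫_ℂ = c * ⟪j ψ, j x⟫_ℂ) → c * ⟪b k, j x⟫_ℂ = ν k * ⟪b k, j x⟫_ℂ) ∧
      ((∀ x, ‖j x‖ ≤ ‖x‖) → ∀ k, 1 ≤ ν k) := by
  set V := UniformSpace.Completion D
  set i : D →L[ℂ] V := UniformSpace.Completion.toComplL
  have hi : DenseRange i := UniformSpace.Completion.denseRange_coe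
  have hiu : IsUniformInducing i := UniformSpace.Completion.isUniformInducing_coe D
  set J : V →L[ℂ] H := j.extend i
  have hJi : ∀ x, J (i x) = j x := fun x => ContinuousLinearMap.extend_eq _ hi hiu x
  have hii : ∀ x y, ⟪i x, i y⟫_ℂ = ⟪x, y⟫_ℂ := fun x y => UniformSpace.Completion.inner_coe x y
  have hJc : IsCompactOperator J := by
    refine isCompactOperator_of_forall_functionals i hi (fun x => UniformSpace.Completion.norm_coe x) J ?_
    simpa only [hJi] using hJ
  -- `A x` is the weak solution of the equation with right-hand side `x`, by the relation `⟪w, A x⟫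
  -- = ⟪J w, x⟫`; `T = J A` is the resolvent. It is positive since `⟪T x, x⟫ = ‖A x‖²`, and
  -- injective since `J` has dense range.
  set A : H →L[ℂ] V := ContinuousLinearMap.adjoint J
  have hA : ∀ w x, ⟪w, A x⟫_ℂ = ⟪J w, x⟫_ℂ := fun w x => ContinuousLinearMap.adjoint_inner_right J w x
  have hA' : ∀ w x, ⟪A x, w⟫_ℂ = ⟪x, J w⟫_ℂ := fun w x => ContinuousLinearMap.adjoint_inner_left J w x
  set T : H →L[ℂ] H := J.comp A
  have hTc : IsCompactOperator T := hJc.comp_clm A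
  have hTapp : ∀ x, T x = J (A x) := fun _ => rfl
  have hTin : ∀ x y, ⟪T x, y⟫_ℂ = ⟪A x, A y⟫_ℂ := fun x y => by rw [hTapp, hA]
  obtain ⟨b, ν, hm, ht, hν, hb⟩ := exists_hilbertBasis_of_compact hinf hTc
    (fun x y => by
      change ⟪T x, y⟫_ℂ = ⟪x, T y⟫_ℂ
      rw [hTin, hTapp y, hA'])
    (fun x => by
      rw [hTin]
      exact inner_self_nonneg (𝕜 := ℂ) (x := A x))
    (fun x hx => by
      have h1 : A x = 0 := by
        have h2 := hTin x x
        rw [hx, inner_zero_left] at h2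
        exact inner_self_eq_zero.1 h2.symm
      refine hj.eq_zero_of_inner_left ℂ fun ψ => ?_
      rw [← inner_conj_symm, ← hJi, ← hA, h1, inner_zero_right, map_zero])
  have hνc : ∀ k, (ν k : ℂ) ≠ 0 := fun k => Complex.ofReal_ne_zero.2 (hν k).ne'
  refine ⟨b, ν, hm, ht, fun k => ?_, fun k x c hx => ?_, fun hjle k => ?_⟩
  -- This lifts the eigenvector `bₖ` to the completion: `J y = bₖ`, and `y` satisfies the weak
  -- eigenvalue equation. The `φ m` are elements of `D` converging to `y`.
  · set y : V := (ν k : ℂ) • A (b k)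
    have hJy : J y = b k := by
      rw [map_smul, ← hTapp, hb, smul_smul]
      rw [mul_inv_cancel₀ (hνc k), one_smul]
    obtain ⟨w, hw, hwy⟩ := mem_closure_iff_seq_limit.1 (hi y)
    choose φ hφ using hw
    have hφy : Tendsto (fun m => i (φ m)) atTop (𝓝 y) := by simpa only [hφ] using hwy
    refine ⟨φ, ?_, ?_, fun ψ => ?_⟩
    · have := (J.continuous.tendsto y).comp hφy
      simpa only [hJy, Function.comp_def, hJi] using this
    · exact hiu.cauchy_map_iff.1 (by rw [Filter.map_map]; exact hφy.cauchySeq)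
    · have := Tendsto.inner (𝕜 := ℂ) (tendsto_const_nhds (x := i ψ)) hφy
      simp only [hii] at this
      rwa [inner_smul_right, hA, hJi] at this
  -- The hypothesis says that `x` is a weak eigenvector with value `c`, so `c T(j x) = j x`. Moving
  -- `T` to `bₖ` shows that `j x` can have a component along `bₖ` only if `νₖ = c`.
  · have hAx : i x = c • A (j x) := by
      refine (hi.eq_of_inner_right ℂ fun ψ => ?_)
      rw [hii, hx, inner_smul_right, hA, hJi]
    have h1 : c • T (j x) = j x := by
      rw [hTapp, ← map_smul, ← hAx, hJi]
    have h2 : ⟪T (b k), j x⟫_ℂ = ⟪b k, T (j x)⟫_ℂ := by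
      rw [hTin, hTapp (j x), hA']
    have h3 : ⟪b k, j x⟫_ℂ = c * ⟪b k, T (j x)⟫_ℂ := by rw [← inner_smul_right, h1]
    rw [← h2, hb, inner_smul_left] at h3
    have h4 : (starRingEnd ℂ) ((ν k : ℂ)⁻¹) = (ν k : ℂ)⁻¹ := by
      rw [map_inv₀, Complex.conj_ofReal]
    rw [h4] at h3
    nth_rewrite 2 [h3]
    field_simp [hνc k]
  · have hJle : ∀ w, ‖J w‖ ≤ ‖w‖ := fun w => hi.induction_on w
      (isClosed_le J.continuous.norm continuous_norm) fun x => by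
        rw [hJi]
        exact (hjle x).trans (UniformSpace.Completion.norm_coe x).ge
    have hb1 : ‖b k‖ = 1 := b.orthonormal.1 k
    -- `1/ν = ‖A b‖²` and, as `‖J‖ ≤ 1`, `1/ν = ‖J A b‖ ≤ ‖A b‖`. Hence `1/ν² ≤ 1/ν`.
    have h1 : ‖A (b k)‖ ^ 2 = (ν k)⁻¹ := by
      rw [← inner_self_eq_norm_sq (𝕜 := ℂ), ← hTin, hb, inner_smul_left, inner_self_eq_norm_sq_to_K,
        hb1, ← Complex.ofReal_inv, Complex.conj_ofReal]
      simp
    have h2 : (ν k)⁻¹ ≤ ‖A (b k)‖ := by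
      have := hJle (A (b k))
      rw [← hTapp, hb, norm_smul, hb1, mul_one, ← Complex.ofReal_inv, Complex.norm_real,
        Real.norm_of_nonneg (inv_pos.2 (hν k)).le] at this
      exact this
    have h3 := inv_pos.2 (hν k)
    have h4 : (ν k)⁻¹ * (ν k)⁻¹ ≤ (ν k)⁻¹ * 1 := by
      rw [mul_one, ← sq]
      conv_rhs => rw [← h1]
      exact pow_le_pow_left₀ h3.le h2 2
    exact (inv_le_one₀ (hν k)).1 (le_of_mul_le_mul_left h4 h3)

/-- Spectral theorem for a nonnegative form `a` (linear in its first variable) on a dense domain in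
`H`, with compact resolvent, that has a null vector. -/
theorem exists_hilbertBasis_of_form (hinf : ¬ FiniteDimensional ℂ H) {D : Type*} [AddCommGroup D]
    [Module ℂ D] (j : D →ₗ[ℂ] H) (hj : DenseRange j) (a : D → D → ℂ)
    (hadd : ∀ x y z, a (x + y) z = a x z + a y z) (hsmul : ∀ (c : ℂ) x y, a (c • x) y = c * a x y)
    (hconj : ∀ x y, (starRingEnd ℂ) (a x y) = a y x) (hnonneg : ∀ x, 0 ≤ (a x x).re)
    (hcomp : ∀ ε > 0, ∃ (ι : Type) (_ : Fintype ι) (L : ι → D →ₗ[ℂ] ℂ) (C : ℝ),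
      (∀ k x, ‖L k x‖ ≤ C * ‖j x‖) ∧ ∀ x, ‖j x‖ ^ 2 ≤ ε * (a x x).re + ∑ k, ‖L k x‖ ^ 2)
    (one : D) (hone : j one ≠ 0) (haone : ∀ ψ, a one ψ = 0) :
    ∃ (b : HilbertBasis ℕ ℂ H) (lam : ℕ → ℝ), Monotone lam ∧ Tendsto lam atTop atTop ∧ lam 0 = 0 ∧
      ∀ k, ∃ φ : ℕ → D, Tendsto (fun m => j (φ m)) atTop (𝓝 (b k)) ∧
        (∀ ε > 0, ∃ N, ∀ m ≥ N, ∀ l ≥ N, (a (φ m - φ l) (φ m - φ l)).re < ε) ∧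
        ∀ ψ, Tendsto (fun m => a (φ m) ψ) atTop (𝓝 (lam k * ⟪j ψ, b k⟫_ℂ)) := by
  let core : PreInnerProductSpace.Core ℂ D :=
    -- The arguments of `a` are exchanged because the inner product is linear in its second variable
    -- and `a` in its first. Adding the product of `H` shifts the spectrum by 1, so that `ν = λ +
    -- 1`.
    { inner := fun x y => ⟪j x, j y⟫_ℂ + a y x
      conj_inner_symm := fun x y => by rw [map_add, inner_conj_symm, hconj]
      re_inner_nonneg := fun x => add_nonneg (inner_self_nonneg (𝕜 := ℂ)) (hnonneg x)
      add_left := fun x y z => by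
        rw [map_add, inner_add_left, ← hconj (x + y) z, hadd, map_add, hconj, hconj]
        ring
      smul_left := fun x y c => by
        rw [map_smul, inner_smul_left, ← hconj (c • x) y, hsmul, map_mul, hconj]
        ring }
  let : SeminormedAddCommGroup D := InnerProductSpace.Core.toSeminormedAddCommGroup (𝕜 := ℂ)
  let : InnerProductSpace ℂ D := InnerProductSpace.ofCore core
  have hin : ∀ x y : D, ⟪x, y⟫_ℂ = ⟪j x, j y⟫_ℂ + a y x := fun _ _ => rfl
  have hnorm : ∀ x : D, ‖x‖ ^ 2 = ‖j x‖ ^ 2 + (a x x).re := fun x => by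
    rw [← inner_self_eq_norm_sq (𝕜 := ℂ), hin, map_add, inner_self_eq_norm_sq (𝕜 := ℂ)]
    rfl
  have hle : ∀ x : D, ‖j x‖ ≤ 1 * ‖x‖ := fun x => by
    rw [one_mul]
    refine le_of_sq_le_sq ?_ (norm_nonneg _)
    linarith [hnorm x, hnonneg x]
  obtain ⟨b, ν, hm, ht, hφ, hnull, hν1⟩ := exists_hilbertBasis_of_embedding hinf (j.mkContinuous 1 hle) hj
    (fun ε hε => by
      obtain ⟨ι, hι, L, C, hL, hJ⟩ := hcomp ε hε
      refine ⟨ι, hι, L, max C 0, fun k x => ?_, fun x => ?_⟩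
      · calc ‖L k x‖ ≤ C * ‖j x‖ := hL k x
          _ ≤ max C 0 * ‖x‖ := by
            have := hle x
            rw [one_mul] at this
            gcongr
            exact le_max_left _ _
      · refine (hJ x).trans ?_
        have : (a x x).re ≤ ‖x‖ ^ 2 := by rw [hnorm x]; nlinarith [sq_nonneg ‖j x‖]
        gcongr)
  simp only [LinearMap.mkContinuous_apply] at hφ hnull
  replace hν1 := hν1 fun x => by simpa using hle x
  -- The null vector is a weak eigenvector with value 1. If no `νₖ` were 1, all its coefficients
  -- would vanish. With `ν ≥ 1` and monotonicity this gives `ν₀ = 1`.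
  have hone' : ∃ k, ν k = 1 := by
    by_contra hne
    push Not at hne
    refine hone (b.repr.injective ?_)
    ext k
    rw [map_zero, HilbertBasis.repr_apply_apply]
    have h := hnull k one 1 fun ψ => by rw [hin, haone, add_zero, one_mul]
    have h1 : ((ν k : ℂ) - 1) * ⟪b k, j one⟫_ℂ = 0 := by linear_combination -h
    exact (mul_eq_zero.1 h1).resolve_left fun h2 => hne k (by
      have := sub_eq_zero.1 h2
      exact_mod_cast this)
  refine ⟨b, fun k => ν k - 1, fun m k hmk => sub_le_sub_right (hm hmk) 1,
    tendsto_atTop_add_const_right _ _ ht, ?_, fun k => ?_⟩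
  · obtain ⟨k, hk⟩ := hone'
    have := hm (Nat.zero_le k)
    linarith [hν1 0]
  · obtain ⟨φ, h1, h2, h3⟩ := hφ k
    refine ⟨φ, h1, fun ε hε => ?_, fun ψ => ?_⟩
    · obtain ⟨N, hN⟩ := Metric.cauchySeq_iff.1 h2 (Real.sqrt ε) (Real.sqrt_pos.2 hε)
      refine ⟨N, fun m hm l hl => ?_⟩
      have h4 := hN m hm l hl
      rw [dist_eq_norm] at h4
      have h5 : ‖φ m - φ l‖ ^ 2 < ε := by
        have := pow_lt_pow_left₀ h4 (norm_nonneg _) two_ne_zero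
        rwa [Real.sq_sqrt hε.le] at this
      rw [hnorm] at h5
      nlinarith [sq_nonneg ‖j (φ m - φ l)‖]
    · have h4 : Tendsto (fun m => ⟪j ψ, j (φ m)⟫_ℂ) atTop (𝓝 ⟪j ψ, b k⟫_ℂ) :=
        Tendsto.inner tendsto_const_nhds h1
      have h5 := (h3 ψ).sub h4
      simp only [hin, add_sub_cancel_left] at h5
      convert h5 using 2
      push_cast
      ring

end Form

/-! ### The Poincaré inequality on convex sets -/

theorem sq_lintegral_le {X : Type*} [MeasurableSpace X] (ν : Measure X) {φ : X → ℝ≥0∞}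
    (hφ : AEMeasurable φ ν) : (∫⁻ x, φ x ∂ν) ^ 2 ≤ ν univ * ∫⁻ x, φ x ^ 2 ∂ν := by
  have h := ENNReal.lintegral_mul_le_Lp_mul_Lq ν Real.HolderConjugate.two_two hφ
    (aemeasurable_const (b := (1 : ℝ≥0∞)))
  simp only [Pi.mul_apply, mul_one, ENNReal.rpow_two, one_pow, lintegral_one] at h
  calc (∫⁻ x, φ x ∂ν) ^ 2
      ≤ ((∫⁻ x, φ x ^ 2 ∂ν) ^ (1 / 2 : ℝ) * ν univ ^ (1 / 2 : ℝ)) ^ 2 := by gcongr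
    _ = _ := by
      rw [mul_pow, ← ENNReal.rpow_two, ← ENNReal.rpow_two, ← ENNReal.rpow_mul, ← ENNReal.rpow_mul]
      norm_num
      rw [mul_comm]

/-- The fundamental theorem of calculus along the segment from `x` to `y`, followed by
Cauchy-Schwarz in the parameter. The indicator makes the right side a function on the whole space,
ready for changes of variables. -/
theorem enorm_sub_sq_le {E : Type*} [NormedAddCommGroup E] [NormedSpace ℝ E] {K : Set E} {f : E → ℂ}
    {f' : E → E →L[ℝ] ℂ} {d : ℝ} (hconv : Convex ℝ K) (hf : ∀ x ∈ K, HasFDerivAt f (f' x) x)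
    (hf' : ContinuousOn f' K) {x y : E} (hx : x ∈ K) (hy : y ∈ K) (hd : ‖y - x‖ ≤ d) :
    ‖f x - f y‖ₑ ^ 2 ≤ ENNReal.ofReal d ^ 2 *
      ∫⁻ t in Icc (0 : ℝ) 1, K.indicator (fun z => ‖f' z‖ₑ ^ 2) ((1 - t) • x + t • y) := by
  set γ : ℝ → E := fun t => (1 - t) • x + t • y
  have hγ : ∀ t ∈ Icc (0 : ℝ) 1, γ t ∈ K := fun t ht =>
    hconv hx hy (sub_nonneg.2 ht.2) ht.1 (by ring)
  have hγd : ∀ t, HasDerivAt γ (y - x) t := fun t => by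
    have h1 := (((hasDerivAt_id t).const_sub 1).smul_const x).add ((hasDerivAt_id t).smul_const y)
    refine h1.congr_deriv ?_
    simp [sub_eq_neg_add]
  have hc : ContinuousOn (fun t => f' (γ t) (y - x)) (Icc 0 1) :=
    (hf'.comp (by fun_prop) hγ).clm_apply continuousOn_const
  have hFTC : ∫ t in (0 : ℝ)..1, f' (γ t) (y - x) = f y - f x := by
    have := intervalIntegral.integral_eq_sub_of_hasDerivAt (f := fun t => f (γ t)) (a := 0) (b := 1)
      (fun t ht => by
        rw [uIcc_of_le zero_le_one] at ht
        exact (hf _ (hγ t ht)).comp_hasDerivAt t (hγd t))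
      (ContinuousOn.intervalIntegrable (by rwa [uIcc_of_le zero_le_one]))
    simpa [γ] using this
  have hm : AEMeasurable (fun t => ‖f' (γ t) (y - x)‖ₑ) (volume.restrict (Icc (0 : ℝ) 1)) :=
    (hc.aestronglyMeasurable measurableSet_Icc).enorm
  calc ‖f x - f y‖ₑ ^ 2 = ‖∫ t in Icc (0 : ℝ) 1, f' (γ t) (y - x)‖ₑ ^ 2 := by
        rw [← neg_sub, enorm_neg, ← hFTC, intervalIntegral.integral_of_le zero_le_one,
          integral_Icc_eq_integral_Ioc]
    _ ≤ (∫⁻ t in Icc (0 : ℝ) 1, ‖f' (γ t) (y - x)‖ₑ) ^ 2 := by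
        gcongr
        exact enorm_integral_le_lintegral_enorm _
    _ ≤ ∫⁻ t in Icc (0 : ℝ) 1, ‖f' (γ t) (y - x)‖ₑ ^ 2 := by
        refine (sq_lintegral_le _ hm).trans_eq ?_
        simp
    _ ≤ ∫⁻ t in Icc (0 : ℝ) 1, ENNReal.ofReal d ^ 2 * K.indicator (fun z => ‖f' z‖ₑ ^ 2) (γ t) := by
        refine setLIntegral_mono' measurableSet_Icc fun t ht => ?_
        rw [indicator_of_mem (hγ t ht), ← mul_pow, mul_comm]
        gcongr
        refine ((f' (γ t)).le_opENorm _).trans ?_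
        gcongr
        rw [← ofReal_norm]
        exact ENNReal.ofReal_le_ofReal hd
    _ = _ := lintegral_const_mul' _ _ (by simp)

variable {E : Type*} [NormedAddCommGroup E] [NormedSpace ℝ E] [FiniteDimensional ℝ E]
  [MeasurableSpace E] [BorelSpace E] {μ : Measure E} [μ.IsAddHaarMeasure]

theorem lintegral_comp_smul_add {h : E → ℝ≥0∞} (hh : Measurable h) {r : ℝ} (hr : 1 / 2 ≤ r) (v : E) :
    ∫⁻ x, h (r • x + v) ∂μ ≤ 2 ^ Module.finrank ℝ E * ∫⁻ x, h x ∂μ := by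
  have hr0 : 0 < r := by linarith
  have h1 : ∫⁻ x, h (r • x + v) ∂μ = ∫⁻ x, h (x + v) ∂(Measure.map (r • ·) μ) := by
    rw [lintegral_map (f := fun x => h (x + v)) (hh.comp (measurable_add_const v))
      (measurable_const_smul r)]
  rw [h1, Measure.map_addHaar_smul μ hr0.ne', lintegral_smul_measure, lintegral_add_right_eq_self, smul_eq_mul]
  gcongr
  rw [← ENNReal.ofReal_ofNat, ← ENNReal.ofReal_pow (by norm_num)]
  refine ENNReal.ofReal_le_ofReal ?_
  rw [abs_of_nonneg (by positivity), ← inv_pow]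
  have : r⁻¹ ≤ 2 := by
    rw [inv_le_comm₀ hr0 two_pos]
    linarith
  gcongr

/-- One of `t` and `1 - t` is at least `1/2`. Integrating first in the variable carrying that
factor, the dilation costs at most `2^dim`; the other integration contributes `μ K`. -/
theorem lintegral_lintegral_segment_le {h : E → ℝ≥0∞} (hh : Measurable h) (K : Set E) (t : ℝ) :
    ∫⁻ x in K, ∫⁻ y in K, h ((1 - t) • x + t • y) ∂μ ∂μ ≤
      μ K * (2 ^ Module.finrank ℝ E * ∫⁻ x, h x ∂μ) := by
  have key : ∀ r s : ℝ, 1 / 2 ≤ r → ∫⁻ x in K, ∫⁻ y in K, h (r • y + s • x) ∂μ ∂μ ≤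
      μ K * (2 ^ Module.finrank ℝ E * ∫⁻ x, h x ∂μ) := by
    intro r s hr
    calc ∫⁻ x in K, ∫⁻ y in K, h (r • y + s • x) ∂μ ∂μ
        ≤ ∫⁻ _ in K, (2 ^ Module.finrank ℝ E * ∫⁻ x, h x ∂μ) ∂μ :=
          lintegral_mono fun x => (setLIntegral_le_lintegral _ _).trans
            (lintegral_comp_smul_add hh hr _)
      _ = _ := by rw [setLIntegral_const, mul_comm]
  rcases le_total (1 / 2) t with ht | ht
  · simp only [add_comm _ (t • _)]
    exact key t (1 - t) ht
  · rw [lintegral_lintegral_swap]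
    · exact key (1 - t) t (by linarith)
    · exact (hh.comp (by fun_prop : Measurable fun z : E × E => (1 - t) • z.1 + t • z.2)).aemeasurable

variable {K : Set E} {f : E → ℂ} {f' : E → E →L[ℝ] ℂ} {d : ℝ}

/-- The Poincaré inequality on a convex set of diameter at most `d`. -/
theorem lintegral_sq_le_of_convex (hconv : Convex ℝ K) (hK : MeasurableSet K) (hKfin : μ K ≠ ⊤)
    (hd : ∀ x ∈ K, ∀ y ∈ K, ‖y - x‖ ≤ d)
    (hf : ∀ x ∈ K, HasFDerivAt f (f' x) x) (hf' : ContinuousOn f' K) (hfi : IntegrableOn f K μ) :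
    ∫⁻ x in K, ‖f x‖ₑ ^ 2 ∂μ ≤
      2 * (ENNReal.ofReal d ^ 2 * 2 ^ Module.finrank ℝ E * ∫⁻ x in K, ‖f' x‖ₑ ^ 2 ∂μ) +
        2 * ((μ K)⁻¹ * ‖∫ x in K, f x ∂μ‖ₑ ^ 2) := by
  by_cases hK0 : μ K = 0
  · rw [setLIntegral_measure_zero _ _ hK0]
    exact zero_le
  set h : E → ℝ≥0∞ := K.indicator fun z => ‖f' z‖ₑ ^ 2
  have hh : Measurable h := by
    have h1 : Measurable (K.indicator fun z => ‖f' z‖) := by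
      classical
      rw [← piecewise_eq_indicator]
      exact hf'.norm.measurable_piecewise continuousOn_const hK
    have h2 : h = fun z => ENNReal.ofReal (K.indicator (fun z => ‖f' z‖) z) ^ 2 := by
      ext z
      by_cases hz : z ∈ K
      · simp [h, hz]
      · simp [h, hz]
    rw [h2]
    exact h1.ennreal_ofReal.pow_const 2
  have hhK : ∫⁻ x, h x ∂μ = ∫⁻ x in K, ‖f' x‖ₑ ^ 2 ∂μ := lintegral_indicator hK _
  have hKr : (μ.real K : ℂ) ≠ 0 := by
    rw [Complex.ofReal_ne_zero, Measure.real]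
    exact (ENNReal.toReal_pos hK0 hKfin).ne'
  -- The mean of `f`. Then `f(x) - c` is the average of `f(x) - f(y)` over `y`, which the segment
  -- estimate controls after a double integration.
  set c : ℂ := (μ.real K : ℂ)⁻¹ * ∫ x in K, f x ∂μ
  have hce : ‖c‖ₑ = (μ K)⁻¹ * ‖∫ x in K, f x ∂μ‖ₑ := by
    rw [enorm_mul, enorm_inv hKr]
    congr 2
    rw [← ofReal_norm, Complex.norm_real, Real.norm_of_nonneg measureReal_nonneg,
      Measure.real, ENNReal.ofReal_toReal hKfin]
  have h1 : ∀ x ∈ K, ‖f x - c‖ₑ ^ 2 ≤ (μ K)⁻¹ * ∫⁻ y in K, ‖f x - f y‖ₑ ^ 2 ∂μ := by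
    intro x _
    have e1 : f x - c = (μ.real K : ℂ)⁻¹ * ∫ y in K, (f x - f y) ∂μ := by
      rw [integral_sub (integrableOn_const (C := f x) hKfin) hfi, setIntegral_const, Complex.real_smul]
      field_simp
      simp only [c]
      field_simp
    have e2 : ‖(μ.real K : ℂ)⁻¹‖ₑ = (μ K)⁻¹ := by
      rw [enorm_inv hKr]
      congr 1
      rw [← ofReal_norm, Complex.norm_real, Real.norm_of_nonneg measureReal_nonneg,
        Measure.real, ENNReal.ofReal_toReal hKfin]
    have hm : AEMeasurable (fun y => ‖f x - f y‖ₑ) (μ.restrict K) :=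
      (aestronglyMeasurable_const.sub hfi.aestronglyMeasurable).enorm
    calc ‖f x - c‖ₑ ^ 2 = (μ K)⁻¹ ^ 2 * ‖∫ y in K, (f x - f y) ∂μ‖ₑ ^ 2 := by
          rw [e1, enorm_mul, e2, mul_pow]
      _ ≤ (μ K)⁻¹ ^ 2 * (μ K * ∫⁻ y in K, ‖f x - f y‖ₑ ^ 2 ∂μ) := by
          gcongr
          refine (pow_le_pow_left₀ zero_le (enorm_integral_le_lintegral_enorm _) 2).trans ?_
          refine (sq_lintegral_le _ hm).trans_eq ?_
          rw [Measure.restrict_apply_univ]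
      _ = _ := by
          rw [sq, ← mul_assoc, mul_assoc (μ K)⁻¹, ENNReal.inv_mul_cancel hK0 hKfin, mul_one]
  have h2 : ∫⁻ x in K, ‖f x - c‖ₑ ^ 2 ∂μ ≤
      ENNReal.ofReal d ^ 2 * 2 ^ Module.finrank ℝ E * ∫⁻ x in K, ‖f' x‖ₑ ^ 2 ∂μ := by
    calc ∫⁻ x in K, ‖f x - c‖ₑ ^ 2 ∂μ
        ≤ ∫⁻ x in K, (μ K)⁻¹ * ∫⁻ y in K, (ENNReal.ofReal d ^ 2 *
            ∫⁻ t in Icc (0 : ℝ) 1, h ((1 - t) • x + t • y)) ∂μ ∂μ := by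
          refine setLIntegral_mono' hK fun x hx => (h1 x hx).trans (mul_le_mul' le_rfl ?_)
          exact setLIntegral_mono' hK fun y hy => enorm_sub_sq_le hconv hf hf' hx hy (hd x hx y hy)
      _ = (μ K)⁻¹ * (ENNReal.ofReal d ^ 2 *
            ∫⁻ x in K, ∫⁻ y in K, (∫⁻ t in Icc (0 : ℝ) 1, h ((1 - t) • x + t • y)) ∂μ ∂μ) := by
          simp only [lintegral_const_mul' _ _ (show ENNReal.ofReal d ^ 2 ≠ ⊤ by simp),
            lintegral_const_mul' _ _ (ENNReal.inv_ne_top.2 hK0)]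
      _ = (μ K)⁻¹ * (ENNReal.ofReal d ^ 2 *
            ∫⁻ t in Icc (0 : ℝ) 1, ∫⁻ x in K, ∫⁻ y in K, h ((1 - t) • x + t • y) ∂μ ∂μ) := by
          congr 2
          have hm3 : Measurable fun p : (E × E) × ℝ => h ((1 - p.2) • p.1.1 + p.2 • p.1.2) :=
            hh.comp (by fun_prop)
          have e1 : ∫⁻ x in K, ∫⁻ y in K, (∫⁻ t in Icc (0 : ℝ) 1, h ((1 - t) • x + t • y)) ∂μ ∂μ =
              ∫⁻ z, (∫⁻ t in Icc (0 : ℝ) 1, h ((1 - t) • z.1 + t • z.2))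
                ∂((μ.restrict K).prod (μ.restrict K)) :=
            (lintegral_prod _ hm3.lintegral_prod_right'.aemeasurable).symm
          rw [e1, lintegral_lintegral_swap hm3.aemeasurable]
          refine lintegral_congr fun t => ?_
          exact lintegral_prod _ (hm3.comp (by fun_prop : Measurable fun z : E × E => (z, t))).aemeasurable
      _ ≤ (μ K)⁻¹ * (ENNReal.ofReal d ^ 2 *
            ∫⁻ _ in Icc (0 : ℝ) 1, μ K * (2 ^ Module.finrank ℝ E * ∫⁻ x, h x ∂μ)) := by
          gcongr with t
          exact lintegral_lintegral_segment_le hh K t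
      _ = ((μ K)⁻¹ * μ K) * (ENNReal.ofReal d ^ 2 * 2 ^ Module.finrank ℝ E * ∫⁻ x, h x ∂μ) := by
          rw [setLIntegral_const, Real.volume_Icc]
          simp only [sub_zero, ENNReal.ofReal_one, mul_one]
          ring
      _ = _ := by rw [ENNReal.inv_mul_cancel hK0 hKfin, one_mul, hhK]
  have h3 : ∀ x, ‖f x‖ₑ ^ 2 ≤ 2 * ‖f x - c‖ₑ ^ 2 + 2 * ‖c‖ₑ ^ 2 := by
    intro x
    have e1 : ‖f x‖ ^ 2 ≤ 2 * ‖f x - c‖ ^ 2 + 2 * ‖c‖ ^ 2 := by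
      have := norm_add_le (f x - c) c
      rw [sub_add_cancel] at this
      nlinarith [norm_nonneg (f x), sq_nonneg (‖f x - c‖ - ‖c‖)]
    simp only [← ofReal_norm]
    have := ENNReal.ofReal_le_ofReal e1
    rwa [ENNReal.ofReal_add (by positivity) (by positivity), ENNReal.ofReal_mul two_pos.le,
      ENNReal.ofReal_mul two_pos.le, ENNReal.ofReal_pow (norm_nonneg _),
      ENNReal.ofReal_pow (norm_nonneg _), ENNReal.ofReal_pow (norm_nonneg _), ENNReal.ofReal_ofNat] at this
  calc ∫⁻ x in K, ‖f x‖ₑ ^ 2 ∂μ ≤ ∫⁻ x in K, (2 * ‖f x - c‖ₑ ^ 2 + 2 * ‖c‖ₑ ^ 2) ∂μ :=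
        lintegral_mono fun x => h3 x
    _ = 2 * ∫⁻ x in K, ‖f x - c‖ₑ ^ 2 ∂μ + 2 * ‖c‖ₑ ^ 2 * μ K := by
        rw [lintegral_add_right _ measurable_const, lintegral_const_mul' _ _ (by simp),
          setLIntegral_const]
    _ ≤ _ := by
        refine add_le_add (mul_le_mul' le_rfl h2) (le_of_eq ?_)
        rw [hce, mul_pow, sq (μ K)⁻¹]
        calc _ = 2 * ((μ K)⁻¹ * ‖∫ x in K, f x ∂μ‖ₑ ^ 2) * ((μ K)⁻¹ * μ K) := by ring
          _ = _ := by rw [ENNReal.inv_mul_cancel hK0 hKfin, mul_one]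

/-! ### The metric in charts -/

theorem eq_sum_single {n : ℕ} (v : EuclideanSpace ℝ (Fin n)) :
    v = ∑ k, v k • (EuclideanSpace.single k (1 : ℝ) : EuclideanSpace ℝ (Fin n)) := by
  ext k
  simp [Finset.sum_apply, Pi.single_apply]

section Charts

variable {n : ℕ} {M : Type*} [TopologicalSpace M]
  [ChartedSpace (EuclideanSpace ℝ (Fin n)) M] [IsManifold (𝓡 n) ∞ M]

/-- The metric at `x` as a bilinear form on the model space. -/
def metricForm (g : Metric n M) (x : M) :
    EuclideanSpace ℝ (Fin n) →L[ℝ] EuclideanSpace ℝ (Fin n) →L[ℝ] ℝ := g.inner x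

/-- The derivative of the inverse of the preferred chart at `x₀`, on the model space. -/
def chartDeriv (x₀ : M) (y : EuclideanSpace ℝ (Fin n)) :
    EuclideanSpace ℝ (Fin n) →L[ℝ] EuclideanSpace ℝ (Fin n) :=
  mfderiv (𝓡 n) (𝓡 n) (chartAt (EuclideanSpace ℝ (Fin n)) x₀).symm y

variable (g : Metric n M)

theorem chartGram_apply (x₀ : M) (y : EuclideanSpace ℝ (Fin n)) (i j : Fin n) :
    chartGram g x₀ y i j = metricForm g ((chartAt (EuclideanSpace ℝ (Fin n)) x₀).symm y)
      (chartDeriv x₀ y (EuclideanSpace.single i 1)) (chartDeriv x₀ y (EuclideanSpace.single j 1)) :=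
  rfl

theorem metricForm_symm (x : M) (v w : EuclideanSpace ℝ (Fin n)) :
    metricForm g x v w = metricForm g x w v := g.symm x v w

theorem metricForm_pos (x : M) {v : EuclideanSpace ℝ (Fin n)} (hv : v ≠ 0) :
    0 < metricForm g x v v := g.pos x v hv

theorem contMDiffOn_chartDeriv (x₀ : M) (v : EuclideanSpace ℝ (Fin n)) :
    ContMDiffOn (𝓡 n) ((𝓡 n).prod 𝓘(ℝ, EuclideanSpace ℝ (Fin n))) ∞
      (fun y => (⟨(chartAt (EuclideanSpace ℝ (Fin n)) x₀).symm y, chartDeriv x₀ y v⟩ :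
        TangentBundle (𝓡 n) M)) (chartAt (EuclideanSpace ℝ (Fin n)) x₀).target := by
  set c := chartAt (EuclideanSpace ℝ (Fin n)) x₀
  have h1 : ContMDiffOn (𝓡 n) (𝓡 n) ∞ c.symm c.target := contMDiffOn_chart_symm
  have h2 := h1.contMDiffOn_tangentMapWithin (m := ∞) (by simp) c.open_target.uniqueMDiffOn
  have h3 : ContMDiff (𝓡 n) (𝓡 n).tangent ∞
      (fun y : EuclideanSpace ℝ (Fin n) => (⟨y, v⟩ : TangentBundle (𝓡 n) (EuclideanSpace ℝ (Fin n)))) := by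
    intro y
    exact contMDiffAt_vectorSpace_iff_contDiffAt.2 contDiffAt_const
  have h4 := h2.comp (h3.contMDiffOn (s := c.target)) (fun y hy => hy)
  refine h4.congr fun y hy => ?_
  simp only [Function.comp, tangentMapWithin, chartDeriv]
  rw [mfderivWithin_of_isOpen c.open_target hy]
  rfl

/-- `metricForm` and `chartDeriv` taken separately need not be continuous: they refer to the
preferred chart at a varying point, which may jump. Their combination is, as the metric and the
coordinate fields are smooth in their bundles. -/
theorem continuousOn_metricForm_chartDeriv (x₀ : M) (v w : EuclideanSpace ℝ (Fin n)) :
    ContinuousOn (fun y => metricForm g ((chartAt (EuclideanSpace ℝ (Fin n)) x₀).symm y)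
      (chartDeriv x₀ y v) (chartDeriv x₀ y w)) (chartAt (EuclideanSpace ℝ (Fin n)) x₀).target := by
  set c := chartAt (EuclideanSpace ℝ (Fin n)) x₀
  intro y hy
  have hv := contMDiffOn_chartDeriv x₀ v y hy
  have hw := contMDiffOn_chartDeriv x₀ w y hy
  have hb : ContMDiffWithinAt (𝓡 n) (𝓡 n) ∞ c.symm c.target y := contMDiffOn_chart_symm y hy
  have : ContMDiffWithinAt (𝓡 n) ((𝓡 n).prod 𝓘(ℝ)) ∞
      (fun m => Bundle.TotalSpace.mk' ℝ (E := Bundle.Trivial M ℝ) (c.symm m)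
        (g.inner (c.symm m) (chartDeriv x₀ m v) (chartDeriv x₀ m w))) c.target y := by
    apply ContMDiffWithinAt.clm_bundle_apply₂ (F₁ := EuclideanSpace ℝ (Fin n))
      (F₂ := EuclideanSpace ℝ (Fin n))
    · exact ContMDiffAt.comp_contMDiffWithinAt y g.contMDiff.contMDiffAt hb
    · exact hv
    · exact hw
  simp only [Bundle.contMDiffWithinAt_totalSpace] at this
  exact this.2.continuousWithinAt

theorem continuousOn_chartGram (x₀ : M) :
    ContinuousOn (chartGram g x₀) (chartAt (EuclideanSpace ℝ (Fin n)) x₀).target :=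
  continuousOn_pi.2 fun _ => continuousOn_pi.2 fun _ => continuousOn_metricForm_chartDeriv g x₀ _ _

theorem continuousOn_det_chartGram (x₀ : M) :
    ContinuousOn (fun y => (chartGram g x₀ y).det) (chartAt (EuclideanSpace ℝ (Fin n)) x₀).target :=
  (continuous_id.matrix_det).comp_continuousOn (continuousOn_chartGram g x₀)

theorem chartDeriv_injective (x₀ : M) {y : EuclideanSpace ℝ (Fin n)}
    (hy : y ∈ (chartAt (EuclideanSpace ℝ (Fin n)) x₀).target) :
    Function.Injective (chartDeriv x₀ y) := by
  have h := (mdifferentiable_chart (I := 𝓡 n) x₀).comp_symm_deriv hy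
  refine Function.LeftInverse.injective (g := mfderiv (𝓡 n) (𝓡 n) (chartAt (EuclideanSpace ℝ (Fin n)) x₀)
    ((chartAt (EuclideanSpace ℝ (Fin n)) x₀).symm y)) fun v => ?_
  exact congrArg (fun L => L v) h

theorem bilin_sum (B : EuclideanSpace ℝ (Fin n) →L[ℝ] EuclideanSpace ℝ (Fin n) →L[ℝ] ℝ)
    (v w : Fin n → ℝ) :
    B (WithLp.toLp 2 v) (WithLp.toLp 2 w) =
      ∑ i, ∑ j, v i * w j * B (EuclideanSpace.single i 1) (EuclideanSpace.single j 1) := by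
  rw [eq_sum_single (WithLp.toLp 2 v), eq_sum_single (WithLp.toLp 2 w)]
  simp only [map_sum, map_smul, FunLike.coe_sum, Finset.sum_apply, FunLike.coe_smul, Pi.smul_apply,
    smul_eq_mul, Finset.mul_sum]
  rw [Finset.sum_comm]
  exact Finset.sum_congr rfl fun i _ => Finset.sum_congr rfl fun j _ => by ring

theorem chartGram_posDef (x₀ : M) {y : EuclideanSpace ℝ (Fin n)}
    (hy : y ∈ (chartAt (EuclideanSpace ℝ (Fin n)) x₀).target) : (chartGram g x₀ y).PosDef := by
  refine Matrix.posDef_iff_dotProduct_mulVec.2 ⟨?_, fun v hv => ?_⟩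
  · ext i j
    simp only [Matrix.conjTranspose_apply, star_trivial, chartGram_apply]
    exact metricForm_symm g _ _ _
  · have hv' : (WithLp.toLp 2 v : EuclideanSpace ℝ (Fin n)) ≠ 0 := by simpa using hv
    have h := metricForm_pos g ((chartAt (EuclideanSpace ℝ (Fin n)) x₀).symm y)
      (v := chartDeriv x₀ y (WithLp.toLp 2 v))
      (by rw [← map_zero (chartDeriv x₀ y)]; exact (chartDeriv_injective x₀ hy).ne hv')
    have h2 := bilin_sum (((metricForm g ((chartAt (EuclideanSpace ℝ (Fin n)) x₀).symm y)).bilinearComp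
      (chartDeriv x₀ y) (chartDeriv x₀ y))) v v
    rw [ContinuousLinearMap.bilinearComp_apply] at h2
    rw [h2] at h
    refine h.trans_eq ?_
    simp only [dotProduct, Matrix.mulVec, star_trivial, Finset.mul_sum]
    exact Finset.sum_congr rfl fun i _ => Finset.sum_congr rfl fun j _ => by
      rw [chartGram_apply, ContinuousLinearMap.bilinearComp_apply]; ring

theorem det_chartGram_pos (x₀ : M) {y : EuclideanSpace ℝ (Fin n)}
    (hy : y ∈ (chartAt (EuclideanSpace ℝ (Fin n)) x₀).target) : 0 < (chartGram g x₀ y).det :=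
  (chartGram_posDef g x₀ hy).det_pos

/-- The Gram matrix of a bilinear form pulled back along a linear map. -/
theorem gram_comp (B : EuclideanSpace ℝ (Fin n) →L[ℝ] EuclideanSpace ℝ (Fin n) →L[ℝ] ℝ)
    (T : EuclideanSpace ℝ (Fin n) →L[ℝ] EuclideanSpace ℝ (Fin n)) :
    (Matrix.of fun i j => B (T (EuclideanSpace.single i 1)) (T (EuclideanSpace.single j 1)) :
      Matrix (Fin n) (Fin n) ℝ) =
    (Matrix.of fun k i => T (EuclideanSpace.single i 1) k).transpose *
      (Matrix.of fun k l => B (EuclideanSpace.single k 1) (EuclideanSpace.single l 1)) *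
      (Matrix.of fun k i => T (EuclideanSpace.single i 1) k) := by
  ext i j
  have h := bilin_sum B (fun k => T (EuclideanSpace.single i 1) k)
    (fun k => T (EuclideanSpace.single j 1) k)
  simp only [Matrix.of_apply, Matrix.mul_apply, Matrix.transpose_apply, Finset.sum_mul]
  refine Eq.trans h ?_
  rw [Finset.sum_comm]
  refine (Finset.sum_congr rfl fun k _ => Finset.sum_congr rfl fun l _ => by ring)

theorem det_coordMatrix (T : EuclideanSpace ℝ (Fin n) →L[ℝ] EuclideanSpace ℝ (Fin n)) :
    (Matrix.of fun k i => T (EuclideanSpace.single i 1) k : Matrix (Fin n) (Fin n) ℝ).det =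
      T.det := by
  rw [ContinuousLinearMap.det, ← LinearMap.det_toMatrix (EuclideanSpace.basisFun (Fin n) ℝ).toBasis]
  congr 1

theorem det_gram_comp (B : EuclideanSpace ℝ (Fin n) →L[ℝ] EuclideanSpace ℝ (Fin n) →L[ℝ] ℝ)
    (T : EuclideanSpace ℝ (Fin n) →L[ℝ] EuclideanSpace ℝ (Fin n)) :
    (Matrix.of fun i j => B (T (EuclideanSpace.single i 1)) (T (EuclideanSpace.single j 1)) :
      Matrix (Fin n) (Fin n) ℝ).det = T.det ^ 2 *
      (Matrix.of fun k l => B (EuclideanSpace.single k 1) (EuclideanSpace.single l 1) :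
        Matrix (Fin n) (Fin n) ℝ).det := by
  rw [gram_comp, Matrix.det_mul, Matrix.det_mul, Matrix.det_transpose, det_coordMatrix]
  ring

/-- The chart change `chart at x₁ ∘ (chart at x₀)⁻¹`. -/
theorem hasFDerivAt_chart_trans (x₀ x₁ : M) {y : EuclideanSpace ℝ (Fin n)}
    (hy : y ∈ (chartAt (EuclideanSpace ℝ (Fin n)) x₀).target)
    (hy' : (chartAt (EuclideanSpace ℝ (Fin n)) x₀).symm y ∈
      (chartAt (EuclideanSpace ℝ (Fin n)) x₁).source) :
    ∃ T : EuclideanSpace ℝ (Fin n) →L[ℝ] EuclideanSpace ℝ (Fin n),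
      HasFDerivAt (fun z => chartAt (EuclideanSpace ℝ (Fin n)) x₁
        ((chartAt (EuclideanSpace ℝ (Fin n)) x₀).symm z)) T y ∧
      chartDeriv x₀ y = (chartDeriv x₁ (chartAt (EuclideanSpace ℝ (Fin n)) x₁
        ((chartAt (EuclideanSpace ℝ (Fin n)) x₀).symm y))).comp T := by
  set c₀ := chartAt (EuclideanSpace ℝ (Fin n)) x₀ with hc₀
  set c₁ := chartAt (EuclideanSpace ℝ (Fin n)) x₁ with hc₁
  have h0 : MDifferentiableAt (𝓡 n) (𝓡 n) c₀.symm y := mdifferentiableAt_atlas_symm (chart_mem_atlas _ x₀) hy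
  have h1 : MDifferentiableAt (𝓡 n) (𝓡 n) c₁ (c₀.symm y) :=
    mdifferentiableAt_atlas (chart_mem_atlas _ x₁) hy'
  have h2 : MDifferentiableAt (𝓡 n) (𝓡 n) c₁.symm (c₁ (c₀.symm y)) :=
    mdifferentiableAt_atlas_symm (chart_mem_atlas _ x₁) (c₁.map_source hy')
  have h01 : MDifferentiableAt (𝓡 n) (𝓡 n) (fun z => c₁ (c₀.symm z)) y := h1.comp y h0
  refine ⟨mfderiv (𝓡 n) (𝓡 n) (fun z => c₁ (c₀.symm z)) y, ?_, ?_⟩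
  · exact h01.hasMFDerivAt.hasFDerivAt
  · have h3 := mfderiv_comp y (g := c₁.symm) (f := fun z => c₁ (c₀.symm z)) h2 h01
    have h4 : c₁.symm ∘ (fun z => c₁ (c₀.symm z)) =ᶠ[𝓝 y] c₀.symm := by
      have := (c₀.symm.continuousAt hy).preimage_mem_nhds (c₁.open_source.mem_nhds hy')
      filter_upwards [this] with z hz
      exact c₁.left_inv hz
    rw [h4.mfderiv_eq] at h3
    exact h3

/-- Gram matrices transform by `Tᵀ G T`, so the density picks up exactly the Jacobian of the chart
change. -/
theorem det_chartGram_chart_trans (x₀ x₁ : M) {y : EuclideanSpace ℝ (Fin n)}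
    (hy' : (chartAt (EuclideanSpace ℝ (Fin n)) x₀).symm y ∈
      (chartAt (EuclideanSpace ℝ (Fin n)) x₁).source)
    {T : EuclideanSpace ℝ (Fin n) →L[ℝ] EuclideanSpace ℝ (Fin n)}
    (hT : chartDeriv x₀ y = (chartDeriv x₁ (chartAt (EuclideanSpace ℝ (Fin n)) x₁
        ((chartAt (EuclideanSpace ℝ (Fin n)) x₀).symm y))).comp T) :
    Real.sqrt (chartGram g x₀ y).det = |T.det| * Real.sqrt (chartGram g x₁
      (chartAt (EuclideanSpace ℝ (Fin n)) x₁
        ((chartAt (EuclideanSpace ℝ (Fin n)) x₀).symm y))).det := by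
  set c₀ := chartAt (EuclideanSpace ℝ (Fin n)) x₀ with hc₀
  set c₁ := chartAt (EuclideanSpace ℝ (Fin n)) x₁ with hc₁
  have h : (chartGram g x₀ y).det = T.det ^ 2 * (chartGram g x₁ (c₁ (c₀.symm y))).det := by
    have h1 := det_gram_comp ((metricForm g (c₀.symm y)).bilinearComp
      (chartDeriv x₁ (c₁ (c₀.symm y))) (chartDeriv x₁ (c₁ (c₀.symm y)))) T
    have h2 : chartGram g x₀ y = Matrix.of fun i j => ((metricForm g (c₀.symm y)).bilinearComp
      (chartDeriv x₁ (c₁ (c₀.symm y))) (chartDeriv x₁ (c₁ (c₀.symm y))))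
        (T (EuclideanSpace.single i 1)) (T (EuclideanSpace.single j 1)) := by
      ext i j
      rw [chartGram_apply, hT]
      rfl
    have h3 : chartGram g x₁ (c₁ (c₀.symm y)) = Matrix.of fun i j => ((metricForm g (c₀.symm y)).bilinearComp
      (chartDeriv x₁ (c₁ (c₀.symm y))) (chartDeriv x₁ (c₁ (c₀.symm y))))
        (EuclideanSpace.single i 1) (EuclideanSpace.single j 1) := by
      ext i j
      rw [chartGram_apply, ← hc₁, c₁.left_inv hy']
      rfl
    rw [h2, h3, h1]
  rw [h, Real.sqrt_mul (sq_nonneg _), Real.sqrt_sq_eq_abs]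

end Charts

/-! ### The Riemannian volume in charts -/

section Volume

theorem measurableSet_target_inter {X Y : Type*} [TopologicalSpace X] [TopologicalSpace Y]
    [MeasurableSpace X] [BorelSpace X] [MeasurableSpace Y] [OpensMeasurableSpace Y]
    (c : OpenPartialHomeomorph X Y) {s : Set X} (hs : MeasurableSet s) :
    MeasurableSet (c.target ∩ c.symm ⁻¹' s) := by
  have h1 : Measurable (c.target.domRestrict c.symm) :=
    (continuousOn_iff_continuous_domRestrict.1 c.continuousOn_symm).measurable
  have h2 := c.open_target.measurableSet.subtype_image (h1 hs)
  convert h2 using 1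
  ext y
  simp [Set.domRestrict_apply, and_comm]

variable {n : ℕ} {M : Type*} [TopologicalSpace M]
  [ChartedSpace (EuclideanSpace ℝ (Fin n)) M]

theorem aemeasurable_chart_symm [MeasurableSpace M] [BorelSpace M] (x₀ : M) :
    AEMeasurable (chartAt (EuclideanSpace ℝ (Fin n)) x₀).symm
      (volume.restrict (chartAt (EuclideanSpace ℝ (Fin n)) x₀).target) :=
  (chartAt (EuclideanSpace ℝ (Fin n)) x₀).continuousOn_symm.aemeasurable
    (chartAt (EuclideanSpace ℝ (Fin n)) x₀).open_target.measurableSet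

variable [IsManifold (𝓡 n) ∞ M] (g : Metric n M)

/-- The density `√(det g_{ij})` of the volume in a chart. -/
def chartDensity (x₀ : M) (y : EuclideanSpace ℝ (Fin n)) : ℝ≥0∞ :=
  ENNReal.ofReal (Real.sqrt (chartGram g x₀ y).det)

theorem aemeasurable_chartDensity (x₀ : M) :
    AEMeasurable (chartDensity g x₀)
      (volume.restrict (chartAt (EuclideanSpace ℝ (Fin n)) x₀).target) :=
  ((continuousOn_det_chartGram g x₀).sqrt.aemeasurable
    (chartAt (EuclideanSpace ℝ (Fin n)) x₀).open_target.measurableSet).ennreal_ofReal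

variable [MeasurableSpace M] [BorelSpace M]

theorem chartVolume_apply (x₀ : M) {s : Set M} (hs : MeasurableSet s) :
    chartVolume g x₀ s = ∫⁻ y in (chartAt (EuclideanSpace ℝ (Fin n)) x₀).target ∩
      (chartAt (EuclideanSpace ℝ (Fin n)) x₀).symm ⁻¹' s, chartDensity g x₀ y := by
  rw [chartVolume, Measure.map_apply_of_aemeasurable
    ((aemeasurable_chart_symm x₀).mono_ac (withDensity_absolutelyContinuous _ _)) hs,
    withDensity_apply', Measure.restrict_restrict'
      (chartAt (EuclideanSpace ℝ (Fin n)) x₀).open_target.measurableSet, inter_comm]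
  rfl

theorem chartVolume_eq (x₀ x₁ : M) {s : Set M} (hs : MeasurableSet s)
    (h₀ : s ⊆ (chartAt (EuclideanSpace ℝ (Fin n)) x₀).source)
    (h₁ : s ⊆ (chartAt (EuclideanSpace ℝ (Fin n)) x₁).source) :
    chartVolume g x₀ s = chartVolume g x₁ s := by
  rw [chartVolume_apply g x₀ hs, chartVolume_apply g x₁ hs]
  have hA := measurableSet_target_inter (chartAt (EuclideanSpace ℝ (Fin n)) x₀) hs
  have hT := fun y (hy : y ∈ (chartAt (EuclideanSpace ℝ (Fin n)) x₀).target ∩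
      (chartAt (EuclideanSpace ℝ (Fin n)) x₀).symm ⁻¹' s) =>
    hasFDerivAt_chart_trans x₀ x₁ hy.1 (h₁ hy.2)
  have hdet := fun y (hy : y ∈ (chartAt (EuclideanSpace ℝ (Fin n)) x₀).target ∩
      (chartAt (EuclideanSpace ℝ (Fin n)) x₀).symm ⁻¹' s) T =>
    det_chartGram_chart_trans g x₀ x₁ (y := y) (h₁ hy.2) (T := T)
  set c₀ := chartAt (EuclideanSpace ℝ (Fin n)) x₀ with hc₀
  set c₁ := chartAt (EuclideanSpace ℝ (Fin n)) x₁ with hc₁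
  choose! T hT1 hT2 using hT
  have him : (fun z => c₁ (c₀.symm z)) '' (c₀.target ∩ c₀.symm ⁻¹' s) = c₁.target ∩ c₁.symm ⁻¹' s := by
    ext z
    constructor
    · rintro ⟨y, ⟨-, hy⟩, rfl⟩
      refine ⟨c₁.map_source (h₁ hy), ?_⟩
      simpa only [mem_preimage, c₁.left_inv (h₁ hy)] using hy
    · rintro ⟨hz, hzs⟩
      refine ⟨c₀ (c₁.symm z), ⟨c₀.map_source (h₀ hzs), ?_⟩, ?_⟩
      · simpa only [mem_preimage, c₀.left_inv (h₀ hzs)] using hzs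
      · simp only [c₀.left_inv (h₀ hzs), c₁.right_inv hz]
  have hinj : InjOn (fun z => c₁ (c₀.symm z)) (c₀.target ∩ c₀.symm ⁻¹' s) := by
    intro y hy z hz hyz
    exact c₀.symm.injOn hy.1 hz.1 (c₁.injOn (h₁ hy.2) (h₁ hz.2) hyz)
  rw [← him, lintegral_image_eq_lintegral_abs_det_fderiv_mul volume hA
    (fun y hy => (hT1 y hy).hasFDerivWithinAt) hinj]
  refine setLIntegral_congr_fun hA fun y hy => ?_
  simp only [chartDensity]
  rw [hdet y hy (T y) (hT2 y hy), ENNReal.ofReal_mul (abs_nonneg _)]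

/-- A supremum of measures is not computed set by set, but it lies below every common upper bound.
Here the bound is the volume of the chart at `x₀` plus infinite mass on each point outside that
chart; it dominates all chart volumes since these agree on overlaps. -/
theorem riemVolume_apply (x₀ : M) {s : Set M} (hs : MeasurableSet s)
    (h₀ : s ⊆ (chartAt (EuclideanSpace ℝ (Fin n)) x₀).source) :
    riemVolume g s = chartVolume g x₀ s := by
  refine le_antisymm ?_ (le_iSup (chartVolume g) x₀ s)
  have hS : MeasurableSet (chartAt (EuclideanSpace ℝ (Fin n)) x₀).source :=
    (chartAt (EuclideanSpace ℝ (Fin n)) x₀).open_source.measurableSet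
  have hle : riemVolume g ≤ chartVolume g x₀ + ((⊤ : ℝ≥0∞) • Measure.count).restrict
      (chartAt (EuclideanSpace ℝ (Fin n)) x₀).sourceᶜ := by
    refine iSup_le fun x₁ => Measure.le_iff.2 fun t ht => ?_
    have hS₁ : MeasurableSet (chartAt (EuclideanSpace ℝ (Fin n)) x₁).source :=
      (chartAt (EuclideanSpace ℝ (Fin n)) x₁).open_source.measurableSet
    have h1 : chartVolume g x₁ (chartAt (EuclideanSpace ℝ (Fin n)) x₁).sourceᶜ = 0 := by
      rw [chartVolume_apply g x₁ hS₁.compl]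
      convert setLIntegral_empty _
      ext y
      simp only [mem_inter_iff, mem_preimage, mem_compl_iff, mem_empty_iff_false, iff_false, not_and,
        not_not]
      exact fun hy => (chartAt (EuclideanSpace ℝ (Fin n)) x₁).map_target hy
    have h2 : chartVolume g x₁ (t ∩ (chartAt (EuclideanSpace ℝ (Fin n)) x₀).source) ≤
        chartVolume g x₀ t := by
      calc _ = chartVolume g x₁ (t ∩ (chartAt (EuclideanSpace ℝ (Fin n)) x₀).source ∩
            (chartAt (EuclideanSpace ℝ (Fin n)) x₁).source) := by
            rw [measure_inter_conull h1]
        _ = chartVolume g x₀ (t ∩ (chartAt (EuclideanSpace ℝ (Fin n)) x₀).source ∩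
            (chartAt (EuclideanSpace ℝ (Fin n)) x₁).source) :=
            chartVolume_eq g x₁ x₀ ((ht.inter hS).inter hS₁) inter_subset_right
              (inter_subset_left.trans inter_subset_right)
        _ ≤ _ := measure_mono (inter_subset_left.trans inter_subset_left)
    rw [Measure.add_apply, Measure.restrict_apply ht, ← measure_inter_add_sdiff t hS]
    refine add_le_add h2 ?_
    rw [← sdiff_eq]
    rcases (t \ (chartAt (EuclideanSpace ℝ (Fin n)) x₀).source).eq_empty_or_nonempty with h | h
    · simp [h]
    · have : Measure.count (t \ (chartAt (EuclideanSpace ℝ (Fin n)) x₀).source) ≠ 0 := by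
        simpa only [Measure.count_ne_zero_iff] using h
      simp [ENNReal.top_mul this]
  refine (hle s).trans ?_
  have h3 : s ∩ (chartAt (EuclideanSpace ℝ (Fin n)) x₀).sourceᶜ = ∅ := by
    rw [← sdiff_eq, sdiff_eq_empty]; exact h₀
  simp [Measure.restrict_apply hs, h3]

theorem restrict_riemVolume (x₀ : M) {s : Set M} (hs : MeasurableSet s)
    (h₀ : s ⊆ (chartAt (EuclideanSpace ℝ (Fin n)) x₀).source) :
    (riemVolume g).restrict s = (chartVolume g x₀).restrict s := by
  ext t ht
  rw [Measure.restrict_apply ht, Measure.restrict_apply ht,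
    riemVolume_apply g x₀ (ht.inter hs) (inter_subset_right.trans h₀)]

/-- The change of variables formula for the Riemannian volume. -/
theorem setLIntegral_riemVolume (x₀ : M) {s : Set M} (hs : MeasurableSet s)
    (h₀ : s ⊆ (chartAt (EuclideanSpace ℝ (Fin n)) x₀).source) {F : M → ℝ≥0∞} (hF : Measurable F) :
    ∫⁻ x in s, F x ∂(riemVolume g) = ∫⁻ y in (chartAt (EuclideanSpace ℝ (Fin n)) x₀).target ∩
      (chartAt (EuclideanSpace ℝ (Fin n)) x₀).symm ⁻¹' s,
      chartDensity g x₀ y * F ((chartAt (EuclideanSpace ℝ (Fin n)) x₀).symm y) := by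
  have hT := (chartAt (EuclideanSpace ℝ (Fin n)) x₀).open_target.measurableSet
  have hA := measurableSet_target_inter (chartAt (EuclideanSpace ℝ (Fin n)) x₀) hs
  have hac : ((volume.restrict (chartAt (EuclideanSpace ℝ (Fin n)) x₀).target).withDensity
      (chartDensity g x₀)) ≪ volume.restrict (chartAt (EuclideanSpace ℝ (Fin n)) x₀).target :=
    withDensity_absolutelyContinuous _ _
  rw [restrict_riemVolume g x₀ hs h₀, ← lintegral_indicator hs]
  have h1 : AEMeasurable (fun y => s.indicator F ((chartAt (EuclideanSpace ℝ (Fin n)) x₀).symm y))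
      (volume.restrict (chartAt (EuclideanSpace ℝ (Fin n)) x₀).target) :=
    (hF.indicator hs).comp_aemeasurable (aemeasurable_chart_symm x₀)
  rw [chartVolume]
  refine (lintegral_map' (hF.indicator hs).aemeasurable
    ((aemeasurable_chart_symm x₀).mono_ac hac)).trans ?_
  refine (lintegral_withDensity_eq_lintegral_mul₀ (aemeasurable_chartDensity g x₀) h1).trans ?_
  rw [← lintegral_indicator hT, ← lintegral_indicator hA]
  refine lintegral_congr fun y => ?_
  by_cases hy : y ∈ (chartAt (EuclideanSpace ℝ (Fin n)) x₀).target
  · by_cases hys : (chartAt (EuclideanSpace ℝ (Fin n)) x₀).symm y ∈ s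
    · simp [indicator, hy, hys]
    · simp [indicator, hy, hys]
  · simp [indicator, hy]

end Volume

/-! ### The Dirichlet integrand in charts -/

section Hermitian

open Matrix

variable {ι : Type*} [Fintype ι]

/-- The sesquilinear form of a real matrix. -/
def hermForm (A : Matrix ι ι ℝ) (p q : ι → ℂ) : ℂ :=
  ∑ i, ∑ j, (A i j : ℂ) * p i * (starRingEnd ℂ) (q j)

theorem hermForm_eq (A : Matrix ι ι ℝ) (p q : ι → ℂ) :
    hermForm A p q = p ⬝ᵥ (A.map (algebraMap ℝ ℂ) *ᵥ star q) := by
  simp only [hermForm, dotProduct, mulVec, Finset.mul_sum]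
  refine Finset.sum_congr rfl fun i _ => Finset.sum_congr rfl fun j _ => ?_
  simp only [map_apply, Complex.coe_algebraMap, Pi.star_apply, RCLike.star_def]
  ring

theorem hermForm_conj_mul (P A : Matrix ι ι ℝ) (p q : ι → ℂ) :
    hermForm (P * A * Pᵀ) p q =
      hermForm A (fun i => ∑ k, p k * P k i) (fun i => ∑ k, q k * P k i) := by
  rw [hermForm_eq, hermForm_eq, Matrix.map_mul, Matrix.map_mul, ← mulVec_mulVec, ← mulVec_mulVec,
    dotProduct_mulVec]
  congr 1
  congr 1
  ext j
  simp only [mulVec, dotProduct, map_apply, transpose_apply, Pi.star_apply, star_sum, star_mul']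
  exact Finset.sum_congr rfl fun k _ => by simp [mul_comm]

theorem hermForm_self_re {A : Matrix ι ι ℝ} (p : ι → ℂ) :
    (hermForm A p p).re = (fun i => (p i).re) ⬝ᵥ (A *ᵥ fun i => (p i).re) +
      (fun i => (p i).im) ⬝ᵥ (A *ᵥ fun i => (p i).im) := by
  simp only [hermForm, dotProduct, mulVec, Finset.mul_sum, Complex.re_sum, ← Finset.sum_add_distrib]
  refine Finset.sum_congr rfl fun i _ => Finset.sum_congr rfl fun j _ => ?_
  simp [Complex.mul_re, Complex.mul_im]
  ring

variable [DecidableEq ι]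

/-- Cauchy-Schwarz for the form of `G`: with `w = G⁻¹ a`, `aᵢ` is the product of `w` and the `i`-th
unit vector. The proof evaluates the form on `w` minus its projection to that vector. -/
theorem sq_le_mul_dotProduct_inv {G : Matrix ι ι ℝ} (hG : G.PosDef) (a : ι → ℝ) (i : ι) :
    a i ^ 2 ≤ G i i * (a ⬝ᵥ (G⁻¹ *ᵥ a)) := by
  have hii : 0 < G i i := hG.diag_pos
  have hdet : IsUnit G.det := hG.det_pos.ne'.isUnit
  have hsymm : Gᵀ = G := by
    have h := hG.isHermitian
    rwa [Matrix.IsHermitian, conjTranspose_eq_transpose_of_trivial] at h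
  set w := G⁻¹ *ᵥ a with hw
  have hGw : G *ᵥ w = a := by rw [hw, mulVec_mulVec, mul_nonsing_inv _ hdet, one_mulVec]
  have h := hG.posSemidef.dotProduct_mulVec_nonneg (w - (a i / G i i) • Pi.single i 1)
  have h1 : w ⬝ᵥ (G *ᵥ Pi.single i 1) = a i := by
    rw [dotProduct_mulVec, ← mulVec_transpose, hsymm, hGw]; simp
  have h2 : (Pi.single i 1 : ι → ℝ) ⬝ᵥ (G *ᵥ Pi.single i 1) = G i i := by simp
  simp only [star_trivial, mulVec_sub, mulVec_smul, dotProduct_sub, sub_dotProduct, hGw,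
    dotProduct_smul, smul_dotProduct, h1, h2, single_one_dotProduct, smul_eq_mul] at h
  rw [dotProduct_comm w a] at h
  have h3 : a i / G i i * G i i = a i := div_mul_cancel₀ _ hii.ne'
  have h4 : a i / G i i * a i * G i i = a i ^ 2 := by rw [mul_right_comm, h3, sq]
  rw [h3] at h
  nlinarith [mul_nonneg hii.le h]

theorem norm_sq_le_mul_hermForm_inv {G : Matrix ι ι ℝ} (hG : G.PosDef) (p : ι → ℂ) (i : ι) :
    ‖p i‖ ^ 2 ≤ G i i * (hermForm G⁻¹ p p).re := by
  have h1 := sq_le_mul_dotProduct_inv hG (fun i => (p i).re) i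
  have h2 := sq_le_mul_dotProduct_inv hG (fun i => (p i).im) i
  rw [hermForm_self_re, mul_add, Complex.sq_norm, Complex.normSq_apply]
  linarith [sq (p i).re, sq (p i).im]

end Hermitian

/-! ### Smooth functions and their gradients in a chart -/

section Gradient

variable {n : ℕ} {M : Type*} [TopologicalSpace M]
  [ChartedSpace (EuclideanSpace ℝ (Fin n)) M]

/-- A smooth function in the coordinates of a chart. -/
def inChart (φ : SmoothFn n M) (x₀ : M) (y : EuclideanSpace ℝ (Fin n)) : ℂ :=
  φ ((chartAt (EuclideanSpace ℝ (Fin n)) x₀).symm y)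

/-- Complex multiples of smooth functions. -/
instance : Module ℂ (SmoothFn n M) where
  smul c φ := ⟨fun x => c * φ x, (contDiff_const.mul contDiff_id).contMDiff.comp φ.contMDiff⟩
  one_smul φ := ContMDiffMap.ext fun x => one_mul (φ x)
  mul_smul a b φ := ContMDiffMap.ext fun x => mul_assoc a b (φ x)
  smul_zero a := ContMDiffMap.ext fun _ => mul_zero a
  smul_add a φ ψ := ContMDiffMap.ext fun x => mul_add a (φ x) (ψ x)
  add_smul a b φ := ContMDiffMap.ext fun x => add_mul a b (φ x)
  zero_smul _ := ContMDiffMap.ext fun _ => zero_mul _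

theorem partialDeriv_add (φ ψ : SmoothFn n M) (x : M) (i : Fin n) :
    partialDeriv (φ + ψ) x i = partialDeriv φ x i + partialDeriv ψ x i := by
  have h1 : MDifferentiableAt (𝓡 n) 𝓘(ℝ, ℂ) φ x := φ.contMDiff.mdifferentiable (by simp) _
  have h2 : MDifferentiableAt (𝓡 n) 𝓘(ℝ, ℂ) ψ x := ψ.contMDiff.mdifferentiable (by simp) _
  have h3 := (h1.hasMFDerivAt.add h2.hasMFDerivAt).mfderiv
  exact congrArg (fun L => L (stdTangent x i)) h3

theorem partialDeriv_smul (c : ℂ) (φ : SmoothFn n M) (x : M) (i : Fin n) :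
    partialDeriv (c • φ) x i = c * partialDeriv φ x i := by
  have h1 : MDifferentiableAt (𝓡 n) 𝓘(ℝ, ℂ) φ x := φ.contMDiff.mdifferentiable (by simp) _
  have h2 : HasFDerivAt (fun z : ℂ => c * z) (c • (1 : ℂ →L[ℝ] ℂ)) (φ x) :=
    (hasFDerivAt_id (φ x)).const_mul c
  have h3 := (h2.hasMFDerivAt.comp x h1.hasMFDerivAt).mfderiv
  exact congrArg (fun L => L (stdTangent x i)) h3

theorem partialDeriv_one (x : M) (i : Fin n) : partialDeriv (1 : SmoothFn n M) x i = 0 := by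
  have h : mfderiv (𝓡 n) 𝓘(ℝ, ℂ) (fun _ : M => (1 : ℂ)) x = 0 := mfderiv_const
  exact congrArg (fun L => L (stdTangent x i)) h

variable [IsManifold (𝓡 n) ∞ M]

theorem contDiffOn_inChart (φ : SmoothFn n M) (x₀ : M) :
    ContDiffOn ℝ ∞ (inChart φ x₀) (chartAt (EuclideanSpace ℝ (Fin n)) x₀).target :=
  contMDiffOn_iff_contDiffOn.1 (φ.contMDiff.comp_contMDiffOn contMDiffOn_chart_symm)

theorem hasFDerivAt_inChart (φ : SmoothFn n M) (x₀ : M) {y : EuclideanSpace ℝ (Fin n)}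
    (hy : y ∈ (chartAt (EuclideanSpace ℝ (Fin n)) x₀).target) :
    HasFDerivAt (inChart φ x₀) (fderiv ℝ (inChart φ x₀) y) y :=
  (((contDiffOn_inChart φ x₀).contDiffAt ((chartAt (EuclideanSpace ℝ (Fin n)) x₀).open_target.mem_nhds
    hy)).differentiableAt (by simp)).hasFDerivAt

theorem continuousOn_fderiv_inChart (φ : SmoothFn n M) (x₀ : M) :
    ContinuousOn (fderiv ℝ (inChart φ x₀)) (chartAt (EuclideanSpace ℝ (Fin n)) x₀).target :=
  (contDiffOn_inChart φ x₀).continuousOn_fderiv_of_isOpen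
    (chartAt (EuclideanSpace ℝ (Fin n)) x₀).open_target (by simp)

theorem fderiv_inChart_apply (φ : SmoothFn n M) (x₀ : M) {y : EuclideanSpace ℝ (Fin n)}
    (hy : y ∈ (chartAt (EuclideanSpace ℝ (Fin n)) x₀).target) (i : Fin n) :
    fderiv ℝ (inChart φ x₀) y (EuclideanSpace.single i 1) =
      ∑ k, partialDeriv φ ((chartAt (EuclideanSpace ℝ (Fin n)) x₀).symm y) k *
        ((chartDeriv x₀ y (EuclideanSpace.single i 1) k : ℝ) : ℂ) := by
  set c := chartAt (EuclideanSpace ℝ (Fin n)) x₀ with hc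
  have h0 : MDifferentiableAt (𝓡 n) (𝓡 n) c.symm y :=
    mdifferentiableAt_atlas_symm (chart_mem_atlas _ x₀) hy
  have h1 : MDifferentiableAt (𝓡 n) 𝓘(ℝ, ℂ) φ (c.symm y) :=
    φ.contMDiff.mdifferentiable (by simp) _
  have h2 := mfderiv_comp y h1 h0
  have h3 : fderiv ℝ (inChart φ x₀) y = mfderiv (𝓡 n) 𝓘(ℝ, ℂ) (φ ∘ c.symm) y :=
    mfderiv_eq_fderiv.symm
  let L : EuclideanSpace ℝ (Fin n) →L[ℝ] ℂ := mfderiv (𝓡 n) 𝓘(ℝ, ℂ) φ (c.symm y)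
  have h4 : fderiv ℝ (inChart φ x₀) y (EuclideanSpace.single i 1) =
      L (chartDeriv x₀ y (EuclideanSpace.single i 1)) := by
    rw [h3, h2]; rfl
  rw [h4, eq_sum_single (chartDeriv x₀ y (EuclideanSpace.single i 1)), map_sum]
  refine Finset.sum_congr rfl fun k _ => ?_
  rw [map_smul, Complex.real_smul, mul_comm, ← eq_sum_single]
  rfl

variable (g : Metric n M)

/-- Coordinate invariance: with the Jacobian matrix `P`, the Gram matrix is `Pᵀ S P`, so `S⁻¹ = P
G⁻¹ Pᵀ`, and `P` is absorbed by the chain rule for the partial derivatives. This replaces frames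
varying with the point by the frame of one fixed chart, where continuity is visible. -/
theorem gradInner_symm_apply (φ ψ : SmoothFn n M) (x₀ : M) {y : EuclideanSpace ℝ (Fin n)}
    (hy : y ∈ (chartAt (EuclideanSpace ℝ (Fin n)) x₀).target) :
    gradInner g φ ψ ((chartAt (EuclideanSpace ℝ (Fin n)) x₀).symm y) =
      hermForm (chartGram g x₀ y)⁻¹
        (fun i => fderiv ℝ (inChart φ x₀) y (EuclideanSpace.single i 1))
        (fun i => fderiv ℝ (inChart ψ x₀) y (EuclideanSpace.single i 1)) := by
  simp only [fderiv_inChart_apply _ x₀ hy]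
  set c := chartAt (EuclideanSpace ℝ (Fin n)) x₀ with hc
  set P : Matrix (Fin n) (Fin n) ℝ :=
    Matrix.of fun k i => chartDeriv x₀ y (EuclideanSpace.single i 1) k with hP
  set S : Matrix (Fin n) (Fin n) ℝ := Matrix.of fun k l => metricForm g (c.symm y)
    (EuclideanSpace.single k 1) (EuclideanSpace.single l 1) with hS
  have hG : chartGram g x₀ y = P.transpose * S * P :=
    gram_comp (metricForm g (c.symm y)) (chartDeriv x₀ y)
  have hdet : P.det ^ 2 * S.det ≠ 0 := by
    have := (det_chartGram_pos g x₀ hy).ne'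
    rw [hG, Matrix.det_mul, Matrix.det_mul, Matrix.det_transpose] at this
    convert this using 1; ring
  have hPdet : IsUnit P.det := isUnit_iff_ne_zero.2 fun h => hdet (by simp [h])
  have hSinv : S⁻¹ = P * (chartGram g x₀ y)⁻¹ * P.transpose := by
    rw [hG, Matrix.mul_inv_rev, Matrix.mul_inv_rev, ← Matrix.mul_assoc, ← Matrix.mul_assoc,
      Matrix.mul_nonsing_inv _ hPdet, Matrix.one_mul, Matrix.mul_assoc,
      Matrix.nonsing_inv_mul _ (by rwa [Matrix.det_transpose]), Matrix.mul_one]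
  have h := hermForm_conj_mul P (chartGram g x₀ y)⁻¹ (partialDeriv φ (c.symm y))
    (partialDeriv ψ (c.symm y))
  rw [← hSinv] at h
  exact h

theorem continuous_gradInner (φ ψ : SmoothFn n M) : Continuous (gradInner g φ ψ) := by
  refine continuous_iff_continuousAt.2 fun x₀ => ?_
  set c := chartAt (EuclideanSpace ℝ (Fin n)) x₀ with hc
  have hdiff : ∀ (χ : SmoothFn n M) (i : Fin n), ContinuousOn
      (fun y => fderiv ℝ (inChart χ x₀) y (EuclideanSpace.single i 1)) c.target := fun χ i =>
    (continuousOn_fderiv_inChart χ x₀).clm_apply continuousOn_const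
  have hinv : ContinuousOn (fun y => (chartGram g x₀ y)⁻¹) c.target := by
    simp only [Matrix.inv_def, Ring.inverse_eq_inv']
    exact ((continuousOn_det_chartGram g x₀).inv₀ fun y hy => (det_chartGram_pos g x₀ hy).ne').smul
      (continuous_id.matrix_adjugate.comp_continuousOn (continuousOn_chartGram g x₀))
  have h1 : ContinuousOn (fun y => hermForm (chartGram g x₀ y)⁻¹
        (fun i => fderiv ℝ (inChart φ x₀) y (EuclideanSpace.single i 1))
        (fun i => fderiv ℝ (inChart ψ x₀) y (EuclideanSpace.single i 1))) c.target := by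
    refine continuousOn_finsetSum _ fun i _ => continuousOn_finsetSum _ fun j _ => ?_
    exact ((Complex.continuous_ofReal.comp_continuousOn
      (continuousOn_pi.1 (continuousOn_pi.1 hinv i) j)).mul (hdiff φ i)).mul
      (Complex.continuous_conj.comp_continuousOn (hdiff ψ j))
  have hx : x₀ ∈ c.source := mem_chart_source _ x₀
  refine ((h1.comp c.continuousOn c.mapsTo).congr fun x hx => ?_).continuousAt
    (c.open_source.mem_nhds hx)
  have := gradInner_symm_apply g φ ψ x₀ (c.map_source hx)
  rw [← hc, c.left_inv hx] at this
  exact this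

theorem norm_fderiv_inChart_sq_le (φ : SmoothFn n M) (x₀ : M) {y : EuclideanSpace ℝ (Fin n)}
    (hy : y ∈ (chartAt (EuclideanSpace ℝ (Fin n)) x₀).target) (i : Fin n) :
    ‖fderiv ℝ (inChart φ x₀) y (EuclideanSpace.single i 1)‖ ^ 2 ≤ chartGram g x₀ y i i *
      (gradInner g φ φ ((chartAt (EuclideanSpace ℝ (Fin n)) x₀).symm y)).re := by
  rw [gradInner_symm_apply g φ φ x₀ hy]
  exact norm_sq_le_mul_hermForm_inv (chartGram_posDef g x₀ hy)
    (fun i => fderiv ℝ (inChart φ x₀) y (EuclideanSpace.single i 1)) i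

theorem gradInner_self_re_nonneg (φ : SmoothFn n M) (x : M) : 0 ≤ (gradInner g φ φ x).re := by
  have hx := mem_chart_source (EuclideanSpace ℝ (Fin n)) x
  have hy := (chartAt (EuclideanSpace ℝ (Fin n)) x).map_source hx
  have h := gradInner_symm_apply g φ φ x hy
  rw [(chartAt (EuclideanSpace ℝ (Fin n)) x).left_inv hx] at h
  have hG := (chartGram_posDef g x hy).inv.posSemidef
  rw [h, hermForm_self_re]
  exact add_nonneg (hG.dotProduct_mulVec_nonneg _) (hG.dotProduct_mulVec_nonneg _)

theorem conj_gradInner (φ ψ : SmoothFn n M) (x : M) :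
    (starRingEnd ℂ) (gradInner g φ ψ x) = gradInner g ψ φ x := by
  set S : Matrix (Fin n) (Fin n) ℝ :=
    Matrix.of fun k l => g.inner x (stdTangent x k) (stdTangent x l) with hSdef
  have hS : S.transpose = S := by
    ext k l
    exact g.symm x _ _
  have h : ∀ i j, S⁻¹ i j = S⁻¹ j i := fun i j => by
    conv_lhs => rw [← hS, ← Matrix.transpose_nonsing_inv]
    rfl
  simp only [gradInner, ← hSdef, map_sum, map_mul, Complex.conj_ofReal, Complex.conj_conj]
  rw [Finset.sum_comm]
  refine Finset.sum_congr rfl fun i _ => Finset.sum_congr rfl fun j _ => ?_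
  rw [h j i]
  ring

theorem gradInner_add (φ ψ χ : SmoothFn n M) (x : M) :
    gradInner g (φ + ψ) χ x = gradInner g φ χ x + gradInner g ψ χ x := by
  simp only [gradInner, partialDeriv_add, mul_add, add_mul, Finset.sum_add_distrib]

theorem gradInner_smul (c : ℂ) (φ ψ : SmoothFn n M) (x : M) :
    gradInner g (c • φ) ψ x = c * gradInner g φ ψ x := by
  simp only [gradInner, partialDeriv_smul, Finset.mul_sum]
  exact Finset.sum_congr rfl fun i _ => Finset.sum_congr rfl fun j _ => by ring

theorem gradInner_one (ψ : SmoothFn n M) (x : M) : gradInner g 1 ψ x = 0 := by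
  simp [gradInner, partialDeriv_one]

end Gradient

/-! ### Chart balls -/

section ChartBall

variable {n : ℕ} {M : Type*} [TopologicalSpace M]
  [ChartedSpace (EuclideanSpace ℝ (Fin n)) M]

variable (n) in
/-- The part of `M` that the preferred chart at `x₀` maps to a ball about the image of `x₀`. -/
def chartBall (x₀ : M) (r : ℝ) : Set M :=
  (chartAt (EuclideanSpace ℝ (Fin n)) x₀).source ∩
    chartAt (EuclideanSpace ℝ (Fin n)) x₀ ⁻¹'
      Metric.ball (chartAt (EuclideanSpace ℝ (Fin n)) x₀ x₀) r

theorem isOpen_chartBall (x₀ : M) (r : ℝ) : IsOpen (chartBall n x₀ r) :=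
  (chartAt (EuclideanSpace ℝ (Fin n)) x₀).isOpen_inter_preimage Metric.isOpen_ball

theorem chartBall_mem_nhds (x₀ : M) {r : ℝ} (hr : 0 < r) : chartBall n x₀ r ∈ 𝓝 x₀ :=
  (isOpen_chartBall x₀ r).mem_nhds ⟨mem_chart_source _ x₀, Metric.mem_ball_self hr⟩

theorem target_inter_chartBall {x₀ : M} {r : ℝ}
    (h : Metric.closedBall (chartAt (EuclideanSpace ℝ (Fin n)) x₀ x₀) r ⊆
      (chartAt (EuclideanSpace ℝ (Fin n)) x₀).target) :
    (chartAt (EuclideanSpace ℝ (Fin n)) x₀).target ∩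
      (chartAt (EuclideanSpace ℝ (Fin n)) x₀).symm ⁻¹' chartBall n x₀ r =
      Metric.ball (chartAt (EuclideanSpace ℝ (Fin n)) x₀ x₀) r := by
  ext y
  simp only [chartBall, mem_inter_iff, mem_preimage]
  constructor
  · rintro ⟨hy, -, hy'⟩
    rwa [OpenPartialHomeomorph.right_inv _ hy] at hy'
  · intro hy
    have hyt := h (Metric.ball_subset_closedBall hy)
    exact ⟨hyt, OpenPartialHomeomorph.map_target _ hyt,
      by rwa [OpenPartialHomeomorph.right_inv _ hyt]⟩

variable [IsManifold (𝓡 n) ∞ M] (g : Metric n M)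

/-- In the closed ball of radius `r` the metric coefficients of the chart at `x₀` are controlled
by `A`. -/
structure IsGoodBall (x₀ : M) (r : ℝ) (A : NNReal) : Prop where
  pos : 0 < r
  closedBall_subset : Metric.closedBall (chartAt (EuclideanSpace ℝ (Fin n)) x₀ x₀) r ⊆
    (chartAt (EuclideanSpace ℝ (Fin n)) x₀).target
  density_le : ∀ y ∈ Metric.closedBall (chartAt (EuclideanSpace ℝ (Fin n)) x₀ x₀) r,
    chartDensity g x₀ y ≤ A
  one_le : ∀ y ∈ Metric.closedBall (chartAt (EuclideanSpace ℝ (Fin n)) x₀ x₀) r,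
    1 ≤ A * chartDensity g x₀ y
  gram_le : ∀ y ∈ Metric.closedBall (chartAt (EuclideanSpace ℝ (Fin n)) x₀ x₀) r, ∀ i,
    chartGram g x₀ y i i ≤ A

theorem exists_isGoodBall (x₀ : M) : ∃ r A, IsGoodBall g x₀ r A := by
  have hx := mem_chart_target (EuclideanSpace ℝ (Fin n)) x₀
  obtain ⟨r, hr, hrt⟩ := Metric.nhds_basis_closedBall.mem_iff.1
    ((chartAt (EuclideanSpace ℝ (Fin n)) x₀).open_target.mem_nhds hx)
  have hcomp := isCompact_closedBall (chartAt (EuclideanSpace ℝ (Fin n)) x₀ x₀) r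
  have hdet := ((continuousOn_det_chartGram g x₀).mono hrt).sqrt
  obtain ⟨A₁, hA₁⟩ := hcomp.exists_bound_of_continuousOn hdet
  obtain ⟨A₂, hA₂⟩ := hcomp.exists_bound_of_continuousOn (hdet.inv₀ fun y hy =>
    (Real.sqrt_pos.2 (det_chartGram_pos g x₀ (hrt hy))).ne')
  have h3 : ∀ i, ∃ A₃ : ℝ, ∀ y ∈ Metric.closedBall (chartAt (EuclideanSpace ℝ (Fin n)) x₀ x₀) r,
      ‖chartGram g x₀ y i i‖ ≤ A₃ := fun i =>
    hcomp.exists_bound_of_continuousOn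
      ((continuousOn_pi.1 (continuousOn_pi.1 (continuousOn_chartGram g x₀) i) i).mono hrt)
  choose A₃ hA₃ using h3
  set A : ℝ := |A₁| + |A₂| + ∑ i, |A₃ i| with hA
  have hs : 0 ≤ ∑ i, |A₃ i| := Finset.sum_nonneg fun i _ => abs_nonneg _
  have hA0 : 0 ≤ A := by positivity
  refine ⟨r, A.toNNReal, hr, hrt, fun y hy => ?_, fun y hy => ?_, fun y hy i => ?_⟩
  · refine ENNReal.ofReal_le_ofReal ?_
    have := (le_abs_self _).trans ((hA₁ y hy).trans (le_abs_self _))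
    linarith [abs_nonneg A₂]
  · have h0 := Real.sqrt_pos.2 (det_chartGram_pos g x₀ (hrt hy))
    have h1 := (le_abs_self _).trans ((hA₂ y hy).trans (le_abs_self _))
    have h2 : 1 ≤ A * Real.sqrt (chartGram g x₀ y).det := by
      rw [← inv_mul_cancel₀ h0.ne']
      refine mul_le_mul_of_nonneg_right ?_ h0.le
      rw [Pi.inv_apply] at h1
      linarith [abs_nonneg A₁]
    calc (1 : ℝ≥0∞) = ENNReal.ofReal 1 := by simp
      _ ≤ ENNReal.ofReal (A * Real.sqrt (chartGram g x₀ y).det) := ENNReal.ofReal_le_ofReal h2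
      _ = _ := ENNReal.ofReal_mul hA0
  · rw [Real.coe_toNNReal _ hA0]
    have h1 := (le_abs_self _).trans ((hA₃ i y hy).trans (le_abs_self _))
    have h2 : |A₃ i| ≤ ∑ i, |A₃ i| := Finset.single_le_sum (f := fun i => |A₃ i|)
      (fun i _ => abs_nonneg _) (Finset.mem_univ i)
    linarith [abs_nonneg A₁, abs_nonneg A₂]

variable {g} [MeasurableSpace M] [BorelSpace M] {x₀ : M} {r : ℝ} {A : NNReal}

theorem IsGoodBall.setLIntegral_eq (h : IsGoodBall g x₀ r A) {F : M → ℝ≥0∞} (hF : Measurable F) :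
    ∫⁻ x in chartBall n x₀ r, F x ∂(riemVolume g) =
      ∫⁻ y in Metric.ball (chartAt (EuclideanSpace ℝ (Fin n)) x₀ x₀) r,
        chartDensity g x₀ y * F ((chartAt (EuclideanSpace ℝ (Fin n)) x₀).symm y) := by
  rw [setLIntegral_riemVolume g x₀ (isOpen_chartBall x₀ r).measurableSet inter_subset_left hF,
    target_inter_chartBall h.closedBall_subset]

theorem IsGoodBall.setLIntegral_le (h : IsGoodBall g x₀ r A) {F : M → ℝ≥0∞} (hF : Measurable F) :
    ∫⁻ x in chartBall n x₀ r, F x ∂(riemVolume g) ≤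
      A * ∫⁻ y in Metric.ball (chartAt (EuclideanSpace ℝ (Fin n)) x₀ x₀) r,
        F ((chartAt (EuclideanSpace ℝ (Fin n)) x₀).symm y) := by
  rw [h.setLIntegral_eq hF, ← lintegral_const_mul' _ _ ENNReal.coe_ne_top]
  refine setLIntegral_mono' measurableSet_ball fun y hy => ?_
  gcongr
  exact h.density_le y (Metric.ball_subset_closedBall hy)

theorem IsGoodBall.le_setLIntegral (h : IsGoodBall g x₀ r A) {F : M → ℝ≥0∞} (hF : Measurable F) :
    ∫⁻ y in Metric.ball (chartAt (EuclideanSpace ℝ (Fin n)) x₀ x₀) r,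
        F ((chartAt (EuclideanSpace ℝ (Fin n)) x₀).symm y) ≤
      A * ∫⁻ x in chartBall n x₀ r, F x ∂(riemVolume g) := by
  rw [h.setLIntegral_eq hF, ← lintegral_const_mul' _ _ ENNReal.coe_ne_top]
  refine setLIntegral_mono' measurableSet_ball fun y hy => ?_
  rw [← mul_assoc]
  exact le_mul_of_one_le_left zero_le (h.one_le y (Metric.ball_subset_closedBall hy))

instance isFiniteMeasure_riemVolume [CompactSpace M] (g : Metric n M) :
    IsFiniteMeasure (riemVolume g) := by
  refine ⟨isCompact_univ.measure_lt_top_of_nhdsWithin fun x _ => ?_⟩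
  obtain ⟨r, A, h⟩ := exists_isGoodBall g x
  refine ⟨chartBall n x r, mem_nhdsWithin_of_mem_nhds (chartBall_mem_nhds x h.pos), ?_⟩
  have h1 := h.setLIntegral_le (F := fun _ => 1) measurable_const
  simp only [lintegral_const, one_mul, Measure.restrict_apply MeasurableSet.univ, univ_inter] at h1
  exact h1.trans_lt (ENNReal.mul_lt_top ENNReal.coe_lt_top measure_ball_lt_top)

theorem riemVolume_pos_of_isOpen (g : Metric n M) {U : Set M} (hU : IsOpen U) (hne : U.Nonempty) :
    0 < riemVolume g U := by
  obtain ⟨x, hx⟩ := hne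
  obtain ⟨r, A, h⟩ := exists_isGoodBall g x
  refine pos_iff_ne_zero.2 fun h0 => ?_
  have h1 := h.le_setLIntegral (F := U.indicator 1) (measurable_one.indicator hU.measurableSet)
  have h2 : ∫⁻ x in chartBall n x r, U.indicator 1 x ∂(riemVolume g) = 0 := by
    refine le_antisymm ((setLIntegral_le_lintegral _ _).trans ?_) zero_le
    rw [lintegral_indicator_one hU.measurableSet, h0]
  have h3 : IsOpen (Metric.ball (chartAt (EuclideanSpace ℝ (Fin n)) x x) r ∩
      (chartAt (EuclideanSpace ℝ (Fin n)) x).symm ⁻¹' U) :=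
    ((chartAt (EuclideanSpace ℝ (Fin n)) x).continuousOn_symm.mono
      (Metric.ball_subset_closedBall.trans h.closedBall_subset)).isOpen_inter_preimage
      Metric.isOpen_ball hU
  have h4 : 0 < volume (Metric.ball (chartAt (EuclideanSpace ℝ (Fin n)) x x) r ∩
      (chartAt (EuclideanSpace ℝ (Fin n)) x).symm ⁻¹' U) :=
    h3.measure_pos _ ⟨_, Metric.mem_ball_self h.pos, by
      simpa only [mem_preimage, OpenPartialHomeomorph.left_inv _ (mem_chart_source _ x)] using hx⟩
  rw [h2, mul_zero] at h1
  refine (h4.trans_le (le_trans ?_ h1)).false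
  rw [← setLIntegral_one]
  refine (setLIntegral_mono' h3.measurableSet fun y hy => ?_).trans
    (lintegral_mono_set inter_subset_left)
  rw [indicator_of_mem (show _ ∈ U from hy.2), Pi.one_apply]

end ChartBall

/-! ### Rellich's inequality -/

theorem norm_le_sum_norm_coord {n : ℕ} (v : EuclideanSpace ℝ (Fin n)) : ‖v‖ ≤ ∑ i, ‖v i‖ := by
  conv_lhs => rw [eq_sum_single v]
  refine (norm_sum_le _ _).trans (Finset.sum_le_sum fun i _ => ?_)
  simp [norm_smul]

/-- A bounded convex set is divided into finitely many convex pieces of small diameter. -/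
theorem exists_convex_partition {n : ℕ} {B : Set (EuclideanSpace ℝ (Fin n))}
    (hB : Bornology.IsBounded B) (hconv : Convex ℝ B) (hm : MeasurableSet B) {d : ℝ} (hd : 0 < d) :
    ∃ (ι : Type) (_ : Fintype ι) (K : ι → Set (EuclideanSpace ℝ (Fin n))),
      (∀ k, Convex ℝ (K k) ∧ MeasurableSet (K k) ∧ ∀ x ∈ K k, ∀ y ∈ K k, ‖y - x‖ ≤ d) ∧
      Pairwise (Function.onFun Disjoint K) ∧ ⋃ k, K k = B := by
  obtain ⟨R, hR⟩ := hB.exists_norm_le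
  -- Cubes of side `h` have diameter at most `n h ≤ d` by summing over coordinates; `n + 1` keeps
  -- the quotient meaningful for `n = 0`. They are half-open to be disjoint, and `N` makes the grid
  -- cover the bounded set.
  set h : ℝ := d / (n + 1) with hh
  have hn : (0 : ℝ) < n + 1 := by positivity
  have hh0 : 0 < h := div_pos hd hn
  set N : ℤ := ⌈R / h⌉ + 1 with hN
  refine ⟨Fin n → Finset.Icc (-N) N, inferInstance,
    fun k => B ∩ ⋂ i, {y | y i ∈ Ico (((k i : ℤ) : ℝ) * h) ((((k i : ℤ) : ℝ) + 1) * h)},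
    fun k => ⟨?_, ?_, ?_⟩, ?_, ?_⟩
  · refine hconv.inter (convex_iInter fun i => ?_)
    exact (convex_Ico _ _).is_linear_preimage
      (EuclideanSpace.proj (𝕜 := ℝ) i : EuclideanSpace ℝ (Fin n) →L[ℝ] ℝ).isLinear
  · refine hm.inter (MeasurableSet.iInter fun i => ?_)
    exact measurableSet_Ico.preimage (EuclideanSpace.proj (𝕜 := ℝ) i).continuous.measurable
  · rintro x ⟨-, hx⟩ y ⟨-, hy⟩
    simp only [mem_iInter, mem_ofPred_eq, mem_Ico] at hx hy
    refine (norm_le_sum_norm_coord _).trans ?_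
    calc ∑ i, ‖(y - x) i‖ ≤ ∑ _i : Fin n, h := Finset.sum_le_sum fun i _ => by
          have h1 := hx i
          have h2 := hy i
          rw [PiLp.sub_apply, Real.norm_eq_abs, abs_le]
          constructor <;> nlinarith
      _ = n * h := by simp
      _ ≤ (n + 1) * h := by nlinarith
      _ = d := by rw [hh]; field_simp
  · intro k l hkl
    refine disjoint_left.2 ?_
    rintro x ⟨-, hx⟩ ⟨-, hy⟩
    simp only [mem_iInter, mem_ofPred_eq, mem_Ico] at hx hy
    refine hkl (funext fun i => Subtype.ext ?_)
    have e : ∀ m : ℤ, (m : ℝ) * h ≤ x i ∧ x i < ((m : ℝ) + 1) * h → ⌊x i / h⌋ = m := fun m hm => by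
      rw [Int.floor_eq_iff, le_div_iff₀ hh0, div_lt_iff₀ hh0]
      exact hm
    rw [← e _ (hx i), ← e _ (hy i)]
  · refine Subset.antisymm (iUnion_subset fun k => inter_subset_left) fun x hx => ?_
    have hxi : ∀ i, ⌊x i / h⌋ ∈ Finset.Icc (-N) N := fun i => by
      have h1 : |x i| ≤ R := (PiLp.norm_apply_le x i).trans (hR x hx)
      have h2 : |x i / h| ≤ R / h := by
        rw [abs_div, abs_of_pos hh0]
        gcongr
      obtain ⟨h3, h4⟩ := abs_le.1 h2
      have h5 := Int.le_ceil (R / h)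
      rw [Finset.mem_Icc, Int.le_floor, ← Int.lt_add_one_iff, Int.floor_lt]
      push_cast [hN]
      constructor <;> linarith
    refine mem_iUnion.2 ⟨fun i => ⟨_, hxi i⟩, hx, mem_iInter.2 fun i => ?_⟩
    simp only [mem_ofPred_eq, mem_Ico]
    rw [← le_div_iff₀ hh0, ← div_lt_iff₀ hh0]
    exact ⟨Int.floor_le _, Int.lt_floor_add_one _⟩

theorem opNorm_sq_le_card_mul_sum {n : ℕ} (L : EuclideanSpace ℝ (Fin n) →L[ℝ] ℂ) :
    ‖L‖ ^ 2 ≤ n * ∑ i, ‖L (EuclideanSpace.single i 1)‖ ^ 2 := by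
  have h : ‖L‖ ≤ ∑ i, ‖L (EuclideanSpace.single i 1)‖ := by
    refine L.opNorm_le_bound (Finset.sum_nonneg fun i _ => norm_nonneg _) fun v => ?_
    conv_lhs => rw [eq_sum_single v, map_sum]
    rw [Finset.sum_mul]
    refine (norm_sum_le _ _).trans (Finset.sum_le_sum fun i _ => ?_)
    rw [map_smul, norm_smul, mul_comm]
    gcongr
    exact PiLp.norm_apply_le v i
  calc ‖L‖ ^ 2 ≤ (∑ i, ‖L (EuclideanSpace.single i 1)‖) ^ 2 := by gcongr
    _ ≤ _ := by
      simpa using sq_sum_le_card_mul_sum_sq (s := (Finset.univ : Finset (Fin n)))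
        (f := fun i => ‖L (EuclideanSpace.single i 1)‖)

theorem enorm_coe_nnreal (x : NNReal) : ‖Complex.ofReal (x : ℝ)‖ₑ = x := by
  have h : ‖Complex.ofReal (x : ℝ)‖ = x :=
    (Complex.norm_real _).trans (Real.norm_of_nonneg x.2)
  rw [← ofReal_norm, ← ENNReal.ofReal_coe_nnreal]
  exact congrArg ENNReal.ofReal h

section Rellich

variable {n : ℕ} {M : Type*} [TopologicalSpace M]
  [ChartedSpace (EuclideanSpace ℝ (Fin n)) M] [IsManifold (𝓡 n) ∞ M] {g : Metric n M}
  {x₀ : M} {r : ℝ} {A : NNReal}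

theorem IsGoodBall.enorm_fderiv_sq_le (h : IsGoodBall g x₀ r A) (φ : SmoothFn n M)
    {y : EuclideanSpace ℝ (Fin n)}
    (hy : y ∈ Metric.ball (chartAt (EuclideanSpace ℝ (Fin n)) x₀ x₀) r) :
    ‖fderiv ℝ (inChart φ x₀) y‖ₑ ^ 2 ≤ (n * n * A : NNReal) * ENNReal.ofReal
      (gradInner g φ φ ((chartAt (EuclideanSpace ℝ (Fin n)) x₀).symm y)).re := by
  have hy' := Metric.ball_subset_closedBall hy
  have hg := gradInner_self_re_nonneg g φ ((chartAt (EuclideanSpace ℝ (Fin n)) x₀).symm y)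
  have h1 : ‖fderiv ℝ (inChart φ x₀) y‖ ^ 2 ≤ (n * n * A : NNReal) *
      (gradInner g φ φ ((chartAt (EuclideanSpace ℝ (Fin n)) x₀).symm y)).re := by
    refine (opNorm_sq_le_card_mul_sum _).trans ?_
    have h2 : ∑ i, ‖fderiv ℝ (inChart φ x₀) y (EuclideanSpace.single i 1)‖ ^ 2 ≤
        ∑ _i : Fin n, (A : ℝ) *
          (gradInner g φ φ ((chartAt (EuclideanSpace ℝ (Fin n)) x₀).symm y)).re :=
      Finset.sum_le_sum fun i _ =>
        (norm_fderiv_inChart_sq_le g φ x₀ (h.closedBall_subset hy') i).trans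
          (mul_le_mul_of_nonneg_right (h.gram_le y hy' i) hg)
    refine (mul_le_mul_of_nonneg_left h2 (Nat.cast_nonneg n)).trans_eq ?_
    simp only [Finset.sum_const, Finset.card_univ, Fintype.card_fin, nsmul_eq_mul, NNReal.coe_mul,
      NNReal.coe_natCast]
    ring
  rw [← ofReal_norm, ← ENNReal.ofReal_pow (norm_nonneg _), ← ENNReal.ofReal_coe_nnreal,
    ← ENNReal.ofReal_mul NNReal.zero_le_coe]
  exact ENNReal.ofReal_le_ofReal h1

theorem IsGoodBall.integrableOn_inChart (h : IsGoodBall g x₀ r A) (φ : SmoothFn n M) :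
    IntegrableOn (inChart φ x₀) (Metric.ball (chartAt (EuclideanSpace ℝ (Fin n)) x₀ x₀) r) :=
  (((contDiffOn_inChart φ x₀).continuousOn.mono h.closedBall_subset).integrableOn_compact
    (isCompact_closedBall _ _)).mono_set Metric.ball_subset_closedBall

/-- The integral over a set in the coordinates of a chart, as a linear functional. -/
def cellFunctional (x₀ : M) (K : Set (EuclideanSpace ℝ (Fin n)))
    (hK : ∀ φ : SmoothFn n M, IntegrableOn (inChart φ x₀) K) : SmoothFn n M →ₗ[ℂ] ℂ where
  toFun φ := ∫ y in K, inChart φ x₀ y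
  map_add' φ ψ := integral_add (hK φ) (hK ψ)
  map_smul' c _ := integral_const_mul c _

variable [MeasurableSpace M] [BorelSpace M]

theorem IsGoodBall.enorm_cellFunctional_sq_le (h : IsGoodBall g x₀ r A)
    {K : Set (EuclideanSpace ℝ (Fin n))}
    (hKB : K ⊆ Metric.ball (chartAt (EuclideanSpace ℝ (Fin n)) x₀ x₀) r)
    (hK : ∀ φ : SmoothFn n M, IntegrableOn (inChart φ x₀) K) (φ : SmoothFn n M) :
    ‖cellFunctional x₀ K hK φ‖ₑ ^ 2 ≤
      volume K * (A * ∫⁻ x, ‖φ x‖ₑ ^ 2 ∂(riemVolume g)) := by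
  have hφ : Measurable fun x => ‖φ x‖ₑ ^ 2 :=
    (φ.contMDiff.continuous.measurable.enorm).pow_const 2
  calc ‖cellFunctional x₀ K hK φ‖ₑ ^ 2 ≤ (∫⁻ y in K, ‖inChart φ x₀ y‖ₑ) ^ 2 := by
        gcongr
        exact enorm_integral_le_lintegral_enorm _
    _ ≤ volume K * ∫⁻ y in K, ‖inChart φ x₀ y‖ₑ ^ 2 := by
        simpa using sq_lintegral_le (volume.restrict K) (hK φ).aestronglyMeasurable.enorm
    _ ≤ _ := by
        gcongr
        refine (lintegral_mono_set hKB).trans ((h.le_setLIntegral hφ).trans ?_)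
        exact mul_le_mul_right (setLIntegral_le_lintegral _ _) _

variable (g) in
/-- Rellich's inequality on a part `s` of `M`: up to finitely many continuous linear functionals,
the `L²` norm on `s` is small compared with the Dirichlet norm. -/
def RellichOn (s : Set M) : Prop :=
  ∀ ε : NNReal, 0 < ε → ∃ (ι : Type) (_ : Fintype ι) (L : ι → SmoothFn n M →ₗ[ℂ] ℂ),
    (∀ k, ∃ C : NNReal, ∀ φ, ‖L k φ‖ₑ ^ 2 ≤ C * ∫⁻ x, ‖φ x‖ₑ ^ 2 ∂(riemVolume g)) ∧
    ∀ φ : SmoothFn n M, ∫⁻ x in s, ‖φ x‖ₑ ^ 2 ∂(riemVolume g) ≤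
      ε * ∫⁻ x, ENNReal.ofReal (gradInner g φ φ x).re ∂(riemVolume g) + ∑ k, ‖L k φ‖ₑ ^ 2

/-- For a null cell `toNNReal` turns the infinite inverse into 0, which is harmless because the
integral vanishes. -/
theorem inv_mul_enorm_setIntegral_sq_le {X : Type*} [MeasurableSpace X] (ν : Measure X) (K : Set X)
    (f : X → ℂ) : (ν K)⁻¹ * ‖∫ x in K, f x ∂ν‖ₑ ^ 2 ≤
      ((ν K)⁻¹.toNNReal : ℝ≥0∞) * ‖∫ x in K, f x ∂ν‖ₑ ^ 2 := by
  rcases eq_or_ne (ν K) 0 with h | h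
  · simp [Measure.restrict_eq_zero.2 h]
  · rw [ENNReal.coe_toNNReal (ENNReal.inv_ne_top.2 h)]

/-- Cut the coordinate ball into convex cells of diameter at most `d` and apply the Poincaré
inequality in each. The gradient terms carry `d²`, and the cell integrals, suitably scaled, are the
functionals. -/
theorem IsGoodBall.rellichOn (h : IsGoodBall g x₀ r A) : RellichOn g (chartBall n x₀ r) := by
  intro ε hε
  -- The outer factors `A` pass from the manifold to coordinates and back, `2 · 2^n` is the Poincaré
  -- constant, and `n² A` compares the Euclidean with the Riemannian gradient. Taking `d ≤ 1` allows
  -- `d² ≤ d`, so `d² Q ≤ ε`.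
  set Q : NNReal := A * (2 * (2 ^ n * (n * n * A))) * A with hQ
  set d : NNReal := min 1 (ε / (Q + 1)) with hd
  have hd0 : 0 < d := lt_min one_pos (div_pos hε (by positivity))
  have hdQ : d ^ 2 * Q ≤ ε := by
    have h1 : d ^ 2 ≤ d := by
      rw [sq]; exact mul_le_of_le_one_left zero_le (min_le_left _ _)
    calc d ^ 2 * Q ≤ ε / (Q + 1) * (Q + 1) := by
          refine mul_le_mul (h1.trans (min_le_right _ _)) (by simp) zero_le zero_le
      _ = ε := div_mul_cancel₀ _ (by positivity)
  set B := Metric.ball (chartAt (EuclideanSpace ℝ (Fin n)) x₀ x₀) r with hB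
  obtain ⟨ι, hι, K, hK, hdisj, hU⟩ := exists_convex_partition
    (Metric.isBounded_ball (x := chartAt (EuclideanSpace ℝ (Fin n)) x₀ x₀) (r := r))
    (convex_ball _ _) measurableSet_ball (d := d) hd0
  have hKB : ∀ k, K k ⊆ B := fun k => (subset_iUnion K k).trans hU.subset
  have hKt : ∀ k, ∀ y ∈ K k, y ∈ (chartAt (EuclideanSpace ℝ (Fin n)) x₀).target := fun k y hy =>
    h.closedBall_subset (Metric.ball_subset_closedBall (hKB k hy))
  have hint : ∀ k (φ : SmoothFn n M), IntegrableOn (inChart φ x₀) (K k) := fun k φ =>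
    (h.integrableOn_inChart φ).mono_set (hKB k)
  have hfin : ∀ k, volume (K k) ≠ ⊤ := fun k =>
    ((measure_mono (hKB k)).trans_lt measure_ball_lt_top).ne
  set c : ι → NNReal := fun k => A * (2 * (volume (K k))⁻¹.toNNReal) with hc
  -- Scaling by `c + 1` suffices since `c ≤ (c + 1)²`, and it avoids a square root.
  refine ⟨ι, hι, fun k => Complex.ofReal (c k + 1 : NNReal) • cellFunctional x₀ (K k) (hint k),
    fun k => ?_, fun φ => ?_⟩
  · refine ⟨(c k + 1) ^ 2 * ((volume (K k)).toNNReal * A), fun φ => ?_⟩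
    have h1 := h.enorm_cellFunctional_sq_le (hKB k) (hint k) φ
    rw [LinearMap.smul_apply, smul_eq_mul, enorm_mul, mul_pow]
    rw [enorm_coe_nnreal, ENNReal.coe_mul, ENNReal.coe_pow, ENNReal.coe_mul,
      ENNReal.coe_toNNReal (hfin k), mul_assoc, mul_assoc]
    exact mul_le_mul_right h1 _
  · have hφ : Measurable fun x => ‖φ x‖ₑ ^ 2 :=
      (φ.contMDiff.continuous.measurable.enorm).pow_const 2
    have hgrad : Measurable fun x => ENNReal.ofReal (gradInner g φ φ x).re :=
      (Complex.continuous_re.comp (continuous_gradInner g φ φ)).measurable.ennreal_ofReal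
    have hcell : ∀ k, ∫⁻ y in K k, ‖inChart φ x₀ y‖ₑ ^ 2 ≤
        2 * ((d : ℝ≥0∞) ^ 2 * 2 ^ n * ((n * n * A : NNReal) * ∫⁻ y in K k, ENNReal.ofReal
          (gradInner g φ φ ((chartAt (EuclideanSpace ℝ (Fin n)) x₀).symm y)).re)) +
        2 * (((volume (K k))⁻¹.toNNReal : ℝ≥0∞) * ‖cellFunctional x₀ (K k) (hint k) φ‖ₑ ^ 2) := by
      intro k
      refine (lintegral_sq_le_of_convex (d := d) (hK k).1 (hK k).2.1 (hfin k) (hK k).2.2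
        (fun y hy => hasFDerivAt_inChart φ x₀ (hKt k y hy))
        ((continuousOn_fderiv_inChart φ x₀).mono (hKt k)) (hint k φ)).trans ?_
      rw [finrank_euclideanSpace_fin, ENNReal.ofReal_coe_nnreal,
        ← lintegral_const_mul' _ _ ENNReal.coe_ne_top]
      refine add_le_add ?_ (mul_le_mul_right (inv_mul_enorm_setIntegral_sq_le _ _ _) _)
      exact mul_le_mul_right (mul_le_mul_right
        (setLIntegral_mono' (hK k).2.1 fun y hy => h.enorm_fderiv_sq_le φ (hKB k hy)) _) _
    have hsum : ∀ F : EuclideanSpace ℝ (Fin n) → ℝ≥0∞,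
        ∫⁻ y in B, F y = ∑ k, ∫⁻ y in K k, F y := fun F => by
      rw [hB, ← hU, lintegral_iUnion (fun k => (hK k).2.1) hdisj, tsum_fintype]
    calc ∫⁻ x in chartBall n x₀ r, ‖φ x‖ₑ ^ 2 ∂(riemVolume g)
        ≤ A * ∫⁻ y in B, ‖inChart φ x₀ y‖ₑ ^ 2 := h.setLIntegral_le hφ
      _ ≤ A * ∑ k, (2 * ((d : ℝ≥0∞) ^ 2 * 2 ^ n * ((n * n * A : NNReal) * ∫⁻ y in K k,
          ENNReal.ofReal
            (gradInner g φ φ ((chartAt (EuclideanSpace ℝ (Fin n)) x₀).symm y)).re)) +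
          2 * (((volume (K k))⁻¹.toNNReal : ℝ≥0∞) *
            ‖cellFunctional x₀ (K k) (hint k) φ‖ₑ ^ 2)) := by
          rw [hsum]
          gcongr with k
          exact hcell k
      _ = A * (2 * ((d : ℝ≥0∞) ^ 2 * 2 ^ n * (n * n * A : NNReal))) * (∫⁻ y in B, ENNReal.ofReal
            (gradInner g φ φ ((chartAt (EuclideanSpace ℝ (Fin n)) x₀).symm y)).re) +
          ∑ k, c k * ‖cellFunctional x₀ (K k) (hint k) φ‖ₑ ^ 2 := by
          rw [Finset.sum_add_distrib, mul_add, hsum, Finset.mul_sum, Finset.mul_sum, Finset.mul_sum]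
          congr 1
          · exact Finset.sum_congr rfl fun k _ => by ring
          · refine Finset.sum_congr rfl fun k _ => ?_
            rw [hc]
            push_cast
            ring
      _ ≤ _ := by
          refine add_le_add ?_ (Finset.sum_le_sum fun k _ => ?_)
          · refine (mul_le_mul_right ((h.le_setLIntegral hgrad).trans
              (mul_le_mul_right (setLIntegral_le_lintegral _ _) _)) _).trans ?_
            rw [← mul_assoc]
            refine mul_le_mul_left ?_ _
            calc _ = ((d ^ 2 * Q : NNReal) : ℝ≥0∞) := by rw [hQ]; push_cast; ring
              _ ≤ ε := ENNReal.coe_le_coe.2 hdQ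
          · rw [LinearMap.smul_apply, smul_eq_mul, enorm_mul, mul_pow, enorm_coe_nnreal]
            refine mul_le_mul_left ?_ _
            rw [← ENNReal.coe_pow, ENNReal.coe_le_coe]
            nlinarith [sq_nonneg (c k), (zero_le : 0 ≤ c k)]

end Rellich

/-! ### The spectral theorem for the Laplace-Beltrami operator -/

section Global

theorem ofReal_norm_sq {E : Type*} [SeminormedAddCommGroup E] (x : E) :
    ENNReal.ofReal (‖x‖ ^ 2) = ‖x‖ₑ ^ 2 := by
  rw [ENNReal.ofReal_pow (norm_nonneg _), ofReal_norm]

variable {n : ℕ} {M : Type*} [TopologicalSpace M]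
  [ChartedSpace (EuclideanSpace ℝ (Fin n)) M] [IsManifold (𝓡 n) ∞ M]
  [MeasurableSpace M] (g : Metric n M)

theorem dirichlet_smul (c : ℂ) (φ ψ : SmoothFn n M) :
    dirichlet g (c • φ) ψ = c * dirichlet g φ ψ := by
  simp only [dirichlet, gradInner_smul]
  exact integral_const_mul _ _

theorem conj_dirichlet (φ ψ : SmoothFn n M) :
    (starRingEnd ℂ) (dirichlet g φ ψ) = dirichlet g ψ φ := by
  rw [dirichlet, ← integral_conj]
  simp only [conj_gradInner]
  rfl

theorem dirichlet_one (ψ : SmoothFn n M) : dirichlet g 1 ψ = 0 := by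
  simp [dirichlet, gradInner_one]

theorem RellichOn.mono {g : Metric n M} {s t : Set M} (hst : s ⊆ t) (h : RellichOn g t) :
    RellichOn g s := fun ε hε =>
  let ⟨ι, hι, L, hL, hL'⟩ := h ε hε
  ⟨ι, hι, L, hL, fun φ => (lintegral_mono_set hst).trans (hL' φ)⟩

theorem RellichOn.union {g : Metric n M} {s t : Set M} (hs : RellichOn g s) (ht : RellichOn g t) :
    RellichOn g (s ∪ t) := by
  intro ε hε
  obtain ⟨ι, hι, L, hL, hL'⟩ := hs (ε / 2) (half_pos hε)
  obtain ⟨κ, hκ, N, hN, hN'⟩ := ht (ε / 2) (half_pos hε)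
  refine ⟨ι ⊕ κ, inferInstance, Sum.elim L N, ?_, fun φ => ?_⟩
  · rintro (k | k)
    · exact hL k
    · exact hN k
  · refine (lintegral_union_le _ _ _).trans ((add_le_add (hL' φ) (hN' φ)).trans_eq ?_)
    rw [Fintype.sum_sum_type, add_add_add_comm, ← add_mul, ← ENNReal.coe_add, add_halves]
    rfl

variable [BorelSpace M] [CompactSpace M]

theorem rellichOn_univ : RellichOn g univ := by
  refine isCompact_univ.induction_on (p := RellichOn g) ?_ (fun s t hst h => h.mono hst)
    (fun s t hs ht => hs.union ht) fun x _ => ?_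
  · intro ε _
    exact ⟨Empty, inferInstance, fun k => k.elim, fun k => k.elim, fun φ => by simp⟩
  · obtain ⟨r, A, h⟩ := exists_isGoodBall g x
    exact ⟨_, mem_nhdsWithin_of_mem_nhds (chartBall_mem_nhds x h.pos), h.rellichOn⟩

theorem integrable_gradInner (φ ψ : SmoothFn n M) :
    Integrable (gradInner g φ ψ) (riemVolume g) :=
  (continuous_gradInner g φ ψ).integrable_of_hasCompactSupport (HasCompactSupport.of_compactSpace _)

theorem dirichlet_add (φ ψ χ : SmoothFn n M) :
    dirichlet g (φ + ψ) χ = dirichlet g φ χ + dirichlet g ψ χ := by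
  simp only [dirichlet, gradInner_add]
  exact integral_add (integrable_gradInner g φ χ) (integrable_gradInner g ψ χ)

theorem dirichlet_self_re (φ : SmoothFn n M) :
    (dirichlet g φ φ).re = ∫ x, (gradInner g φ φ x).re ∂(riemVolume g) :=
  (integral_re (integrable_gradInner g φ φ)).symm

theorem dirichlet_self_re_nonneg (φ : SmoothFn n M) : 0 ≤ (dirichlet g φ φ).re := by
  rw [dirichlet_self_re]
  exact integral_nonneg (gradInner_self_re_nonneg g φ)

theorem ofReal_dirichlet_self_re (φ : SmoothFn n M) : ENNReal.ofReal (dirichlet g φ φ).re =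
    ∫⁻ x, ENNReal.ofReal (gradInner g φ φ x).re ∂(riemVolume g) := by
  rw [dirichlet_self_re]
  exact ofReal_integral_eq_lintegral_ofReal (integrable_gradInner g φ φ).re
    (Eventually.of_forall (gradInner_self_re_nonneg g φ))

theorem memLp_smoothFn (φ : SmoothFn n M) : MemLp φ 2 (riemVolume g) :=
  φ.contMDiff.continuous.memLp_of_hasCompactSupport (HasCompactSupport.of_compactSpace _)

/-- The inclusion of the smooth functions in `L²(M)`. -/
def smoothToL2 : SmoothFn n M →ₗ[ℂ] L2 g where
  toFun φ := (memLp_smoothFn g φ).toLp φ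
  map_add' φ ψ := (memLp_smoothFn g φ).toLp_add (memLp_smoothFn g ψ)
  map_smul' c φ := (memLp_smoothFn g φ).toLp_const_smul c

theorem coeFn_smoothToL2 (φ : SmoothFn n M) : smoothToL2 g φ =ᵐ[riemVolume g] φ :=
  (memLp_smoothFn g φ).coeFn_toLp

theorem enorm_smoothToL2_sq (φ : SmoothFn n M) :
    ‖smoothToL2 g φ‖ₑ ^ 2 = ∫⁻ x, ‖φ x‖ₑ ^ 2 ∂(riemVolume g) := by
  rw [smoothToL2, LinearMap.coe_mk, AddHom.coe_mk, Lp.enorm_toLp]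
  have h := eLpNorm_nnreal_pow_eq_lintegral (μ := riemVolume g) (f := φ) (p := 2) (by norm_num)
  simpa using h

/-- The compactness of the inclusion of `H¹(M)` in `L²(M)`. -/
theorem exists_functionals_norm_sq_le {ε : ℝ} (hε : 0 < ε) :
    ∃ (ι : Type) (_ : Fintype ι) (L : ι → SmoothFn n M →ₗ[ℂ] ℂ) (C : ℝ),
      (∀ k φ, ‖L k φ‖ ≤ C * ‖smoothToL2 g φ‖) ∧
      ∀ φ, ‖smoothToL2 g φ‖ ^ 2 ≤ ε * (dirichlet g φ φ).re + ∑ k, ‖L k φ‖ ^ 2 := by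
  obtain ⟨ι, hι, L, hL, hL'⟩ := rellichOn_univ g ε.toNNReal (Real.toNNReal_pos.2 hε)
  choose C hC using hL
  refine ⟨ι, hι, L, Real.sqrt (∑ k, (C k : ℝ)), fun k φ => ?_, fun φ => ?_⟩
  · have h1 : ‖L k φ‖ ^ 2 ≤ C k * ‖smoothToL2 g φ‖ ^ 2 := by
      rw [← ENNReal.ofReal_le_ofReal_iff (by positivity), ENNReal.ofReal_mul NNReal.zero_le_coe,
        ofReal_norm_sq, ofReal_norm_sq, enorm_smoothToL2_sq, ENNReal.ofReal_coe_nnreal]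
      exact hC k φ
    have h2 : (C k : ℝ) ≤ ∑ k, (C k : ℝ) :=
      Finset.single_le_sum (f := fun k => (C k : ℝ)) (fun k _ => NNReal.zero_le_coe)
        (Finset.mem_univ k)
    refine le_of_sq_le_sq ?_ (by positivity)
    rw [mul_pow, Real.sq_sqrt (Finset.sum_nonneg fun k _ => NNReal.zero_le_coe)]
    exact h1.trans (mul_le_mul_of_nonneg_right h2 (sq_nonneg _))
  · have h0 := dirichlet_self_re_nonneg g φ
    rw [← ENNReal.ofReal_le_ofReal_iff (by positivity),
      ENNReal.ofReal_add (by positivity) (by positivity), ENNReal.ofReal_mul hε.le,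
      ofReal_norm_sq, enorm_smoothToL2_sq, ofReal_dirichlet_self_re,
      ENNReal.ofReal_sum_of_nonneg fun k _ => sq_nonneg _]
    simp only [ofReal_norm_sq]
    have h1 := hL' φ
    rw [setLIntegral_univ] at h1
    exact h1

/-- Continuous functions are dense in `L²` of a finite measure, and smooth functions are uniformly
dense among continuous ones: a partition of unity glues local constants, and balls are convex. -/
theorem denseRange_smoothToL2 [T2Space M] : DenseRange (smoothToL2 g) := by
  have : TopologicalSpace.MetrizableSpace M := Manifold.metrizableSpace (𝓡 n) M
  have h1 : DenseRange (ContinuousMap.toLp 2 (riemVolume g) ℂ : C(M, ℂ) →L[ℂ] L2 g) :=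
    ContinuousMap.toLp_denseRange ℂ (riemVolume g) ℂ (by simp)
  have h2 : DenseRange fun φ : SmoothFn n M => (⟨φ, φ.contMDiff.continuous⟩ : C(M, ℂ)) := by
    refine Metric.denseRange_iff.2 fun f ε hε => ?_
    obtain ⟨φ, hφ⟩ := exists_contMDiffMap_forall_mem_convex_of_local_const (𝓡 n) (n := ⊤)
      (t := fun x => Metric.ball (f x) ε) (fun x => convex_ball _ _) fun x =>
        ⟨f x, by
          have := f.continuous.continuousAt (x := x) (Metric.ball_mem_nhds _ hε)
          filter_upwards [this] with y hy
          rw [Metric.mem_ball_comm]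
          exact hy⟩
    refine ⟨φ, (ContinuousMap.dist_lt_iff hε).2 fun x => ?_⟩
    rw [dist_comm]
    exact hφ x
  exact h1.comp h2 (ContinuousLinearMap.continuous _)

/-- Positive dimension makes `M` infinite, so it contains infinitely many disjoint nonempty open
sets. Their indicators are orthogonal, and nonzero because open sets have positive volume. This is
what lets the eigenbasis be indexed by `ℕ`. -/
theorem not_finiteDimensional_L2 [T2Space M] [Nonempty M] (hn : 2 ≤ n) :
    ¬ FiniteDimensional ℂ (L2 g) := by
  intro hfin
  have : Nonempty (Fin n) := ⟨⟨0, by omega⟩⟩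
  have x₀ : M := Classical.arbitrary M
  have : Infinite M := by
    have h := infinite_of_mem_nhds _ ((chartAt (EuclideanSpace ℝ (Fin n)) x₀).open_target.mem_nhds
      (mem_chart_target _ x₀))
    rw [← OpenPartialHomeomorph.image_source_eq_target] at h
    exact (h.of_image _).mono (subset_univ _) |> Set.infinite_univ_iff.1
  obtain ⟨U, hU, hUo, hd⟩ := exists_seq_infinite_isOpen_pairwise_disjoint M
  have hm : ∀ k, MeasurableSet (U k) := fun k => (hUo k).measurableSet
  have hi : LinearIndependent ℂ fun k =>
      (indicatorConstLp 2 (hm k) (measure_ne_top (riemVolume g) (U k)) (1 : ℂ)) := by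
    refine linearIndependent_of_ne_zero_of_inner_eq_zero (𝕜 := ℂ) (fun k hk => ?_) fun k l hkl => ?_
    · have h1 := L2.inner_indicatorConstLp_one_indicatorConstLp_one (𝕜 := ℂ) (μ := riemVolume g)
        (hm k) (hm k)
      rw [hk, inner_zero_left, inter_self] at h1
      have h2 : (riemVolume g).real (U k) = 0 := by simpa using h1.symm
      rw [measureReal_eq_zero_iff] at h2
      exact (riemVolume_pos_of_isOpen g (hUo k) (hU k).nonempty).ne' h2
    · refine (L2.inner_indicatorConstLp_one_indicatorConstLp_one (hm k) (hm l)).trans ?_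
      rw [(hd hkl).inter_eq]
      simp
  exact not_finite_iff_infinite.2 (inferInstance : Infinite ℕ) hi.finite

theorem inner_smoothToL2 (ψ : SmoothFn n M) (w : L2 g) :
    ⟪smoothToL2 g ψ, w⟫_ℂ = ∫ x, w x * (starRingEnd ℂ) (ψ x) ∂(riemVolume g) := by
  rw [L2.inner_def]
  refine integral_congr_ae ?_
  filter_upwards [coeFn_smoothToL2 g ψ] with x hx
  rw [hx, RCLike.inner_apply]

theorem tendsto_eLpNorm_of_tendsto_smoothToL2 {φ : ℕ → SmoothFn n M} {u : L2 g}
    (h : Tendsto (fun m => smoothToL2 g (φ m)) atTop (𝓝 u)) :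
    Tendsto (fun m => eLpNorm (fun x => φ m x - u x) 2 (riemVolume g)) atTop (𝓝 0) := by
  refine ((Lp.tendsto_Lp_iff_tendsto_eLpNorm' _ _).1 h).congr fun m => eLpNorm_congr_ae ?_
  filter_upwards [coeFn_smoothToL2 g (φ m)] with x hx
  rw [Pi.sub_apply, hx]

/-- The Laplace-Beltrami operator of a closed manifold has discrete spectrum. -/
theorem nonempty_eigenBasis [T2Space M] [Nonempty M] (hn : 2 ≤ n) : Nonempty (EigenBasis g) := by
  have hone : smoothToL2 g 1 ≠ 0 := fun h => by
    have h1 := enorm_smoothToL2_sq g (1 : SmoothFn n M)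
    have h2 := riemVolume_pos_of_isOpen g isOpen_univ univ_nonempty
    rw [h] at h1
    simp [ContMDiffMap.coe_one] at h1
    exact h2.ne h1
  obtain ⟨b, lam, hmono, hlim, h0, h⟩ := exists_hilbertBasis_of_form
    (not_finiteDimensional_L2 g hn) (smoothToL2 g) (denseRange_smoothToL2 g) (dirichlet g)
    (dirichlet_add g) (dirichlet_smul g) (conj_dirichlet g) (dirichlet_self_re_nonneg g)
    (fun ε hε => exists_functionals_norm_sq_le g hε) 1 hone (dirichlet_one g)
  refine ⟨⟨b, lam, fun k => ?_, h0, hmono, hlim⟩⟩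
  obtain ⟨φ, h1, h2, h3⟩ := h k
  refine ⟨φ, tendsto_eLpNorm_of_tendsto_smoothToL2 g h1, h2, fun ψ => ?_⟩
  rw [← inner_smoothToL2, inner_smul_right]
  exact h3 ψ

end Global

end

end FracSchrodinger

theorem proposition3p1 {n : ℕ} (hn : 2 ≤ n) {M : Type*} [TopologicalSpace M] [T2Space M]
    [CompactSpace M] [Nonempty M] [ChartedSpace (EuclideanSpace ℝ (Fin n)) M]
    [IsManifold (𝓡 n) ∞ M] [MeasurableSpace M] [BorelSpace M]
    (g : FracSchrodinger.Metric n M) (α β : ℝ) (hα : α ∈ Ioo (0 : ℝ) 1) (hβ : β ∈ Ioo (0 : ℝ) 1) :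
    Nonempty (FracSchrodinger.EigenBasis g) ∧
    ∀ (e : FracSchrodinger.EigenBasis g) (f : ℝ → FracSchrodinger.L2 g),
      FracSchrodinger.IsSource f →
      ∃ u : ℝ → e.H (2 * β),
        FracSchrodinger.IsSolution e α β f u ∧
        (∀ v : ℝ → e.H (2 * β), FracSchrodinger.IsSolution e α β f v → ∀ t, 0 ≤ t → v t = u t) ∧
        ∀ t, 0 ≤ t →
          HasSum (fun k => (∫ τ in (0 : ℝ)..t,
            FracSchrodinger.kernel α β (e.lam k) (t - τ) * e.coeff k (f τ)) • e.φH (2 * β) k)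
            (u t) := by
  exact ⟨FracSchrodinger.nonempty_eigenBasis g hn, fun e f hf =>
    FracSchrodinger.exists_unique_solution e hα hβ.1 hf⟩
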